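/- **Setting.** Let $\mathfrak g$ be one of the following simple complex Lie superalgebras: $\mathfrak{sl}(m|n)$ with $1\le m<n$; $\mathfrak{psl}(n|n)$ with $n\ge 2$; $\mathfrak{osp}(2|2n)$ with $n\ge 2$; $\mathfrak{osp}(1|2n)$ with $n\ge 1$; $D(2,1;\alpha)$ with $\alpha\ne 0,-1$; $F(4)$; $G(3)$. Fix a Cartan subalgebra $\mathfrak h$ and the distinguished Borel subalgebra, and let $\rho$ be its Weyl vector. Let $\lambda\in\mathfrak h^*$ be dominant integral, i.e. the simple highest weight module $L(\lambda)$ is finite-dimensional. Assume that for every integer $k\ge1$ the weight $k\lambda$ is typical, i.e. $(k\lambda+\rho,\beta)\neq0$ for every isotropic positive odd root $\beta$. **The Kus–Fourier polytope.** Let $R^+=R_0^+\sqcup R_1^+$ be the even and odd positive roots (for $\mathfrak{psl}(n|n)$ indexed by those of $\mathfrak{sl}(n|n)$). $P(\lambda)\subset\mathbb R^{R^+}$ consists of the points $s$ with $s_\beta\ge 0$ for all $\beta\in R^+$, $s_\beta\le1$ for $\beta\in R_1^+$, and the following inequalities. * *Type $A_r$ (Dyck paths).* For labels $m_1,\dots,m_r$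 and $\alpha_{i,j}=\alpha_i+\dots+\alpha_j$: for every path from a simple root $\alpha_i=\alpha_{i,i}$ to a simple root $\alpha_j$ with steps $\alpha_{p,q}\to\alpha_{p,q+1}$ or $\alpha_{p,q}\to\alpha_{p+1,q}$, the sum of $s$ along the path is at most $m_i+\dots+m_j$. * *Type $C_n$ (symplectic Dyck paths).* Let $\alpha_{i,j}=\alpha_i+\dots+\alpha_j$ for $1\le i\le j\le n$ and $\alpha_{i,2n-j}=(\alpha_i+\dots+\alpha_n)+(\alpha_{n-1}+\dots+\alpha_j)$ for $1\le i\le j<n$, so that $\alpha_{j,2n-j}=2\delta_j$; paths start at a simple root, have the same steps, and stay in the set of positive roots. For every path from $\alpha_i$ to $\alpha_j$ the sum is at most $m_i+\dots+m_j$, and for every path from $\alpha_i$ to $2\delta_j$ the sum is at most $m_i+\dots+m_n$. * $\mathfrak{sl}(m|n)$, $\mathfrak{psl}(n|n)$: the type $A_{m-1}$ and type $A_{n-1}$ inequalities for the even roots, with the labels of $\lambda$ on the two factors of $\mathfrak{sl}_m\oplus\mathfrak{sl}_n$. * $\mathfrak{osp}(2|2n)$: the type $C_n$ inequalities for the even roots,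 with the labels of $\lambda$ on $\mathfrak{sp}_{2n}$. * $\mathfrak{osp}(1|2n)$ (orthosymplectic Dyck paths): the type $C_n$ inequalities for the even roots with the labels of $\lambda$ on $\mathfrak{sp}_{2n}$, where for paths ending at $2\delta_j$ the summand $s_{\delta_j}$ of the odd root $\delta_j$ is added to the sum. * $D(2,1;\alpha)$, with even part $\mathfrak{sl}_2^{\oplus3}$ and even positive roots $2\varepsilon_1,2\varepsilon_2,2\varepsilon_3$, odd simple root $\varepsilon_1-\varepsilon_2-\varepsilon_3$: $s_{2\varepsilon_i}\le\lambda((2\varepsilon_i)^\vee)$ for $i=2,3$, and $s_\theta+\sum_{\beta\in R_1^+}s_\beta\le\lambda(\theta^\vee)$ with $\theta=2\varepsilon_1$. * $G(3)$, with even part $\mathfrak{sl}_2\oplus G_2$: $s_\theta+\sum_{\beta\in R_1^+}s_\beta\le\lambda(\theta^\vee)$, where $\theta$ is the positive root of $\mathfrak{sl}_2$, together with, for the positive roots $i\alpha_1+j\alpha_2$ of $G_2$ ($\alpha_1$ short, coordinate $s_{ij}$, labels $m_1,m_2$): $s_{10}\le m_1$, $s_{01}\le m_2$, $s_{31}+s_{21}+s_{10}\le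 m_1+m_2$, $s_{21}+s_{11}+s_{10}\le m_1+m_2$, $s_{11}+s_{01}+s_{10}\le m_1+m_2$, $s_{32}+s_{31}+s_{21}+s_{11}+s_{01}\le m_1+2m_2$, $s_{31}+s_{21}+s_{11}+s_{01}+s_{10}\le m_1+2m_2$. * $F(4)$, with even part $\mathfrak{sl}_2\oplus\mathfrak{so}_7$: $s_\theta+\sum_{\beta\in R_1^+}s_\beta\le\lambda(\theta^\vee)$, where $\theta$ is the positive root of $\mathfrak{sl}_2$, together with, for $\mathfrak{so}_7$ with simple roots $\alpha_1=\varepsilon_1-\varepsilon_2$, $\alpha_2=\varepsilon_2-\varepsilon_3$, $\alpha_3=\varepsilon_3$, labels $m_1,m_2,m_3$, and coordinates $x_{ij}$ at $\alpha_i+\dots+\alpha_j$ and $y_{ij}$ at $\varepsilon_i+\varepsilon_j$: 1. $x_{11}\le m_1$, $x_{22}\le m_2$, $x_{33}\le m_3$, $x_{11}+x_{12}+x_{22}\le m_1+m_2$; 2. $x_{22}+x_{23}+x_{33}$ and $x_{23}+y_{23}+x_{33}$ are at most $m_2+m_3$; 3. $x_{11}+x_{12}+x_{13}+x_{22}+x_{33}$,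 $x_{11}+x_{13}+x_{22}+x_{23}+x_{33}$, $x_{11}+x_{13}+y_{13}+x_{23}+x_{33}$ and $x_{11}+y_{13}+x_{23}+y_{23}+x_{33}$ are at most $m_1+m_2+m_3$; 4. $x_{11}+x_{12}+x_{13}+y_{13}+x_{22}+x_{23}+x_{33}$, $x_{11}+x_{12}+y_{13}+x_{22}+x_{23}+y_{23}+x_{33}$, $x_{12}+x_{13}+y_{13}+y_{12}+x_{22}+x_{23}+x_{33}$, $x_{12}+y_{13}+y_{12}+x_{22}+x_{23}+y_{23}+x_{33}$ and $x_{11}+x_{12}+x_{13}+2x_{22}+x_{23}+x_{33}$ are at most $m_1+2m_2+m_3$; 5. $x_{11}+x_{13}+y_{13}+x_{22}+2x_{23}+y_{23}+2x_{33}$, $x_{11}+x_{12}+x_{13}+y_{13}+x_{22}+x_{23}+y_{23}+2x_{33}$ and $x_{12}+x_{13}+y_{13}+y_{12}+x_{22}+x_{23}+y_{23}+2x_{33}$ are at most $m_1+2m_2+2m_3$; 6. $x_{11}+x_{12}+x_{13}+y_{13}+2x_{22}+2x_{23}+y_{23}+2x_{33}$ and $x_{12}+x_{13}+y_{13}+y_{12}+2x_{22}+2x_{23}+y_{23}+2x_{33}$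 are at most $m_1+3m_2+2m_3$. Let $S(\lambda)$ be the set of lattice points of $P(\lambda)$, written as pairs $(I,\mathbf m)$ with $I\subseteq R_1^+$ and $\mathbf m\in\mathbb Z_{\ge0}^{R_0^+}$. In the free commutative superalgebra over $\mathbb C$ on even variables $x_\beta$ $(\beta\in R_0^+)$, $v$ and odd variables $\xi_\beta$ $(\beta\in R_1^+)$, let $$A=\mathbb C[\xi^Ix^{\mathbf m}v\mid(I,\mathbf m)\in S(\lambda)]$$ be the subalgebra generated by the monomials $\xi^Ix^{\mathbf m}v$. **Supervarieties.** For a commutative superalgebra $B$ let $K(B)$ be its localization at the even non-zero-divisors, and $J_B$ the preimage in $B$ of the ideal of $K(B)$ generated by the odd elements. $B$ is *reduced* if $J_B$ is the set of nilpotent elements and the zero-divisors of $B/J_B$ are exactly the images of the zero-divisors of $B$; it is *fermionically regular* if $B\cong\bigwedge_RM$ as a superring for a module $M$ over a commutative ring $R$. A superscheme $X$ is reduced if $\mathcal O_X(U)$ is reduced for all affine open $U$, and generically fermionically regular if the points with fermionically regular stalks are dense. A *supervariety* is a reduced, generically fermionically regular, separated superscheme of finite type over $\mathbb C$. A *supertorus*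 is an algebraic supergroup $T$ given by a Harish-Chandra pair $(T_0,\mathfrak t)$ with $T_0\cong(\mathbb C^\times)^p$ and $[\mathfrak t_0,\mathfrak t]=0$. A *faithful toric supervariety* is an irreducible supervariety $X$ with a left action of a supertorus $T$ and a $T$-equivariant open immersion $T\to X$. **Claim.** The superscheme $\operatorname{Spec}A$ is a faithful toric supervariety. -/

import Mathlib

open scoped BigOperators

noncomputable section

namespace SuperToric

universe u

/-! ### Supercommutative superalgebras over `ℂ` -/

/-- A commutative superalgebra over `ℂ`: a decomposition `A = A₀ ⊕ A₁` with
`A_i A_j ⊆ A_{i+j}` and `a b = (-1)^{|a||b|} b a` for homogeneous `a`, `b`. -/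
class SuperCommAlgebra (A : Type*) [Ring A] [Algebra ℂ A] where
  part : ZMod 2 → Submodule ℂ A
  isCompl : IsCompl (part 0) (part 1)
  one_mem : (1 : A) ∈ part 0
  mul_mem : ∀ {i j : ZMod 2} {a b : A}, a ∈ part i → b ∈ part j → a * b ∈ part (i + j)
  comm : ∀ {i j : ZMod 2} {a b : A}, a ∈ part i → b ∈ part j →
    a * b = (-1 : ℂ) ^ (i.val * j.val) • (b * a)

section Algebra

variable (A : Type*) [Ring A] [Algebra ℂ A] [SuperCommAlgebra A]

abbrev part (i : ZMod 2) : Submodule ℂ A := SuperCommAlgebra.part i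

/-- The even part `A₀`, a commutative ring. -/
def evenSub : Subalgebra ℂ A where
  carrier := part A 0
  mul_mem' {a b} ha hb := by
    have h := SuperCommAlgebra.mul_mem (A := A) (i := 0) (j := 0) ha hb
    rwa [add_zero] at h
  add_mem' ha hb := (part A 0).add_mem ha hb
  algebraMap_mem' r := by
    rw [Algebra.algebraMap_eq_smul_one]
    exact (part A 0).smul_mem r SuperCommAlgebra.one_mem

variable {A} in
theorem even_comm {a : A} (ha : a ∈ part A 0) (b : A) : a * b = b * a := by
  have hb : b ∈ part A 0 ⊔ part A 1 := by
    rw [(SuperCommAlgebra.isCompl (A := A)).sup_eq_top]; trivial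
  obtain ⟨b₀, h₀, b₁, h₁, rfl⟩ := Submodule.mem_sup.1 hb
  have e₀ := SuperCommAlgebra.comm (A := A) ha h₀
  have e₁ := SuperCommAlgebra.comm (A := A) ha h₁
  simp only [ZMod.val_zero, zero_mul, pow_zero, one_smul] at e₀ e₁
  rw [mul_add, add_mul, e₀, e₁]

instance evenCommRing : CommRing (evenSub A) :=
  { (inferInstance : Ring (evenSub A)) with
    mul_comm := fun a b => Subtype.ext (even_comm a.2 b.1) }

/-- `A` is an algebra over its (central) even part. -/
instance evenAlgebra : Algebra (evenSub A) A where
  smul r a := r.1 * a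
  algebraMap := (evenSub A).val.toRingHom
  commutes' r a := even_comm r.2 a
  smul_def' _ _ := rfl

/-- The topological space underlying the affine superscheme `Spec A`. -/
abbrev SpecTop : Type _ := PrimeSpectrum (evenSub A)

variable {A} in
/-- The homogeneous part of degree `i` of a localization `S⁻¹A`, with `S ⊆ A₀`. -/
def locPart (S : Submonoid (evenSub A)) (i : ZMod 2) : Set (LocalizedModule S A) :=
  {x | ∃ a ∈ part A i, ∃ s : S, x = LocalizedModule.mk a s}

variable {A} in
/-- The natural map `A → S⁻¹A`. -/
def toLoc (S : Submonoid (evenSub A)) : A →+* LocalizedModule S A where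
  toFun a := LocalizedModule.mk a 1
  map_one' := OreLocalization.one_def.symm
  map_mul' a b := by rw [LocalizedModule.mk_mul_mk, one_mul]
  map_zero' := LocalizedModule.zero_mk 1
  map_add' a b := by rw [LocalizedModule.mk_add_mk]; simp

/-- The stalk of the structure sheaf of `Spec A` at a point. -/
abbrev Stalk (x : SpecTop A) : Type _ := LocalizedModule x.asIdeal.primeCompl A

/-! ### Reduced and fermionically regular superrings -/

/-- The even non-zero-divisors. -/
def nonzdiv : Submonoid (evenSub A) where
  carrier := {s | ∀ a : A, s.1 * a = 0 → a = 0}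
  one_mem' a h := by simpa using h
  mul_mem' {s t} hs ht a h := ht a (hs _ (by simpa [mul_assoc] using h))

/-- The total superring of fractions `K(A)`. -/
abbrev FractionSuperring : Type _ := LocalizedModule (nonzdiv A) A

/-- The ideal `J_A`, the preimage in `A` of the ideal of `K(A)` generated by `K(A)₁`. -/
def bodyIdeal : TwoSidedIdeal A :=
  TwoSidedIdeal.comap (toLoc (nonzdiv A)) (TwoSidedIdeal.span (locPart (nonzdiv A) 1))

/-- The zero-divisors of a ring. -/
def zdiv (R : Type*) [Ring R] : Set R := {a | ∃ b : R, b ≠ 0 ∧ (a * b = 0 ∨ b * a = 0)}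

/-- A superring is reduced if `J_A` is the set of nilpotent elements and the zero-divisors of the
underlying ring `A / J_A` are exactly the classes of the zero-divisors of `A`. -/
def IsReducedSuperring : Prop :=
  (∀ a : A, a ∈ bodyIdeal A ↔ IsNilpotent a) ∧
    (bodyIdeal A).ringCon.mk' '' zdiv A = zdiv (bodyIdeal A).ringCon.Quotient

end Algebra

/-- A superring `B` with homogeneous parts `P 0`, `P 1` is fermionically regular if it is an
exterior algebra `⋀ M` of a module over a commutative ring, with its parity grading. -/
def IsFermionicallyRegular (B : Type u) [Ring B] (P : ZMod 2 → Set B) : Prop :=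
  ∃ (R M : Type u) (_ : CommRing R) (_ : AddCommGroup M) (_ : Module R M)
    (e : B ≃+* ExteriorAlgebra R M),
    ∀ (i : ZMod 2) (b : B),
      b ∈ P i ↔ e b ∈ CliffordAlgebra.evenOdd (0 : QuadraticForm R M) i

/-! ### Morphisms of affine superschemes -/

/-- Even homomorphisms of superalgebras `A → B`, that is, morphisms `Spec B → Spec A`. -/
structure SuperHom (A B : Type*) [Ring A] [Algebra ℂ A] [SuperCommAlgebra A]
    [Ring B] [Algebra ℂ B] [SuperCommAlgebra B] extends A →ₐ[ℂ] B where
  map_part : ∀ (i : ZMod 2) (a : A), a ∈ part A i → toFun a ∈ part B i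

namespace SuperHom

variable {A B : Type*} [Ring A] [Algebra ℂ A] [SuperCommAlgebra A]
  [Ring B] [Algebra ℂ B] [SuperCommAlgebra B] (φ : SuperHom A B)

/-- The induced homomorphism `A₀ → B₀`. -/
def even : evenSub A →+* evenSub B where
  toFun a := ⟨φ.toAlgHom a.1, φ.map_part 0 a.1 a.2⟩
  map_one' := Subtype.ext (map_one φ.toAlgHom)
  map_mul' a b := Subtype.ext (map_mul φ.toAlgHom a.1 b.1)
  map_zero' := Subtype.ext (map_zero φ.toAlgHom)
  map_add' a b := Subtype.ext (map_add φ.toAlgHom a.1 b.1)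

/-- The continuous map `|Spec B| → |Spec A|`. -/
def specMap : SpecTop B → SpecTop A := PrimeSpectrum.comap φ.even

/-- The map of stalks at a point `y` of `Spec B`, sending `a / s` to `φ a / φ s`. -/
def stalkMap (y : SpecTop B) (z : Stalk A (φ.specMap y)) : Stalk B y :=
  LocalizedModule.liftOn z
    (fun p => LocalizedModule.mk (φ.toAlgHom p.1)
      (⟨φ.even p.2.1, fun h => p.2.2 h⟩ : y.asIdeal.primeCompl))
    (by
      rintro ⟨a, s⟩ ⟨b, t⟩ ⟨w, hw⟩
      rw [LocalizedModule.mk_eq]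
      refine ⟨⟨φ.even w.1, fun h => w.2 h⟩, ?_⟩
      have h : w.1.1 * (t.1.1 * a) = w.1.1 * (s.1.1 * b) := hw
      have h' := congrArg φ.toAlgHom h
      simp only [map_mul] at h'
      exact h')

/-- `Spec B → Spec A` is an open immersion: an open embedding of spaces that is an isomorphism on
all stalks. -/
def IsOpenImmersion : Prop :=
  Topology.IsOpenEmbedding φ.specMap ∧ ∀ y : SpecTop B, Function.Bijective (φ.stalkMap y)

end SuperHom

/-! ### Affine supervarieties -/

section Variety

variable (A : Type u) [Ring A] [Algebra ℂ A] [SuperCommAlgebra A]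

/-- `Spec A` is reduced: `𝒪(U)` is a reduced superring for every affine open `U`. The affine open
sub-superschemes `U` are the open immersions `Spec B → Spec A`, and then `𝒪(U) = B`. -/
def SpecIsReduced : Prop :=
  ∀ (B : Type u) [Ring B] [Algebra ℂ B] [SuperCommAlgebra B] (φ : SuperHom A B),
    φ.IsOpenImmersion → IsReducedSuperring B

/-- `Spec A` is generically fermionically regular: the points with fermionically regular stalk
contain a dense set. -/
def SpecIsGFR : Prop :=
  ∃ Z : Set (SpecTop A), Dense Z ∧
    ∀ x ∈ Z, IsFermionicallyRegular (Stalk A x) (locPart x.asIdeal.primeCompl)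

/-- `Spec A` is an irreducible algebraic supervariety over `ℂ`. -/
structure IsIrreducibleSupervariety : Prop where
  irreducible : IrreducibleSpace (SpecTop A)
  reduced : SpecIsReduced A
  gfr : SpecIsGFR A
  finiteType : Algebra.FiniteType ℂ A
  /-- The diagonal is a closed immersion, so that `Spec A` is separated. -/
  separated : Function.Surjective (LinearMap.mul' ℂ A)

end Variety

/-! ### Superalgebras of (Laurent) polynomials in even and odd variables -/

/-- The superalgebra with even monomials `x^m`, `m ∈ M`, and odd variables `ξ_i`, `i ∈ ι`:
formal combinations of the `x^m` with coefficients in the exterior algebra on the `ξ_i`. It is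
`ℂ[x₁,…,x_n,ξ₁,…,ξ_q]` for `M = ℕⁿ` and `ℂ[t₁^±,…,t_p^±,ξ₁,…,ξ_q]` for `M = ℤᵖ`. -/
abbrev SuperPoly (M ι : Type*) : Type _ := AddMonoidAlgebra (ExteriorAlgebra ℂ (ι → ℂ)) M

section SuperPoly

variable {ι : Type*}

theorem ι_mul_eq (v : ι → ℂ) (x : ExteriorAlgebra ℂ (ι → ℂ)) :
    ExteriorAlgebra.ι ℂ v * x = CliffordAlgebra.involute x * ExteriorAlgebra.ι ℂ v := by
  induction x using CliffordAlgebra.induction with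
  | algebraMap r => rw [AlgHom.commutes]; exact (Algebra.commutes r _).symm
  | ι w =>
    rw [CliffordAlgebra.involute_ι, neg_mul]
    exact eq_neg_of_add_eq_zero_left (ExteriorAlgebra.ι_add_mul_swap v w)
  | mul a b ha hb => rw [← mul_assoc, ha, mul_assoc, hb, map_mul, mul_assoc]
  | add a b ha hb => rw [mul_add, ha, hb, map_add, add_mul]

/-- The even and odd elements of the exterior algebra. -/
abbrev extPart (ι : Type*) (i : ZMod 2) : Submodule ℂ (ExteriorAlgebra ℂ (ι → ℂ)) :=
  CliffordAlgebra.evenOdd (0 : QuadraticForm ℂ (ι → ℂ)) i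

theorem even_central {a : ExteriorAlgebra ℂ (ι → ℂ)} (ha : a ∈ extPart ι 0)
    (x : ExteriorAlgebra ℂ (ι → ℂ)) : a * x = x * a := by
  induction a, ha using CliffordAlgebra.even_induction with
  | algebraMap r => exact Algebra.commutes r x
  | add _ _ _ _ ha hb => rw [add_mul, mul_add, ha, hb]
  | ι_mul_ι_mul v w y _ hy =>
    have h₁ := ι_mul_eq v
    have h₂ := ι_mul_eq w
    change ∀ x, CliffordAlgebra.ι 0 v * x = _ at h₁
    change ∀ x, CliffordAlgebra.ι 0 w * x = _ at h₂
    rw [mul_assoc, hy, ← mul_assoc, mul_assoc (CliffordAlgebra.ι 0 v), h₂, ← mul_assoc, h₁,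
      CliffordAlgebra.involute_involute, mul_assoc, mul_assoc, mul_assoc]

theorem odd_mul_eq {a : ExteriorAlgebra ℂ (ι → ℂ)} (ha : a ∈ extPart ι 1)
    (x : ExteriorAlgebra ℂ (ι → ℂ)) : a * x = CliffordAlgebra.involute x * a := by
  induction a, ha using CliffordAlgebra.odd_induction with
  | ι v => exact ι_mul_eq v x
  | add _ _ _ _ ha hb => rw [add_mul, mul_add, ha, hb]
  | ι_mul_ι_mul v w y _ hy =>
    have h₁ := ι_mul_eq v
    have h₂ := ι_mul_eq w
    change ∀ x, CliffordAlgebra.ι 0 v * x = _ at h₁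
    change ∀ x, CliffordAlgebra.ι 0 w * x = _ at h₂
    rw [mul_assoc, hy, ← mul_assoc, mul_assoc (CliffordAlgebra.ι 0 v), h₂, ← mul_assoc, h₁,
      CliffordAlgebra.involute_involute, mul_assoc, mul_assoc, mul_assoc]

theorem ext_comm {i j : ZMod 2} {a b : ExteriorAlgebra ℂ (ι → ℂ)} (ha : a ∈ extPart ι i)
    (hb : b ∈ extPart ι j) : a * b = (-1 : ℂ) ^ (i.val * j.val) • (b * a) := by
  have key : ∀ k : ZMod 2, k = 0 ∨ k = 1 := by decide
  obtain rfl | rfl := key i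
  · simpa using even_central ha b
  · obtain rfl | rfl := key j
    · simpa using (even_central hb a).symm
    · have h := odd_mul_eq ha b
      rw [CliffordAlgebra.involute_eq_of_mem_odd hb] at h
      simpa [ZMod.val_one] using h

end SuperPoly

section SuperPolyParts

variable (M ι : Type*)

/-- The elements of `SuperPoly M ι` all of whose coefficients have parity `i`. -/
def polyPart (i : ZMod 2) : Submodule ℂ (SuperPoly M ι) where
  carrier := {f | ∀ m, f.coeff m ∈ extPart ι i}
  zero_mem' m := by simp
  add_mem' hf hg m := by simpa using add_mem (hf m) (hg m)
  smul_mem' c f hf m := by simpa using Submodule.smul_mem _ c (hf m)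

variable {M ι} in
theorem single_mem_polyPart {i : ZMod 2} {c : ExteriorAlgebra ℂ (ι → ℂ)} (hc : c ∈ extPart ι i)
    (m : M) : (AddMonoidAlgebra.single m c : SuperPoly M ι) ∈ polyPart M ι i := by
  classical
  intro m'
  rw [AddMonoidAlgebra.coeff_single, Finsupp.single_apply]
  split_ifs
  · exact hc
  · exact zero_mem _

variable {M ι} in
theorem polyPart_induction {i : ZMod 2} {p : SuperPoly M ι → Prop} {f : SuperPoly M ι}
    (hf : f ∈ polyPart M ι i) (h0 : p 0) (hadd : ∀ f g, p f → p g → p (f + g))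
    (hs : ∀ (m : M) (c : ExteriorAlgebra ℂ (ι → ℂ)), c ∈ extPart ι i →
      p (AddMonoidAlgebra.single m c)) : p f := by
  classical
  have hsum : f = ∑ m ∈ f.coeff.support, AddMonoidAlgebra.single m (f.coeff m) := by
    have := AddMonoidAlgebra.sum_coeff_single f
    exact this.symm
  rw [hsum]
  exact Finset.sum_induction _ p hadd h0 fun m _ => hs m _ (hf m)

instance superPoly [AddCommMonoid M] : SuperCommAlgebra (SuperPoly M ι) where
  part := polyPart M ι
  isCompl := by
    have hc := CliffordAlgebra.evenOdd_isCompl (Q := (0 : QuadraticForm ℂ (ι → ℂ)))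
    refine ⟨?_, ?_⟩
    · rw [Submodule.disjoint_def]
      intro f h₀ h₁
      ext m
      exact (Submodule.disjoint_def.1 hc.disjoint) _ (h₀ m) (h₁ m)
    · rw [codisjoint_iff, eq_top_iff]
      rintro f -
      induction f using AddMonoidAlgebra.induction_linear with
      | zero => exact zero_mem _
      | add f g hf hg => exact add_mem hf hg
      | single m c =>
        have hcm : c ∈ extPart ι 0 ⊔ extPart ι 1 := by rw [hc.sup_eq_top]; trivial
        obtain ⟨c₀, h₀, c₁, h₁, rfl⟩ := Submodule.mem_sup.1 hcm
        rw [AddMonoidAlgebra.single_add]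
        exact Submodule.add_mem_sup (single_mem_polyPart h₀ m) (single_mem_polyPart h₁ m)
  one_mem := single_mem_polyPart (Submodule.one_le.1 (CliffordAlgebra.one_le_evenOdd_zero _)) 0
  mul_mem {i j a b} ha hb := by
    refine polyPart_induction (p := fun f => f * b ∈ polyPart M ι (i + j)) ha ?_ ?_
      fun m c hc => ?_
    · rw [zero_mul]; exact zero_mem _
    · intro f g hf hg; beta_reduce at hf hg ⊢; rw [add_mul]; exact add_mem hf hg
    · refine polyPart_induction
        (p := fun g => AddMonoidAlgebra.single m c * g ∈ polyPart M ι (i + j)) hb ?_ ?_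
        fun n d hd => ?_
      · rw [mul_zero]; exact zero_mem _
      · intro f g hf hg; beta_reduce at hf hg ⊢; rw [mul_add]; exact add_mem hf hg
      · rw [AddMonoidAlgebra.single_mul_single]
        exact single_mem_polyPart (SetLike.mul_mem_graded hc hd) _
  comm {i j a b} ha hb := by
    refine polyPart_induction
      (p := fun f => f * b = (-1 : ℂ) ^ (i.val * j.val) • (b * f)) ha ?_ ?_ fun m c hc => ?_
    · rw [zero_mul, mul_zero, smul_zero]
    · intro f g hf hg; beta_reduce at hf hg ⊢; rw [add_mul, mul_add, hf, hg, smul_add]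
    · refine polyPart_induction (p := fun g => AddMonoidAlgebra.single m c * g =
        (-1 : ℂ) ^ (i.val * j.val) • (g * AddMonoidAlgebra.single m c)) hb ?_ ?_
        fun n d hd => ?_
      · rw [zero_mul, mul_zero, smul_zero]
      · intro f g hf hg; beta_reduce at hf hg ⊢; rw [add_mul, mul_add, hf, hg, smul_add]
      · rw [AddMonoidAlgebra.single_mul_single, AddMonoidAlgebra.single_mul_single,
          AddMonoidAlgebra.smul_single, ext_comm hc hd, add_comm]

end SuperPolyParts

/-- A subalgebra generated by homogeneous elements is again a commutative superalgebra. -/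
abbrev adjoinSuper {A : Type*} [Ring A] [Algebra ℂ A] [SuperCommAlgebra A] (G : Set A)
    (hG : ∀ g ∈ G, ∃ i, g ∈ part A i) : SuperCommAlgebra (Algebra.adjoin ℂ G) where
  part i := (part A i).comap (Algebra.adjoin ℂ G).val.toLinearMap
  isCompl := by
    have hc := SuperCommAlgebra.isCompl (A := A)
    refine ⟨?_, ?_⟩
    · rw [Submodule.disjoint_def]
      intro x h₀ h₁
      exact Subtype.ext ((Submodule.disjoint_def.1 hc.disjoint) _ h₀ h₁)
    · rw [codisjoint_iff, eq_top_iff]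
      rintro ⟨x, hx⟩ -
      suffices h : ∃ x₀ ∈ part A 0, ∃ x₁ ∈ part A 1, x₀ ∈ Algebra.adjoin ℂ G ∧
          x₁ ∈ Algebra.adjoin ℂ G ∧ x = x₀ + x₁ by
        obtain ⟨x₀, h₀, x₁, h₁, k₀, k₁, rfl⟩ := h
        exact Submodule.mem_sup.2 ⟨⟨x₀, k₀⟩, h₀, ⟨x₁, k₁⟩, h₁, rfl⟩
      induction hx using Algebra.adjoin_induction with
      | mem x hx =>
        obtain ⟨i, hi⟩ := hG x hx
        have key : ∀ k : ZMod 2, k = 0 ∨ k = 1 := by decide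
        obtain rfl | rfl := key i
        · exact ⟨x, hi, 0, zero_mem _, Algebra.subset_adjoin hx, zero_mem _, (add_zero x).symm⟩
        · exact ⟨0, zero_mem _, x, hi, zero_mem _, Algebra.subset_adjoin hx, (zero_add x).symm⟩
      | algebraMap r =>
        exact ⟨_, (evenSub A).algebraMap_mem r, 0, zero_mem _, Subalgebra.algebraMap_mem _ r,
          zero_mem _, (add_zero _).symm⟩
      | add x y _ _ hx hy =>
        obtain ⟨x₀, h₀, x₁, h₁, k₀, k₁, rfl⟩ := hx
        obtain ⟨y₀, h₀', y₁, h₁', k₀', k₁', rfl⟩ := hy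
        exact ⟨_, add_mem h₀ h₀', _, add_mem h₁ h₁', add_mem k₀ k₀', add_mem k₁ k₁',
          add_add_add_comm _ _ _ _⟩
      | mul x y _ _ hx hy =>
        obtain ⟨x₀, h₀, x₁, h₁, k₀, k₁, rfl⟩ := hx
        obtain ⟨y₀, h₀', y₁, h₁', k₀', k₁', rfl⟩ := hy
        refine ⟨x₀ * y₀ + x₁ * y₁, add_mem ?_ ?_, x₀ * y₁ + x₁ * y₀, add_mem ?_ ?_,
          add_mem (mul_mem k₀ k₀') (mul_mem k₁ k₁'), add_mem (mul_mem k₀ k₁') (mul_mem k₁ k₀'), ?_⟩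
        · exact SuperCommAlgebra.mul_mem (i := 0) (j := 0) h₀ h₀'
        · exact SuperCommAlgebra.mul_mem (i := 1) (j := 1) h₁ h₁'
        · exact SuperCommAlgebra.mul_mem (i := 0) (j := 1) h₀ h₁'
        · exact SuperCommAlgebra.mul_mem (i := 1) (j := 0) h₁ h₀'
        · simp only [mul_add, add_mul]; abel
  one_mem := SuperCommAlgebra.one_mem (A := A)
  mul_mem ha hb := SuperCommAlgebra.mul_mem (A := A) ha hb
  comm ha hb := Subtype.ext (SuperCommAlgebra.comm (A := A) ha hb)

section Monomial

variable {E O : Type}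

/-- The odd variable `ξ_o`. -/
def xi (o : O) : ExteriorAlgebra ℂ (O → ℂ) := by
  classical exact ExteriorAlgebra.ι ℂ (Pi.single o 1)

/-- The monomial `ξ^I x^m v` in the even variables `x_e` (`e ∈ E`), `v` and the odd variables
`ξ_o` (`o ∈ O`). The `ξ_o` are multiplied in an arbitrary fixed order, which only affects the
sign. -/
def monomial (I : Finset O) (m : E → ℕ) : SuperPoly ((E → ℕ) × ℕ) O :=
  AddMonoidAlgebra.single (m, 1) (I.toList.map xi).prod

/-- The generators `ξ^I x^m v`, `(I, m) ∈ S`. -/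
def generators (S : Set (Finset O × (E → ℕ))) : Set (SuperPoly ((E → ℕ) × ℕ) O) :=
  {f | ∃ s ∈ S, f = monomial s.1 s.2}

theorem generators_homogeneous (S : Set (Finset O × (E → ℕ))) :
    ∀ g ∈ generators S, ∃ i, g ∈ part (SuperPoly ((E → ℕ) × ℕ) O) i := by
  rintro _ ⟨⟨I, m⟩, -, rfl⟩
  suffices h : ∀ l : List O, ∃ i, (l.map xi).prod ∈ extPart O i by
    obtain ⟨i, hi⟩ := h I.toList
    exact ⟨i, single_mem_polyPart hi _⟩
  intro l
  induction l with
  | nil => exact ⟨0, Submodule.one_le.1 (CliffordAlgebra.one_le_evenOdd_zero _)⟩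
  | cons o l ih =>
    obtain ⟨i, hi⟩ := ih
    exact ⟨1 + i, SetLike.mul_mem_graded (CliffordAlgebra.ι_mem_evenOdd_one _ _) hi⟩

/-- The monomial superalgebra `ℂ[ξ^I x^m v | (I, m) ∈ S]`. -/
abbrev MonomialSuperalgebra (S : Set (Finset O × (E → ℕ))) : Type :=
  Algebra.adjoin ℂ (generators S)

instance monomialSuper (S : Set (Finset O × (E → ℕ))) :
    SuperCommAlgebra (MonomialSuperalgebra S) :=
  adjoinSuper (generators S) (generators_homogeneous S)

end Monomial

/-! ### Supertori and toric supervarieties -/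

/-- A supertorus, as a Harish-Chandra pair `(T₀, 𝔱)` with `T₀ = (ℂˣ)ᵖ` and `[𝔱₀, 𝔱] = 0`: then
`𝔱₀ = ℂᵖ`, `𝔱₁` has a basis `θ₁, …, θ_q` on which `T₀` acts trivially, and the pair is given by the
elements `[θ_i, θ_j] ∈ 𝔱₀`. The super Jacobi identity holds automatically. -/
structure Supertorus where
  p : ℕ
  q : ℕ
  bracket : Fin q → Fin q → Fin p → ℂ
  bracket_symm : ∀ i j, bracket i j = bracket j i

/-- The character `t ↦ t^m` of `(ℂˣ)ᵖ`. -/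
def torusChar {p : ℕ} (m : Fin p → ℤ) (t : Fin p → ℂˣ) : ℂ := ∏ k, ((t k ^ m k : ℂˣ) : ℂ)

/-- The pairing of a weight `m ∈ ℤᵖ` with `x ∈ 𝔱₀ = ℂᵖ`. -/
def weightPairing {p : ℕ} (m : Fin p → ℤ) (x : Fin p → ℂ) : ℂ := ∑ k, (m k : ℂ) * x k

namespace Supertorus

variable (T : Supertorus)

/-- The coordinate superalgebra `ℂ[T] = ℂ[t₁^±, …, t_p^±, ξ₁, …, ξ_q]`. -/
abbrev Coord : Type := SuperPoly (Fin T.p → ℤ) (Fin T.q)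

/-- Left translation by `t ∈ T₀` on functions on `T`: `(t · f)(x) = f(t⁻¹ x)`. -/
def translate (t : Fin T.p → ℂˣ) (f : T.Coord) : T.Coord :=
  f.coeff.sum fun m c => AddMonoidAlgebra.single m (torusChar (-m) t • c)

/-- The action of `θ_i ∈ 𝔱₁` on functions on `T` by left translation,
`½ ∑_j ξ_j ⟨t ∂/∂t, [θ_i, θ_j]⟩ - ∂/∂ξ_i`. -/
def oddField (i : Fin T.q) (f : T.Coord) : T.Coord :=
  f.coeff.sum fun m c => AddMonoidAlgebra.single m
    ((1 / 2 : ℂ) • ∑ j, weightPairing m (T.bracket i j) • (xi j * c) -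
      CliffordAlgebra.contractLeft (Q := (0 : QuadraticForm ℂ (Fin T.q → ℂ)))
        (LinearMap.proj i) c)

/-- A left action of the supertorus `T = (T₀, 𝔱)` on `Spec A`, in terms of the Harish-Chandra
pair: a rational action of `T₀` on `A` by automorphisms of superalgebras and an action of `𝔱` on
`A` by superderivations, compatible with each other. An element `x ∈ 𝔱₀` acts by the differential
of the action of `T₀`, that is, by `⟨m, x⟩` on vectors of weight `m`. -/
structure Action (A : Type*) [Ring A] [Algebra ℂ A] [SuperCommAlgebra A] where
  grp : (Fin T.p → ℂˣ) →* (A →ₐ[ℂ] A)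
  grp_part : ∀ t i a, a ∈ part A i → grp t a ∈ part A i
  rational : ∀ a : A, a ∈ Submodule.span ℂ
    {w : A | ∃ m : Fin T.p → ℤ, ∀ t, grp t w = torusChar m t • w}
  odd : Fin T.q → A →ₗ[ℂ] A
  odd_part : ∀ k i a, a ∈ part A i → odd k a ∈ part A (i + 1)
  leibniz : ∀ k (i : ZMod 2) (a b : A), a ∈ part A i →
    odd k (a * b) = odd k a * b + (-1 : ℂ) ^ i.val • (a * odd k b)
  odd_grp : ∀ k t a, odd k (grp t a) = grp t (odd k a)
  odd_odd : ∀ (k l : Fin T.q) (m : Fin T.p → ℤ) (w : A),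
    (∀ t, grp t w = torusChar m t • w) →
      odd k (odd l w) + odd l (odd k w) = weightPairing m (T.bracket k l) • w

end Supertorus

/-- `Spec A` is a faithful toric supervariety: an irreducible supervariety with a left action of a
supertorus `T` and a `T`-equivariant open immersion `T = Spec ℂ[T] → Spec A`. -/
def IsFaithfulToricSupervariety (A : Type) [Ring A] [Algebra ℂ A] [SuperCommAlgebra A] : Prop :=
  IsIrreducibleSupervariety A ∧
    ∃ (T : Supertorus) (ρ : T.Action A) (φ : SuperHom A T.Coord),
      (∀ t a, φ.toAlgHom (ρ.grp t a) = T.translate t (φ.toAlgHom a)) ∧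
      (∀ i a, φ.toAlgHom (ρ.odd i a) = T.oddField i (φ.toAlgHom a)) ∧
      φ.IsOpenImmersion

/-! ### Lie superalgebras -/

/-- A Lie superalgebra structure over `ℂ` on `g`. -/
structure LieSuperalgebra (g : Type*) [AddCommGroup g] [Module ℂ g] where
  part : ZMod 2 → Submodule ℂ g
  isCompl : IsCompl (part 0) (part 1)
  bracket : g →ₗ[ℂ] g →ₗ[ℂ] g
  bracket_mem : ∀ {i j : ZMod 2} {x y : g}, x ∈ part i → y ∈ part j → bracket x y ∈ part (i + j)
  skew : ∀ {i j : ZMod 2} {x y : g}, x ∈ part i → y ∈ part j →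
    bracket x y = -((-1 : ℂ) ^ (i.val * j.val) • bracket y x)
  jacobi : ∀ {i j : ZMod 2} {x y : g} (z : g), x ∈ part i → y ∈ part j →
    bracket x (bracket y z) =
      bracket (bracket x y) z + (-1 : ℂ) ^ (i.val * j.val) • bracket y (bracket x z)

/-- A subspace spanned by homogeneous elements. -/
def IsGradedSubspace {V : Type*} [AddCommGroup V] [Module ℂ V]
    (P : ZMod 2 → Submodule ℂ V) (U : Submodule ℂ V) : Prop :=
  U = (U ⊓ P 0) ⊔ (U ⊓ P 1)

namespace LieSuperalgebra

variable {g : Type*} [AddCommGroup g] [Module ℂ g] (L : LieSuperalgebra g)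

/-- `g` is simple: it is not abelian and has no non-trivial graded ideal. -/
def IsSimple : Prop :=
  L.bracket ≠ 0 ∧ ∀ I : Submodule ℂ g, IsGradedSubspace L.part I →
    (∀ x, ∀ y ∈ I, L.bracket x y ∈ I) → I = ⊥ ∨ I = ⊤

end LieSuperalgebra

/-! ### The types of Lie superalgebras under consideration -/

/-- `A m n` stands for `𝔰𝔩(m|n)` if `m < n` and for `𝔭𝔰𝔩(n|n)` if `m = n`; `C n` for `𝔬𝔰𝔭(2|2n)`;
`B n` for `𝔬𝔰𝔭(1|2n)`; `D21 α` for `D(2,1;α)`. The simple roots are those of the distinguished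
Borel subalgebra, in the following order, where the node with index `0` is the first one:

* `A m n`: `ε₁-ε₂, …, ε_{m-1}-ε_m, ε_m-δ₁, δ₁-δ₂, …, δ_{n-1}-δ_n`;
* `C n`: `ε-δ₁, δ₁-δ₂, …, δ_{n-1}-δ_n, 2δ_n`;
* `B n`: `δ₁-δ₂, …, δ_{n-1}-δ_n, δ_n`;
* `D21 α`: `ε₁-ε₂-ε₃, 2ε₂, 2ε₃`;
* `F4`: `½(δ-ε₁-ε₂-ε₃), ε₃, ε₂-ε₃, ε₁-ε₂`;
* `G3`: `δ+ε₃, ε₁, ε₂-ε₁`, where `ε₁+ε₂+ε₃ = 0`. -/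
inductive KFType : Type
  | A (m n : ℕ)
  | C (n : ℕ)
  | B (n : ℕ)
  | D21 (α : ℂ)
  | F4
  | G3

namespace KFType

/-- The parameters for which the type names a basic Lie superalgebra. -/
def Valid : KFType → Prop
  | A m n => 1 ≤ m ∧ m ≤ n ∧ 2 ≤ n
  | C n => 2 ≤ n
  | B n => 1 ≤ n
  | D21 α => α ≠ 0 ∧ α ≠ -1
  | F4 => True
  | G3 => True

/-- The number of simple roots. -/
def rank : KFType → ℕ
  | A m n => m + n - 1
  | C n => n + 1
  | B n => n
  | D21 _ => 3
  | F4 => 4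
  | G3 => 3

/-- The parity of the simple roots. -/
def parity : (τ : KFType) → Fin τ.rank → ZMod 2
  | A m _ => fun i => if i.1 + 1 = m then 1 else 0
  | C _ => fun i => if i.1 = 0 then 1 else 0
  | B n => fun i => if i.1 + 1 = n then 1 else 0
  | D21 _ => ![1, 0, 0]
  | F4 => ![1, 0, 0, 0]
  | G3 => ![1, 0, 0]

/-- The vector with entry `c` in position `i` and `-1` in position `i + 1`. -/
def stepVec (c : ℂ) (i k : ℕ) : ℂ := if k = i then c else if k = i + 1 then -1 else 0

/-- The Gram matrix of vectors in an orthogonal basis with squared lengths `w k`, `k < N`. -/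
def gramOf {r : ℕ} (N : ℕ) (w : ℕ → ℂ) (v : Fin r → ℕ → ℂ) : Matrix (Fin r) (Fin r) ℂ :=
  Matrix.of fun i j => ∑ k ∈ Finset.range N, w k * v i k * v j k

/-- The Gram matrix `(α_i, α_j)` of the simple roots with respect to an invariant form. The
orthogonal basis is `ε₁, …, ε_m, δ₁, …, δ_n` with `(ε_i,ε_i) = 1`, `(δ_j,δ_j) = -1` for `A m n`,
the basis `ε, δ₁, …, δ_n` with `(ε,ε) = 1`, `(δ_j,δ_j) = -1` for `C n`, and `δ₁, …, δ_n` with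
`(δ_j,δ_j) = -1` for `B n`. -/
def gram : (τ : KFType) → Matrix (Fin τ.rank) (Fin τ.rank) ℂ
  | A m n => gramOf (m + n) (fun k => if k < m then 1 else -1) fun i => stepVec 1 i.1
  | C n => gramOf (n + 1) (fun k => if k = 0 then 1 else -1) fun i =>
      stepVec (if i.1 = n then 2 else 1) i.1
  | B n => gramOf n (fun _ => -1) fun i => stepVec 1 i.1
  | D21 α => !![0, -1, -α; -1, 2, 0; -α, 0, 2 * α]
  | F4 => !![0, -1/2, 0, 0; -1/2, 1, -1, 0; 0, -1, 2, -1; 0, 0, -1, 2]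
  | G3 => !![0, 1, 0; 1, -2, 3; 0, 3, -6]

variable (τ : KFType)

/-- The factor `d_i` with `(λ, α_i) = d_i λ(h_i)`. -/
def symmetrizer (i : Fin τ.rank) : ℂ := if τ.gram i i = 0 then 1 else τ.gram i i / 2

/-- The Cartan matrix `α_j(h_i)`: here `h_i` is the coroot `2 α_i / (α_i, α_i)` if `α_i` is not
isotropic, and corresponds to `α_i` under the form otherwise. -/
def cartanMatrix : Matrix (Fin τ.rank) (Fin τ.rank) ℂ :=
  Matrix.of fun i j => τ.gram i j / τ.symmetrizer i

/-- `(λ, β)` for the weight with labels `a_i = λ(h_i)` and `β = ∑ c_i α_i`. -/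
def pairing (a : Fin τ.rank → ℂ) (c : Fin τ.rank → ℕ) : ℂ :=
  ∑ i, (c i : ℂ) * (τ.symmetrizer i * a i)

/-- `(β, β)` for `β = ∑ c_i α_i`. -/
def norm (c : Fin τ.rank → ℕ) : ℂ := ∑ i, ∑ j, (c i : ℂ) * (c j : ℂ) * τ.gram i j

/-- `(ρ, β)` for `β = ∑ c_i α_i`; recall that `(ρ, α_i) = (α_i, α_i) / 2`. -/
def rhoPairing (c : Fin τ.rank → ℕ) : ℂ := ∑ i, (c i : ℂ) * (τ.gram i i / 2)

end KFType

/-- A distinguished set of Chevalley generators of `g` of type `τ`. A simple Lie superalgebra with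
such generators is the basic Lie superalgebra of type `τ`; `rootPart c` is the sum of the root
spaces for `∑ c_i α_i`, and `rootPart 0` the Cartan subalgebra. -/
structure ChevalleyGenerators (τ : KFType) {g : Type*} [AddCommGroup g] [Module ℂ g]
    (L : LieSuperalgebra g) where
  e : Fin τ.rank → g
  f : Fin τ.rank → g
  h : Fin τ.rank → g
  e_mem : ∀ i, e i ∈ L.part (τ.parity i)
  f_mem : ∀ i, f i ∈ L.part (τ.parity i)
  bracket_e_f : ∀ i j, L.bracket (e i) (f j) = if i = j then h i else 0
  bracket_h_h : ∀ i j, L.bracket (h i) (h j) = 0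
  bracket_h_e : ∀ i j, L.bracket (h i) (e j) = τ.cartanMatrix i j • e j
  bracket_h_f : ∀ i j, L.bracket (h i) (f j) = -(τ.cartanMatrix i j • f j)
  generate : ∀ U : Submodule ℂ g, (∀ i, e i ∈ U) → (∀ i, f i ∈ U) →
    (∀ x ∈ U, ∀ y ∈ U, L.bracket x y ∈ U) → U = ⊤
  rootPart : (Fin τ.rank → ℤ) → Submodule ℂ g
  isInternal : DirectSum.IsInternal rootPart
  rootPart_bracket : ∀ {c d : Fin τ.rank → ℤ} {x y : g}, x ∈ rootPart c → y ∈ rootPart d →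
    L.bracket x y ∈ rootPart (c + d)
  e_root : ∀ i, e i ∈ rootPart (Pi.single i 1)
  f_root : ∀ i, f i ∈ rootPart (-Pi.single i 1)
  rootPart_zero : rootPart 0 = Submodule.span ℂ (Set.range h)

namespace ChevalleyGenerators

variable {τ : KFType} {g : Type*} [AddCommGroup g] [Module ℂ g] {L : LieSuperalgebra g}
  (R : ChevalleyGenerators τ L)

/-- The Cartan subalgebra. -/
abbrev cartan : Submodule ℂ g := R.rootPart 0

/-- The labels `λ(h_i)` of a weight. -/
def labels (lam : Module.Dual ℂ R.cartan) (i : Fin τ.rank) : ℂ :=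
  lam ⟨R.h i, by
    change R.h i ∈ R.rootPart 0
    rw [R.rootPart_zero]
    exact Submodule.subset_span ⟨i, rfl⟩⟩

/-- `λ` is typical: `(λ + ρ, β) ≠ 0` for every isotropic positive odd root `β`. -/
def IsTypical (lam : Module.Dual ℂ R.cartan) : Prop :=
  ∀ c : Fin τ.rank → ℕ, R.rootPart (fun i => (c i : ℤ)) ≠ ⊥ →
    ∑ i, (c i : ZMod 2) * τ.parity i = 1 → τ.norm c = 0 →
      τ.pairing (R.labels lam) c + τ.rhoPairing c ≠ 0

/-- `λ` is dominant integral: the simple highest weight module `L(λ)` with respect to the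
distinguished Borel subalgebra is finite-dimensional. That is, there is a finite-dimensional simple
`g`-supermodule `V` with a homogeneous highest weight vector `v` of weight `λ`. -/
def IsDominantIntegral (lam : Module.Dual ℂ R.cartan) : Prop :=
  ∃ (V : Type) (_ : AddCommGroup V) (_ : Module ℂ V) (_ : FiniteDimensional ℂ V)
    (P : ZMod 2 → Submodule ℂ V) (act : g →ₗ[ℂ] V →ₗ[ℂ] V),
    IsCompl (P 0) (P 1) ∧
    (∀ (i j : ZMod 2) (x : g) (v : V), x ∈ L.part i → v ∈ P j → act x v ∈ P (i + j)) ∧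
    (∀ (i j : ZMod 2) (x y : g) (v : V), x ∈ L.part i → y ∈ L.part j →
      act (L.bracket x y) v =
        act x (act y v) - (-1 : ℂ) ^ (i.val * j.val) • act y (act x v)) ∧
    (∀ U : Submodule ℂ V, IsGradedSubspace P U → (∀ x, ∀ v ∈ U, act x v ∈ U) →
      U = ⊥ ∨ U = ⊤) ∧
    ∃ v : V, v ≠ 0 ∧ (v ∈ P 0 ∨ v ∈ P 1) ∧ (∀ i, act (R.e i) v = 0) ∧
      ∀ x : R.cartan, act x.1 v = lam x • v

end ChevalleyGenerators

/-! ### The Kus–Fourier polytopes -/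

/-- The positive roots `α_{i,j} = α_i + ⋯ + α_j` of type `A_r`; indices start at `0`. -/
def ARoot (r : ℕ) : Type := {x : ℕ × ℕ // x.1 ≤ x.2 ∧ x.2 < r}

/-- The positive roots of type `C_n`. With indices starting at `0`, the pair `(i, j)` stands for
`α_i + ⋯ + α_j` if `j < n`, and, for `i ≤ j < n - 1`, the pair `(i, 2n-2-j)` for
`(α_i + ⋯ + α_{n-1}) + (α_{n-2} + ⋯ + α_j)`. Hence the simple roots are the `(j, j)`, and the long roots `2δ_j` are the `(j, 2n-2-j)`. -/
def CRoot (n : ℕ) : Type := {x : ℕ × ℕ // x.1 ≤ x.2 ∧ x.1 + x.2 + 2 ≤ 2 * n}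

/-- The steps of Dyck paths. -/
def DyckStep (x y : ℕ × ℕ) : Prop := y = (x.1, x.2 + 1) ∨ y = (x.1 + 1, x.2)

/-- The Dyck path inequalities in type `A_r`, for a weight with labels `m`: for all Dyck paths from
a simple root `α_i` to a simple root `α_j`, the sum is at most `m_i + ⋯ + m_j`. -/
def DyckA {r : ℕ} (m : ℕ → ℝ) (s : ARoot r → ℝ) : Prop :=
  ∀ (l : List (ARoot r)) (a b : ARoot r), l.IsChain (fun x y => DyckStep x.1 y.1) →
    l.head? = some a → l.getLast? = some b → a.1.1 = a.1.2 → b.1.1 = b.1.2 →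
      (l.map s).sum ≤ ∑ k ∈ Finset.Icc a.1.1 b.1.1, m k

/-- The Dyck path inequalities in type `C_n`, for a weight with labels `m`: for paths from `α_i` to
`α_j` the sum is at most `m_i + ⋯ + m_j`; for paths from `α_i` to the long root `2δ_j` the sum plus
`t_j` is at most `m_i + ⋯ + m_{n-1}`. For `t = 0` these are the symplectic Dyck paths; with `t_j`
the coordinate of the odd root `δ_j` they are the orthosymplectic ones. -/
def DyckC {n : ℕ} (m : ℕ → ℝ) (s : CRoot n → ℝ) (t : ℕ → ℝ) : Prop :=
  ∀ (l : List (CRoot n)) (a b : CRoot n), l.IsChain (fun x y => DyckStep x.1 y.1) →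
    l.head? = some a → l.getLast? = some b → a.1.1 = a.1.2 →
      (b.1.1 = b.1.2 → (l.map s).sum ≤ ∑ k ∈ Finset.Icc a.1.1 b.1.1, m k) ∧
      (b.1.1 + b.1.2 + 2 = 2 * n →
        (l.map s).sum + t b.1.1 ≤ ∑ k ∈ Finset.Icc a.1.1 (n - 1), m k)

/-- The positive roots of type `B₃`, with `α₁ = ε₁-ε₂`, `α₂ = ε₂-ε₃`, `α₃ = ε₃`: `rij` stands for
`α_i + ⋯ + α_j`, and `u23 = ε₂+ε₃`, `u13 = ε₁+ε₃`, `u12 = ε₁+ε₂`. -/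
inductive B3Root : Type
  | r11 | r12 | r13 | r22 | r23 | r33 | u23 | u13 | u12

/-- The inequalities of the polytope of type `B₃` for the weight with labels `m₁`, `m₂`, `m₃`. -/
def IneqB3 (m₁ m₂ m₃ : ℝ) (s : B3Root → ℝ) : Prop :=
  let x11 := s .r11
  let x12 := s .r12
  let x13 := s .r13
  let x22 := s .r22
  let x23 := s .r23
  let x33 := s .r33
  let y23 := s .u23
  let y13 := s .u13
  let y12 := s .u12
  x11 ≤ m₁ ∧ x22 ≤ m₂ ∧ x33 ≤ m₃ ∧
  x11 + x12 + x22 ≤ m₁ + m₂ ∧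
  x22 + x23 + x33 ≤ m₂ + m₃ ∧
  x23 + y23 + x33 ≤ m₂ + m₃ ∧
  x11 + x12 + x13 + x22 + x33 ≤ m₁ + m₂ + m₃ ∧
  x11 + x13 + x22 + x23 + x33 ≤ m₁ + m₂ + m₃ ∧
  x11 + x13 + y13 + x23 + x33 ≤ m₁ + m₂ + m₃ ∧
  x11 + y13 + x23 + y23 + x33 ≤ m₁ + m₂ + m₃ ∧
  x11 + x12 + x13 + y13 + x22 + x23 + x33 ≤ m₁ + 2 * m₂ + m₃ ∧
  x11 + x12 + y13 + x22 + x23 + y23 + x33 ≤ m₁ + 2 * m₂ + m₃ ∧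
  x12 + x13 + y13 + y12 + x22 + x23 + x33 ≤ m₁ + 2 * m₂ + m₃ ∧
  x12 + y13 + y12 + x22 + x23 + y23 + x33 ≤ m₁ + 2 * m₂ + m₃ ∧
  x11 + x12 + x13 + 2 * x22 + x23 + x33 ≤ m₁ + 2 * m₂ + m₃ ∧
  x11 + x13 + y13 + x22 + 2 * x23 + y23 + 2 * x33 ≤ m₁ + 2 * m₂ + 2 * m₃ ∧
  x11 + x12 + x13 + y13 + x22 + x23 + y23 + 2 * x33 ≤ m₁ + 2 * m₂ + 2 * m₃ ∧
  x12 + x13 + y13 + y12 + x22 + x23 + y23 + 2 * x33 ≤ m₁ + 2 * m₂ + 2 * m₃ ∧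
  x11 + x12 + x13 + y13 + 2 * x22 + 2 * x23 + y23 + 2 * x33 ≤ m₁ + 3 * m₂ + 2 * m₃ ∧
  x12 + x13 + y13 + y12 + 2 * x22 + 2 * x23 + y23 + 2 * x33 ≤ m₁ + 3 * m₂ + 2 * m₃

/-- The positive roots of type `G₂`: `rij` stands for `i α₁ + j α₂`, where `α₁` is short. -/
inductive G2Root : Type
  | r10 | r01 | r11 | r21 | r31 | r32

/-- The inequalities of the polytope of type `G₂` for the weight with labels `m₁`, `m₂`. -/
def IneqG2 (m₁ m₂ : ℝ) (s : G2Root → ℝ) : Prop :=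
  s .r10 ≤ m₁ ∧ s .r01 ≤ m₂ ∧
  s .r31 + s .r21 + s .r10 ≤ m₁ + m₂ ∧
  s .r21 + s .r11 + s .r10 ≤ m₁ + m₂ ∧
  s .r11 + s .r01 + s .r10 ≤ m₁ + m₂ ∧
  s .r32 + s .r31 + s .r21 + s .r11 + s .r01 ≤ m₁ + 2 * m₂ ∧
  s .r31 + s .r21 + s .r11 + s .r01 + s .r10 ≤ m₁ + 2 * m₂

namespace KFType

/-- The positive even roots. For `A m n` these are the positive roots of `𝔰𝔩(m) ⊕ 𝔰𝔩(n)`, and for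
`C n`, `B n` those of `𝔰𝔭(2n)`. For `D21 α` the indices `0, 1, 2` stand for `2ε₁, 2ε₂, 2ε₃`. For
`F4` and `G3` the element `none` stands for the roots `δ` and `2δ`, respectively, and the other ones
for the positive roots of `𝔰𝔬(7)` and `G₂`. -/
def EvenRoot : KFType → Type
  | A m n => ARoot (m - 1) ⊕ ARoot (n - 1)
  | C n => CRoot n
  | B n => CRoot n
  | D21 _ => Fin 3
  | F4 => Option B3Root
  | G3 => Option G2Root

/-- The positive odd roots: `ε_i - δ_j` for `A m n`; `ε ± δ_j` for `C n`; `δ_j` for `B n`;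
`ε₁ ± ε₂ ± ε₃` for `D21 α`; `½(δ ± ε₁ ± ε₂ ± ε₃)` for `F4`; `δ` and `δ ± ε_i` for `G3`. -/
def OddRoot : KFType → Type
  | A m n => Fin m × Fin n
  | C n => Fin n × Bool
  | B n => Fin n
  | D21 _ => Bool × Bool
  | F4 => Bool × Bool × Bool
  | G3 => Option (Fin 3 × Bool)

/-- The `k`-th label of a weight, as a real number. -/
def lab {r : ℕ} (a : Fin r → ℂ) (k : ℕ) : ℝ := if hk : k < r then (a ⟨k, hk⟩).re else 0

/-- The value `b = λ(β^∨) = 2 (λ, β) / (β, β)`, as a real number. -/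
def corootValue (τ : KFType) (a : Fin τ.rank → ℂ) (c : Fin τ.rank → ℕ) : ℝ :=
  (2 * τ.pairing a c / τ.norm c).re

/-- The inequalities of `P(λ)` that depend on `λ`, in terms of the labels `a_i = λ(h_i)`, the
coordinates `x` at the even and `y` at the odd positive roots. For `B n` the last label is the value
of `λ` on the coroot of the even root `2δ_n`, which is half of `a_{n-1}`. For the exceptional types
`2α₀+α₁+α₂`, `2α₀+3α₁+2α₂+α₃`, `2α₀+4α₁+2α₂` are the even roots `2ε₁`, `δ`, `2δ`, respectively. -/
def WeightIneq : (τ : KFType) → (Fin τ.rank → ℂ) → (τ.EvenRoot → ℝ) → (τ.OddRoot → ℝ) → Prop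
  | A m n, a, x, _ =>
      DyckA (r := m - 1) (lab a) (fun r => x (Sum.inl r)) ∧
      DyckA (r := n - 1) (fun k => lab a (m + k)) (fun r => x (Sum.inr r))
  | C n, a, x, _ => DyckC (n := n) (fun k => lab a (k + 1)) x 0
  | B n, a, x, y =>
      DyckC (n := n) (fun k => if k + 1 = n then lab a k / 2 else lab a k) x
        (fun j => if hj : j < n then y (⟨j, hj⟩ : Fin n) else 0)
  | D21 α, a, x, y =>
      x (1 : Fin 3) ≤ lab a 1 ∧ x (2 : Fin 3) ≤ lab a 2 ∧
      x (0 : Fin 3) + ∑ o : Bool × Bool, y o ≤ corootValue (D21 α) a ![2, 1, 1]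
  | F4, a, x, y =>
      IneqB3 (lab a 3) (lab a 2) (lab a 1) (fun r => x (some r)) ∧
      x (none : Option B3Root) + ∑ o : Bool × Bool × Bool, y o ≤ corootValue F4 a ![2, 3, 2, 1]
  | G3, a, x, y =>
      IneqG2 (lab a 1) (lab a 2) (fun r => x (some r)) ∧
      x (none : Option G2Root) + ∑ o : Option (Fin 3 × Bool), y o ≤ corootValue G3 a ![2, 4, 2]

/-- The polytope `P(λ)` in the space of real functions on the set of positive roots. -/
def polytope (τ : KFType) (a : Fin τ.rank → ℂ) : Set (τ.EvenRoot ⊕ τ.OddRoot → ℝ) :=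
  {s | (∀ r, 0 ≤ s r) ∧ (∀ o, s (Sum.inr o) ≤ 1) ∧
    τ.WeightIneq a (fun r => s (Sum.inl r)) (fun o => s (Sum.inr o))}

/-- The lattice points `(I, m)` of `P(λ)`. -/
def latticePoints (τ : KFType) (a : Fin τ.rank → ℂ) :
    Set (Finset τ.OddRoot × (τ.EvenRoot → ℕ)) :=
  {p | Sum.elim (fun r => (p.2 r : ℝ)) (Set.indicator (p.1 : Set τ.OddRoot) 1) ∈ τ.polytope a}

end KFType

end SuperToric
end

/-!
The lattice points `S` of the polytope form a finite lower set, because the inequalities have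
nonnegative coefficients and bound every coordinate. In `A = ℂ[ξ^I x^m v | (I, m) ∈ S]`, invert the
product of the generators `x^m v` with `m` zero or a unit vector. Since `S` is a lower set, `ξ_o v`
lies in `A` for every odd variable `ξ_o` that occurs, so the result is the algebra of Laurent
polynomials in the even variables that occur, with coefficients in the exterior algebra on the odd
ones. This is the coordinate ring of a supertorus `T` with zero bracket, and `T` is open in
`Spec A`. Its action extends to `Spec A` because `A` is spanned by weight vectors of `T₀` and closed
under the odd derivations `∂/∂ξ_o`, again since `S` is a lower set. Inverting the even elements of
`A` that are not nilpotent gives an exterior algebra over a field. Hence `Spec A` is irreducible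
and fermionically regular at its generic point, and every affine open inherits from `A` the
properties that make it reduced.
-/

noncomputable section

namespace SuperToric

universe u

/-! ### Parity and reduction -/

section Parity

variable {A : Type*} [Ring A] [Algebra ℂ A] [SuperCommAlgebra A]

theorem odd_mul_odd_mem {a b : A} (ha : a ∈ part A 1) (hb : b ∈ part A 1) : a * b ∈ part A 0 :=
  SuperCommAlgebra.mul_mem (i := 1) (j := 1) ha hb

theorem even_smul_mem {i : ZMod 2} (s : evenSub A) {a : A} (ha : a ∈ part A i) :
    s • a ∈ part A i := by
  have h := SuperCommAlgebra.mul_mem s.2 ha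
  rwa [zero_add] at h

theorem odd_mul_odd_comm {a b : A} (ha : a ∈ part A 1) (hb : b ∈ part A 1) :
    a * b = -(b * a) := by
  simpa [ZMod.val_one] using SuperCommAlgebra.comm ha hb

theorem odd_mul_self {a : A} (ha : a ∈ part A 1) : a * a = 0 := by
  have h : (2 : ℂ) • (a * a) = 0 := by
    rw [two_smul, ← eq_neg_iff_add_eq_zero]
    exact odd_mul_odd_comm ha ha
  exact (smul_eq_zero.1 h).resolve_left two_ne_zero

theorem isNilpotent_of_odd {a : A} (ha : a ∈ part A 1) : IsNilpotent a :=
  ⟨2, by rw [pow_two, odd_mul_self ha]⟩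

theorem isNilpotent_odd_mul_odd {a b : A} (ha : a ∈ part A 1) (hb : b ∈ part A 1) :
    IsNilpotent (a * b) :=
  ⟨2, by rw [pow_two, mul_assoc, ← mul_assoc b, odd_mul_odd_comm hb ha, neg_mul, mul_assoc a b,
    odd_mul_self hb, mul_zero, neg_zero, mul_zero]⟩

theorem isNilpotent_coe_iff {s : evenSub A} : IsNilpotent (s : A) ↔ IsNilpotent s :=
  IsNilpotent.map_iff (f := (evenSub A).val) Subtype.val_injective

/-- The projection `A → A₀` along `A₁`, which is `A₀`-linear. -/
def evenPart : A →ₗ[evenSub A] evenSub A where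
  toFun a := ⟨(part A 0).projection (part A 1) SuperCommAlgebra.isCompl a,
    Submodule.projection_apply_mem _ a⟩
  map_add' a b := Subtype.ext (map_add _ a b)
  map_smul' s a := by
    let p := (part A 0).projection (part A 1) SuperCommAlgebra.isCompl
    have hodd : p (s • (a - p a)) = 0 :=
      (Submodule.projection_apply_eq_zero_iff _).2
        (even_smul_mem s (Submodule.sub_projection_mem _ a))
    have heven : p (s • p a) = s • p a :=
      Submodule.projection_apply_of_mem_left _
        (even_smul_mem s (Submodule.projection_apply_mem _ a))
    rw [smul_sub, map_sub, heven, sub_eq_zero] at hodd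
    exact Subtype.ext hodd

theorem sub_evenPart_mem (a : A) : a - evenPart a ∈ part A 1 :=
  Submodule.sub_projection_mem _ a

theorem evenPart_coe (s : evenSub A) : evenPart (s : A) = s :=
  Subtype.ext (Submodule.projection_apply_of_mem_left _ s.2)

theorem evenPart_of_odd {a : A} (ha : a ∈ part A 1) : evenPart a = 0 :=
  Subtype.ext ((Submodule.projection_apply_eq_zero_iff _).2 ha)

theorem exists_eq_even_add_odd (a : A) : ∃ a₀ : evenSub A, ∃ a₁ ∈ part A 1, a = a₀ + a₁ :=
  ⟨evenPart a, _, sub_evenPart_mem a, (add_sub_cancel _ _).symm⟩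

theorem evenPart_even_add_odd (a₀ : evenSub A) {a₁ : A} (h₁ : a₁ ∈ part A 1) :
    evenPart (a₀ + a₁) = a₀ := by
  rw [map_add, evenPart_coe, evenPart_of_odd h₁, add_zero]

theorem isNilpotent_iff_evenPart {a : A} : IsNilpotent a ↔ IsNilpotent (evenPart a) := by
  obtain ⟨a₀, a₁, h₁, rfl⟩ := exists_eq_even_add_odd a
  have hcomm : Commute (a₀ : A) a₁ := even_comm a₀.2 a₁
  rw [evenPart_even_add_odd a₀ h₁, ← isNilpotent_coe_iff]
  refine ⟨fun h => ?_, fun h => hcomm.isNilpotent_add h (isNilpotent_of_odd h₁)⟩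
  have h' := (hcomm.add_left (Commute.refl a₁)).isNilpotent_sub h (isNilpotent_of_odd h₁)
  rwa [add_sub_cancel_right] at h'

theorem exists_evenPart_mul_eq_add_isNilpotent (a b : A) :
    ∃ n, IsNilpotent n ∧ evenPart (a * b) = evenPart a * evenPart b + n := by
  obtain ⟨a₀, a₁, ha₁, rfl⟩ := exists_eq_even_add_odd a
  obtain ⟨b₀, b₁, hb₁, rfl⟩ := exists_eq_even_add_odd b
  let n : evenSub A := ⟨a₁ * b₁, odd_mul_odd_mem ha₁ hb₁⟩
  refine ⟨n, isNilpotent_coe_iff.1 (isNilpotent_odd_mul_odd ha₁ hb₁), ?_⟩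
  have hmul : (a₀ + a₁) * (b₀ + b₁) = (↑(a₀ * b₀ + n) : A) + (a₀ • b₁ + b₀ • a₁) := by
    change _ = (a₀ : A) * b₀ + a₁ * b₁ + (a₀ * b₁ + b₀ * a₁)
    rw [even_comm b₀.2, add_mul, mul_add, mul_add]
    abel
  rw [hmul, evenPart_even_add_odd _ (add_mem (even_smul_mem _ hb₁) (even_smul_mem _ ha₁)),
    evenPart_even_add_odd a₀ ha₁, evenPart_even_add_odd b₀ hb₁]

variable (A) in
/-- The reduction of a superalgebra: the ring homomorphism onto the reduced commutative ring
`A₀ / √0` that kills the odd elements. Its kernel is the set of nilpotent elements. -/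
def reduction : A →+* evenSub A ⧸ nilradical (evenSub A) where
  toFun a := Ideal.Quotient.mk _ (evenPart a)
  map_one' := by rw [show evenPart (1 : A) = 1 from evenPart_coe 1, map_one]
  map_zero' := by rw [map_zero, map_zero]
  map_add' a b := by rw [map_add, map_add]
  map_mul' a b := by
    obtain ⟨n, hn, hmul⟩ := exists_evenPart_mul_eq_add_isNilpotent a b
    rw [hmul, map_add, map_mul, Ideal.Quotient.eq_zero_iff_mem.2 (mem_nilradical.2 hn), add_zero]

theorem reduction_eq_zero_iff {a : A} : reduction A a = 0 ↔ IsNilpotent a := by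
  rw [isNilpotent_iff_evenPart, ← mem_nilradical]
  exact Ideal.Quotient.eq_zero_iff_mem

variable (A) in
/-- The ideal generated by the odd elements. By supercommutativity the left ideal they generate is
two-sided. -/
def oddIdeal : Ideal A := Ideal.span (part A 1)

theorem odd_mem_oddIdeal {a : A} (ha : a ∈ part A 1) : a ∈ oddIdeal A := Ideal.subset_span ha

theorem isNilpotent_of_mem_oddIdeal {a : A} (ha : a ∈ oddIdeal A) : IsNilpotent a := by
  have hle : oddIdeal A ≤ RingHom.ker (reduction A) := Ideal.span_le.2 fun b hb =>
    reduction_eq_zero_iff.2 (isNilpotent_of_odd hb)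
  exact reduction_eq_zero_iff.1 (hle ha)

end Parity

section Localization

variable {A E : Type*} [Ring A] [Algebra ℂ A] [SuperCommAlgebra A] [Ring E]
  {S : Submonoid (evenSub A)}

theorem localization_mk_surjective (z : LocalizedModule S A) :
    ∃ a s, LocalizedModule.mk a s = z := by
  induction z using LocalizedModule.induction_on with
  | h a s => exact ⟨a, s, rfl⟩

theorem map_mul_eq_of_mk_eq_mk {g : A →+* E} (hg : ∀ s ∈ S, IsUnit (g s)) {a b : A} {s t : S}
    (h : LocalizedModule.mk a s = LocalizedModule.mk b t) : g t * g a = g s * g b := by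
  obtain ⟨u, hu⟩ := LocalizedModule.mk_eq.1 h
  refine (hg u u.2).mul_left_cancel ?_
  rw [← map_mul, ← map_mul, ← map_mul, ← map_mul]
  exact congrArg g hu

theorem map_even_comm (g : A →+* E) (s : evenSub A) (a : A) : g s * g a = g a * g s := by
  rw [← map_mul, ← map_mul, even_comm s.2]

/-- The extension `a / s ↦ g s ⁻¹ * g a` of `g : A →+* E` to `S⁻¹A`, as a function. -/
def localizationLiftFun (g : A →+* E) (hg : ∀ s ∈ S, IsUnit (g s)) (z : LocalizedModule S A) : E :=
  LocalizedModule.liftOn z (fun p => ↑(hg p.2 p.2.2).unit⁻¹ * g p.1) fun p q h => by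
    have hpq := map_mul_eq_of_mk_eq_mk hg (LocalizedModule.mk_eq.2 h)
    rw [Units.inv_mul_eq_iff_eq_mul, IsUnit.unit_spec]
    refine (hg q.2 q.2.2).mul_left_cancel ?_
    rw [hpq, ← mul_assoc (g q.2), map_even_comm g q.2, mul_assoc, ← mul_assoc (g q.2),
      IsUnit.mul_val_inv, one_mul]

theorem mul_localizationLiftFun_mk (g : A →+* E) (hg : ∀ s ∈ S, IsUnit (g s)) (a : A) (s : S) :
    g s * localizationLiftFun g hg (LocalizedModule.mk a s) = g a :=
  (mul_assoc _ _ _).symm.trans (by rw [IsUnit.mul_val_inv, one_mul])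

/-- The extension to `S⁻¹A` of a ring homomorphism that inverts `S`. -/
def localizationLift (g : A →+* E) (hg : ∀ s ∈ S, IsUnit (g s)) : LocalizedModule S A →+* E where
  toFun := localizationLiftFun g hg
  map_one' := by
    simpa [OreLocalization.one_def] using mul_localizationLiftFun_mk g hg 1 1
  map_zero' := by
    simpa using mul_localizationLiftFun_mk g hg 0 1
  map_add' x y := by
    obtain ⟨a, s, rfl⟩ := localization_mk_surjective x
    obtain ⟨b, t, rfl⟩ := localization_mk_surjective y
    have ha := mul_localizationLiftFun_mk g hg a s
    have hb := mul_localizationLiftFun_mk g hg b t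
    refine (hg _ (s * t).2).mul_left_cancel ?_
    rw [LocalizedModule.mk_add_mk, mul_localizationLiftFun_mk, mul_add]
    change g (t * a + s * b) = g (s * t) * _ + g (s * t) * _
    rw [map_add, map_mul, map_mul, map_mul, ← ha, ← hb, ← mul_assoc, ← mul_assoc,
      map_even_comm g t]
  map_mul' x y := by
    obtain ⟨a, s, rfl⟩ := localization_mk_surjective x
    obtain ⟨b, t, rfl⟩ := localization_mk_surjective y
    have ha := mul_localizationLiftFun_mk g hg a s
    have hb := mul_localizationLiftFun_mk g hg b t
    refine (hg _ (s * t).2).mul_left_cancel ?_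
    rw [LocalizedModule.mk_mul_mk, mul_localizationLiftFun_mk]
    change g (a * b) = g (s * t) * _
    rw [map_mul, map_mul, map_even_comm g s, mul_assoc, ← mul_assoc (g s), ha, ← mul_assoc,
      map_even_comm g t, mul_assoc, hb]

theorem mul_localizationLift_mk (g : A →+* E) (hg : ∀ s ∈ S, IsUnit (g s)) (a : A) (s : S) :
    g s * localizationLift g hg (LocalizedModule.mk a s) = g a :=
  mul_localizationLiftFun_mk g hg a s

theorem localizationLift_injective {g : A →+* E} (hg : ∀ s ∈ S, IsUnit (g s))
    (hinj : Function.Injective g) : Function.Injective (localizationLift g hg) := by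
  rw [injective_iff_map_eq_zero]
  intro z hz
  obtain ⟨a, s, rfl⟩ := localization_mk_surjective z
  have ha := mul_localizationLift_mk g hg a s
  rw [hz, mul_zero, eq_comm, map_eq_zero_iff g hinj] at ha
  rw [ha, LocalizedModule.zero_mk]

theorem localizationLift_surjective {g : A →+* E} (hg : ∀ s ∈ S, IsUnit (g s))
    (hsurj : ∀ x, ∃ s ∈ S, ∃ a, g s * x = g a) : Function.Surjective (localizationLift g hg) := by
  intro x
  obtain ⟨s, hs, a, ha⟩ := hsurj x
  refine ⟨LocalizedModule.mk a ⟨s, hs⟩, (hg s hs).mul_left_cancel ?_⟩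
  rw [ha]
  exact mul_localizationLift_mk g hg a ⟨s, hs⟩

end Localization

/-! ### Integral superrings -/

section BodyIdeal

variable {A : Type*} [Ring A] [Algebra ℂ A] [SuperCommAlgebra A]

theorem reduction_coe (s : evenSub A) : reduction A s = Ideal.Quotient.mk _ s :=
  congrArg _ (evenPart_coe s)

theorem reduction_mem_nonZeroDivisors {s : evenSub A} (hs : s ∈ nonzdiv A) :
    reduction A s ∈ nonZeroDivisors (evenSub A ⧸ nilradical (evenSub A)) := by
  rw [reduction_coe, mem_nonZeroDivisors_iff_right]
  intro x hx
  obtain ⟨c, rfl⟩ := Ideal.Quotient.mk_surjective x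
  rw [← map_mul, Ideal.Quotient.eq_zero_iff_mem, mem_nilradical] at hx
  obtain ⟨n, hn⟩ := hx
  rw [mul_comm, mul_pow] at hn
  have hc : (↑(c ^ n) : A) = 0 := pow_mem hs n _ (congrArg Subtype.val hn)
  exact Ideal.Quotient.eq_zero_iff_mem.2 ⟨n, Subtype.ext hc⟩

variable (A) in
/-- The homomorphism from the superring of fractions `K(A)` onto the total ring of fractions of the
reduction of `A`. -/
def fractionReduction :
    FractionSuperring A →+* FractionRing (evenSub A ⧸ nilradical (evenSub A)) :=
  localizationLift ((algebraMap _ _).comp (reduction A)) fun _ hs =>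
    IsLocalization.map_units (FractionRing (evenSub A ⧸ nilradical (evenSub A)))
      ⟨_, reduction_mem_nonZeroDivisors hs⟩

theorem fractionReduction_mk_eq_zero_iff {a : A} {s : nonzdiv A} :
    fractionReduction A (LocalizedModule.mk a s) = 0 ↔ IsNilpotent a := by
  let K := FractionRing (evenSub A ⧸ nilradical (evenSub A))
  have hs := IsLocalization.map_units K ⟨_, reduction_mem_nonZeroDivisors s.2⟩
  have hmk : algebraMap _ K (reduction A s) * fractionReduction A (LocalizedModule.mk a s) =
      algebraMap _ K (reduction A a) :=
    mul_localizationLift_mk ((algebraMap _ K).comp (reduction A)) _ a s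
  rw [← hs.mul_right_eq_zero, hmk, map_eq_zero_iff _ (IsFractionRing.injective _ K),
    reduction_eq_zero_iff]

theorem isNilpotent_of_mem_bodyIdeal {a : A} (ha : a ∈ bodyIdeal A) : IsNilpotent a := by
  have hle : TwoSidedIdeal.span (locPart (nonzdiv A) 1) ≤
      TwoSidedIdeal.ker (fractionReduction A) := by
    rw [TwoSidedIdeal.span_le]
    rintro _ ⟨b, hb, s, rfl⟩
    exact (TwoSidedIdeal.mem_ker _).2
      (fractionReduction_mk_eq_zero_iff.2 (isNilpotent_of_odd hb))
  have hmem := hle ((TwoSidedIdeal.mem_comap _).1 ha)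
  exact fractionReduction_mk_eq_zero_iff.1 ((TwoSidedIdeal.mem_ker _).1 hmem)

theorem oddIdeal_le_bodyIdeal : oddIdeal A ≤ TwoSidedIdeal.asIdeal (bodyIdeal A) :=
  Ideal.span_le.2 fun a ha => (TwoSidedIdeal.mem_comap _).2
    (TwoSidedIdeal.subset_span ⟨a, ha, 1, rfl⟩)

theorem mem_bodyIdeal_of_smul_mem_oddIdeal {s : evenSub A} (hs : s ∈ nonzdiv A) {a : A}
    (ha : s • a ∈ oddIdeal A) : a ∈ bodyIdeal A := by
  have hsa : toLoc (nonzdiv A) (s • a) ∈ TwoSidedIdeal.span (locPart (nonzdiv A) 1) :=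
    (TwoSidedIdeal.mem_comap _).1 (oddIdeal_le_bodyIdeal ha)
  have hmul : toLoc (nonzdiv A) a =
      LocalizedModule.mk 1 ⟨s, hs⟩ * toLoc (nonzdiv A) (s • a) := by
    change LocalizedModule.mk a 1 = LocalizedModule.mk 1 _ * LocalizedModule.mk (s • a) 1
    rw [LocalizedModule.mk_mul_mk, one_mul, mul_one]
    exact (LocalizedModule.mk_eq.2 ⟨1, by rw [one_smul, one_smul, one_smul]; rfl⟩)
  rw [bodyIdeal, TwoSidedIdeal.mem_comap, hmul]
  exact TwoSidedIdeal.mul_mem_left _ _ _ hsa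

theorem zdiv_eq_singleton_zero {R : Type*} [Ring R] [Nontrivial R] [NoZeroDivisors R] :
    zdiv R = {0} := by
  ext x
  refine ⟨fun ⟨y, hy, hxy⟩ => ?_, fun hx => ⟨1, one_ne_zero, Or.inl (by rw [hx, zero_mul])⟩⟩
  simpa [hy] using hxy

end BodyIdeal

section Integral

variable (A : Type*) [Ring A] [Algebra ℂ A] [SuperCommAlgebra A]

/-- The superalgebras with the properties of an integral domain that are used here: the even
nilpotents form a prime ideal, every other even element is a non-zero-divisor, and some multiple of
each even nilpotent by such an element lies in the ideal generated by the odd elements. -/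
structure IsIntegralSuperring : Prop where
  isPrime_nilradical : (nilradical (evenSub A)).IsPrime
  mem_nonzdiv : ∀ s ∉ nilradical (evenSub A), s ∈ nonzdiv A
  exists_smul_mem_oddIdeal :
    ∀ a ∈ nilradical (evenSub A), ∃ t ∉ nilradical (evenSub A), t • (a : A) ∈ oddIdeal A

namespace IsIntegralSuperring

variable {A}

theorem irreducibleSpace (hA : IsIntegralSuperring A) : IrreducibleSpace (SpecTop A) :=
  PrimeSpectrum.irreducibleSpace_iff_isPrime_nilradical.2 hA.isPrime_nilradical

theorem not_isNilpotent_one (hA : IsIntegralSuperring A) : ¬ IsNilpotent (1 : A) := fun h =>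
  hA.isPrime_nilradical.ne_top ((Ideal.eq_top_iff_one _).2
    (mem_nilradical.2 (isNilpotent_coe_iff.1 h)))

theorem isNilpotent_or_isNilpotent_of_mul (hA : IsIntegralSuperring A) {a b : A}
    (h : IsNilpotent (a * b)) : IsNilpotent a ∨ IsNilpotent b := by
  have := (Ideal.Quotient.isDomain_iff_prime _).2 hA.isPrime_nilradical
  simpa only [← reduction_eq_zero_iff, map_mul, mul_eq_zero] using h

theorem isNilpotent_of_mem_zdiv (hA : IsIntegralSuperring A) {a : A} (ha : a ∈ zdiv A) :
    IsNilpotent a := by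
  obtain ⟨c, hc, hac⟩ := ha
  obtain ⟨a₀, a₁, h₁, rfl⟩ := exists_eq_even_add_odd a
  rw [isNilpotent_iff_evenPart, evenPart_even_add_odd a₀ h₁]
  by_contra hn
  have hsq : a₀ ^ 2 ∈ nonzdiv A := pow_mem (hA.mem_nonzdiv a₀ (hn ∘ mem_nilradical.1)) 2
  have hcomm : (a₀ : A) * a₁ = a₁ * a₀ := even_comm a₀.2 a₁
  refine hc (hsq c ?_)
  change (a₀ : A) ^ 2 * c = 0
  rcases hac with hac | hac
  · calc (a₀ : A) ^ 2 * c = (a₀ - a₁) * ((a₀ + a₁) * c) := by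
          rw [← mul_assoc, sub_mul, mul_add, mul_add, odd_mul_self h₁, hcomm, pow_two]
          congr 1; abel
      _ = 0 := by rw [hac, mul_zero]
  · calc (a₀ : A) ^ 2 * c = c * (a₀ + a₁) * (a₀ - a₁) := by
          rw [show (a₀ : A) ^ 2 * c = c * a₀ ^ 2 from even_comm (a₀ ^ 2).2 c, mul_assoc, add_mul,
            mul_sub, mul_sub, odd_mul_self h₁, hcomm, pow_two]
          congr 1; abel
      _ = 0 := by rw [hac, zero_mul]

theorem mem_bodyIdeal_iff_isNilpotent (hA : IsIntegralSuperring A) {a : A} :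
    a ∈ bodyIdeal A ↔ IsNilpotent a := by
  refine ⟨isNilpotent_of_mem_bodyIdeal, fun h => ?_⟩
  obtain ⟨a₀, a₁, h₁, rfl⟩ := exists_eq_even_add_odd a
  rw [isNilpotent_iff_evenPart, evenPart_even_add_odd a₀ h₁] at h
  obtain ⟨t, ht, hta⟩ := hA.exists_smul_mem_oddIdeal a₀ h
  refine mem_bodyIdeal_of_smul_mem_oddIdeal (hA.mem_nonzdiv t ht) ?_
  rw [smul_add]
  exact add_mem hta (odd_mem_oddIdeal (even_smul_mem t h₁))

theorem mk_bodyIdeal_eq_zero_iff (hA : IsIntegralSuperring A) {a : A} :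
    (bodyIdeal A).ringCon.mk' a = 0 ↔ IsNilpotent a := by
  rw [← hA.mem_bodyIdeal_iff_isNilpotent, TwoSidedIdeal.mem_iff]
  exact RingCon.eq _

theorem isReducedSuperring (hA : IsIntegralSuperring A) : IsReducedSuperring A := by
  let q := (bodyIdeal A).ringCon.mk'
  have hA1 : (1 : A) ≠ 0 := fun h => hA.not_isNilpotent_one (h ▸ IsNilpotent.zero)
  have : Nontrivial (bodyIdeal A).ringCon.Quotient :=
    ⟨q 1, 0, fun h => hA.not_isNilpotent_one (hA.mk_bodyIdeal_eq_zero_iff.1 h)⟩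
  have : NoZeroDivisors (bodyIdeal A).ringCon.Quotient := ⟨fun {x y} hxy => by
    obtain ⟨a, rfl⟩ := (bodyIdeal A).ringCon.mk'_surjective x
    obtain ⟨b, rfl⟩ := (bodyIdeal A).ringCon.mk'_surjective y
    rw [← map_mul] at hxy
    simpa only [hA.mk_bodyIdeal_eq_zero_iff] using
      hA.isNilpotent_or_isNilpotent_of_mul (hA.mk_bodyIdeal_eq_zero_iff.1 hxy)⟩
  refine ⟨fun _ => hA.mem_bodyIdeal_iff_isNilpotent, ?_⟩
  rw [zdiv_eq_singleton_zero (R := (bodyIdeal A).ringCon.Quotient), Set.eq_singleton_iff_unique_mem]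
  refine ⟨⟨0, ⟨1, hA1, Or.inl (zero_mul 1)⟩, map_zero q⟩, ?_⟩
  rintro _ ⟨a, ha, rfl⟩
  exact hA.mk_bodyIdeal_eq_zero_iff.2 (hA.isNilpotent_of_mem_zdiv ha)

end IsIntegralSuperring

end Integral

namespace SuperHom

variable {A B : Type*} [Ring A] [Algebra ℂ A] [SuperCommAlgebra A]
  [Ring B] [Algebra ℂ B] [SuperCommAlgebra B] {φ : SuperHom A B} {y : SpecTop B}

theorem map_even_smul (φ : SuperHom A B) (s : evenSub A) (a : A) :
    φ.toAlgHom (s • a) = φ.even s • φ.toAlgHom a :=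
  map_mul φ.toAlgHom (s : A) a

theorem evenPart_map (φ : SuperHom A B) (a : A) :
    evenPart (φ.toAlgHom a) = φ.even (evenPart a) := by
  obtain ⟨a₀, a₁, h₁, rfl⟩ := exists_eq_even_add_odd a
  rw [evenPart_even_add_odd a₀ h₁, map_add]
  exact evenPart_even_add_odd (φ.even a₀) (φ.map_part 1 a₁ h₁)

theorem even_injective (h : Function.Injective φ.toAlgHom) : Function.Injective φ.even :=
  fun _ _ hab => Subtype.ext (h (congrArg Subtype.val hab))

theorem even_mem_nilradical_iff (h : Function.Injective φ.even) {a : evenSub A} :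
    φ.even a ∈ nilradical (evenSub B) ↔ a ∈ nilradical (evenSub A) := by
  rw [mem_nilradical, mem_nilradical, IsNilpotent.map_iff h]

theorem map_mem_oddIdeal {a : A} (ha : a ∈ oddIdeal A) : φ.toAlgHom a ∈ oddIdeal B := by
  have hle : oddIdeal A ≤ (oddIdeal B).comap φ.toAlgHom :=
    Ideal.span_le.2 fun b hb => odd_mem_oddIdeal (φ.map_part 1 b hb)
  exact hle ha

theorem exists_smul_eq_of_stalkMap_surjective (h : Function.Surjective (φ.stalkMap y)) (b : B) :
    ∃ t ∉ y.asIdeal, ∃ s ∉ (φ.specMap y).asIdeal, ∃ a : A,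
      t • φ.even s • b = t • φ.toAlgHom a := by
  obtain ⟨z, hz⟩ := h (LocalizedModule.mk b 1)
  obtain ⟨a, s, rfl⟩ := localization_mk_surjective z
  obtain ⟨t, ht⟩ := LocalizedModule.mk_eq.1 hz
  rw [one_smul] at ht
  exact ⟨t, t.2, s, s.2, a, ht.symm⟩

theorem exists_mul_eq_of_stalkMap_surjective (h : Function.Surjective (φ.stalkMap y))
    (b : evenSub B) : ∃ t ∉ y.asIdeal, ∃ s ∉ (φ.specMap y).asIdeal, ∃ a : evenSub A,
      t * (φ.even s * b) = t * φ.even a := by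
  obtain ⟨t, ht, s, hs, a, hab⟩ := exists_smul_eq_of_stalkMap_surjective h (b : B)
  refine ⟨t, ht, s, hs, evenPart a, ?_⟩
  simpa only [map_smul, evenPart_coe, evenPart_map, smul_eq_mul] using congrArg evenPart hab

theorem exists_smul_eq_zero_of_stalkMap_injective (h : Function.Injective (φ.stalkMap y)) {a : A}
    {t : evenSub B} (ht : t ∉ y.asIdeal) (hta : t • φ.toAlgHom a = 0) :
    ∃ u ∉ (φ.specMap y).asIdeal, u • a = 0 := by
  have hstalk : φ.stalkMap y (LocalizedModule.mk a 1) = φ.stalkMap y (LocalizedModule.mk 0 1) :=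
    LocalizedModule.mk_eq.2 ⟨⟨t, ht⟩, by
      change t • φ.even 1 • φ.toAlgHom a = t • φ.even 1 • φ.toAlgHom 0
      rw [map_one, one_smul, hta, map_zero, smul_zero, smul_zero]⟩
  obtain ⟨u, hu⟩ := LocalizedModule.mk_eq.1 (h hstalk)
  rw [one_smul, one_smul, smul_zero] at hu
  exact ⟨u, u.2, hu⟩

end SuperHom

section LocalVanishing

variable {B : Type*} [Ring B] [Algebra ℂ B] [SuperCommAlgebra B]

theorem eq_zero_of_forall_exists_smul_eq_zero {b : B}
    (h : ∀ y : SpecTop B, ∃ t ∉ y.asIdeal, t • b = 0) : b = 0 := by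
  by_contra hb
  have htop : Ideal.torsionOf (evenSub B) B b ≠ ⊤ :=
    mt (Ideal.torsionOf_eq_top_iff _ _).1 hb
  obtain ⟨P, hP, hle⟩ := Ideal.exists_le_maximal _ htop
  obtain ⟨t, ht, htb⟩ := h ⟨P, hP.isPrime⟩
  exact ht (hle htb)

theorem notMem_nilradical_of_notMem {y : SpecTop B} {t : evenSub B} (ht : t ∉ y.asIdeal) :
    t ∉ nilradical (evenSub B) :=
  fun h => ht (nilradical_le_prime y.asIdeal h)

end LocalVanishing

namespace IsIntegralSuperring

variable {A B : Type*} [Ring A] [Algebra ℂ A] [SuperCommAlgebra A]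
  [Ring B] [Algebra ℂ B] [SuperCommAlgebra B] {φ : SuperHom A B}

theorem eq_zero_of_smul_eq_zero (hA : IsIntegralSuperring A) {s : evenSub A}
    (hs : s ∉ nilradical (evenSub A)) {a : A} (h : s • a = 0) : a = 0 :=
  hA.mem_nonzdiv s hs a h

theorem injective_of_stalkMap_injective (hA : IsIntegralSuperring A) {y : SpecTop B}
    (h : Function.Injective (φ.stalkMap y)) : Function.Injective φ.toAlgHom := by
  rw [injective_iff_map_eq_zero]
  intro a ha
  have h1 : (1 : evenSub B) ∉ y.asIdeal := (Ideal.ne_top_iff_one _).1 y.2.ne_top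
  obtain ⟨u, hu, hua⟩ :=
    SuperHom.exists_smul_eq_zero_of_stalkMap_injective h h1 (by rw [ha, smul_zero])
  exact hA.eq_zero_of_smul_eq_zero (notMem_nilradical_of_notMem hu) hua

theorem isPrime_nilradical_of_isOpenEmbedding (hA : IsIntegralSuperring A)
    (hφ : Topology.IsOpenEmbedding φ.specMap) [Nonempty (SpecTop B)] :
    (nilradical (evenSub B)).IsPrime := by
  have := hA.irreducibleSpace
  have hpre := (PreirreducibleSpace.isPreirreducible_univ (X := SpecTop A)).preimage hφ
  rw [← PrimeSpectrum.irreducibleSpace_iff_isPrime_nilradical]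
  exact { isPreirreducible_univ := hpre, toNonempty := inferInstance }

theorem mem_nonzdiv_of_isOpenImmersion (hA : IsIntegralSuperring A) (hφ : φ.IsOpenImmersion)
    [hB : (nilradical (evenSub B)).IsPrime] {s : evenSub B}
    (hs : s ∉ nilradical (evenSub B)) : s ∈ nonzdiv B := by
  intro b hb
  refine eq_zero_of_forall_exists_smul_eq_zero fun y => ?_
  have hinj := SuperHom.even_injective (hA.injective_of_stalkMap_injective (hφ.2 y).1)
  obtain ⟨t, ht, r, hr, a, hsa⟩ := SuperHom.exists_mul_eq_of_stalkMap_surjective (hφ.2 y).2 s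
  obtain ⟨t', ht', r', hr', c, hbc⟩ := SuperHom.exists_smul_eq_of_stalkMap_surjective (hφ.2 y).2 b
  have ha : a ∉ nilradical (evenSub A) := fun ha => by
    have hmem : t * (φ.even r * s) ∈ nilradical (evenSub B) :=
      hsa ▸ Ideal.mul_mem_left _ t ((SuperHom.even_mem_nilradical_iff hinj).2 ha)
    refine hB.mul_notMem (notMem_nilradical_of_notMem ht) (hB.mul_notMem ?_ hs) hmem
    exact mt (SuperHom.even_mem_nilradical_iff hinj).1 (notMem_nilradical_of_notMem hr)
  have hac : (t' * t) • φ.toAlgHom (a • c) = 0 := by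
    calc (t' * t) • φ.toAlgHom (a • c) = (t * φ.even a) • (t' • φ.toAlgHom c) := by
          rw [φ.map_even_smul, smul_smul, smul_smul]; congr 1; ring
      _ = (t * (φ.even r * s)) • (t' • φ.even r' • b) := by rw [hsa, hbc]
      _ = (t * φ.even r * t' * φ.even r') • (s • b) := by
          simp only [smul_smul]; congr 1; ring
      _ = 0 := by rw [show s • b = 0 from hb, smul_zero]
  obtain ⟨u, hu, huac⟩ :=
    SuperHom.exists_smul_eq_zero_of_stalkMap_injective (hφ.2 y).1 (y.2.mul_notMem ht' ht) hac
  have hc : c = 0 := hA.eq_zero_of_smul_eq_zero ha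
    (hA.eq_zero_of_smul_eq_zero (notMem_nilradical_of_notMem hu) huac)
  refine ⟨t' * φ.even r', y.2.mul_notMem ht' hr', ?_⟩
  rw [mul_smul, hbc, hc, map_zero, smul_zero]

theorem exists_smul_mem_oddIdeal_of_isOpenImmersion (hA : IsIntegralSuperring A)
    (hφ : φ.IsOpenImmersion) [hB : (nilradical (evenSub B)).IsPrime] (y : SpecTop B)
    {b : evenSub B} (hb : b ∈ nilradical (evenSub B)) :
    ∃ t ∉ nilradical (evenSub B), t • (b : B) ∈ oddIdeal B := by
  have hinj := SuperHom.even_injective (hA.injective_of_stalkMap_injective (hφ.2 y).1)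
  obtain ⟨t, ht, s, hs, a, hba⟩ := SuperHom.exists_mul_eq_of_stalkMap_surjective (hφ.2 y).2 b
  have ht' := notMem_nilradical_of_notMem ht
  have ha : a ∈ nilradical (evenSub A) := by
    have hmem : t * φ.even a ∈ nilradical (evenSub B) :=
      hba ▸ Ideal.mul_mem_left _ t (Ideal.mul_mem_left _ _ hb)
    exact (SuperHom.even_mem_nilradical_iff hinj).1 ((hB.mem_or_mem hmem).resolve_left ht')
  obtain ⟨r, hr, hra⟩ := hA.exists_smul_mem_oddIdeal a ha
  refine ⟨t * φ.even s * φ.even r, hB.mul_notMem (hB.mul_notMem ht' ?_) ?_, ?_⟩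
  · exact mt (SuperHom.even_mem_nilradical_iff hinj).1 (notMem_nilradical_of_notMem hs)
  · exact mt (SuperHom.even_mem_nilradical_iff hinj).1 hr
  · have hmul : t * φ.even s * φ.even r * b = t * φ.even (r * a) := by
      rw [mul_right_comm, mul_assoc t, hba, map_mul]; ring
    have hsmul : (t * φ.even s * φ.even r) • (b : B) = t • φ.toAlgHom (r • (a : A)) :=
      congrArg Subtype.val hmul
    rw [hsmul]
    exact Ideal.mul_mem_left _ _ (SuperHom.map_mem_oddIdeal hra)

theorem of_isOpenImmersion (hA : IsIntegralSuperring A) (hφ : φ.IsOpenImmersion)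
    [Nonempty (SpecTop B)] : IsIntegralSuperring B := by
  have hB := hA.isPrime_nilradical_of_isOpenEmbedding hφ.1
  exact ⟨hB, fun _ => hA.mem_nonzdiv_of_isOpenImmersion hφ,
    fun _ => hA.exists_smul_mem_oddIdeal_of_isOpenImmersion hφ (Classical.arbitrary _)⟩

end IsIntegralSuperring

theorem zdiv_eq_empty {R : Type*} [Ring R] [Subsingleton R] : zdiv R = ∅ :=
  Set.eq_empty_of_forall_notMem fun _ ⟨_, hb, _⟩ => hb (Subsingleton.elim _ _)

theorem isReducedSuperring_of_subsingleton {B : Type*} [Ring B] [Algebra ℂ B] [SuperCommAlgebra B]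
    [Subsingleton B] : IsReducedSuperring B := by
  have : Subsingleton (bodyIdeal B).ringCon.Quotient :=
    (bodyIdeal B).ringCon.mk'_surjective.subsingleton
  refine ⟨fun a => ?_, ?_⟩
  · rw [Subsingleton.elim a 0]
    exact iff_of_true (zero_mem _) IsNilpotent.zero
  · rw [zdiv_eq_empty, zdiv_eq_empty, Set.image_empty]

theorem IsIntegralSuperring.specIsReduced {A : Type u} [Ring A] [Algebra ℂ A] [SuperCommAlgebra A]
    (hA : IsIntegralSuperring A) : SpecIsReduced A := by
  intro B _ _ _ φ hφ
  rcases isEmpty_or_nonempty (SpecTop B) with hempty | hnonempty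
  · have : Subsingleton (evenSub B) := PrimeSpectrum.isEmpty_iff_subsingleton.1 hempty
    have : Subsingleton B := subsingleton_of_zero_eq_one
      (congrArg Subtype.val (Subsingleton.elim (0 : evenSub B) 1))
    exact isReducedSuperring_of_subsingleton
  · exact (hA.of_isOpenImmersion hφ).isReducedSuperring

/-! ### Localizations -/

section PrincipalLocalization

variable {A B : Type*} [Ring A] [Algebra ℂ A] [SuperCommAlgebra A]
  [Ring B] [Algebra ℂ B] [SuperCommAlgebra B]

/-- The homomorphism `φ : A → B` identifies `B` with `A[f⁻¹]`, where `f ∈ A₀` is a non-zero-divisor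
of `A`. -/
structure IsPrincipalLocalization (φ : SuperHom A B) (f : evenSub A) : Prop where
  injective : Function.Injective φ.toAlgHom
  isUnit : IsUnit (φ.even f)
  exists_map_eq_pow_smul : ∀ b : B, ∃ (n : ℕ) (a : A), φ.toAlgHom a = φ.even f ^ n • b

namespace IsPrincipalLocalization

variable {φ : SuperHom A B} {f : evenSub A}

theorem exists_even_map_eq_pow_mul (h : IsPrincipalLocalization φ f) (b : evenSub B) :
    ∃ (n : ℕ) (a : evenSub A), φ.even a = φ.even f ^ n * b := by
  obtain ⟨n, a, hab⟩ := h.exists_map_eq_pow_smul (b : B)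
  refine ⟨n, evenPart a, ?_⟩
  rw [← φ.evenPart_map, hab, map_smul, evenPart_coe, smul_eq_mul]

theorem isOpenEmbedding (h : IsPrincipalLocalization φ f) :
    Topology.IsOpenEmbedding φ.specMap := by
  let _ : Algebra (evenSub A) (evenSub B) := φ.even.toAlgebra
  have : IsLocalization.Away f (evenSub B) := by
    refine ⟨?_, fun b => ?_, fun {a b} hab => ?_⟩
    · rintro ⟨_, n, rfl⟩
      change IsUnit (φ.even (f ^ n))
      rw [map_pow]
      exact h.isUnit.pow n
    · obtain ⟨n, a, hab⟩ := h.exists_even_map_eq_pow_mul b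
      refine ⟨⟨a, ⟨f ^ n, n, rfl⟩⟩, ?_⟩
      change b * φ.even (f ^ n) = φ.even a
      rw [hab, map_pow, mul_comm]
    · exact ⟨1, by rw [SuperHom.even_injective h.injective hab]⟩
  exact PrimeSpectrum.localization_away_isOpenEmbedding (evenSub B) f

theorem map_pow_notMem (h : IsPrincipalLocalization φ f) (y : SpecTop B) (n : ℕ) :
    φ.even f ^ n ∉ y.asIdeal :=
  fun hn => y.2.ne_top (Ideal.eq_top_of_isUnit_mem _ hn (h.isUnit.pow n))

theorem stalkMap_injective (h : IsPrincipalLocalization φ f) (y : SpecTop B) :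
    Function.Injective (φ.stalkMap y) := by
  intro z w hzw
  obtain ⟨a, s, rfl⟩ := localization_mk_surjective z
  obtain ⟨b, t, rfl⟩ := localization_mk_surjective w
  obtain ⟨u, hu⟩ := LocalizedModule.mk_eq.1 hzw
  change (u : evenSub B) • φ.even t • φ.toAlgHom a = (u : evenSub B) • φ.even s • φ.toAlgHom b
    at hu
  obtain ⟨n, c, hc⟩ := h.exists_even_map_eq_pow_mul u
  have hcy : φ.even c ∉ y.asIdeal := hc ▸ y.2.mul_notMem (h.map_pow_notMem y n) u.2
  refine LocalizedModule.mk_eq.2 ⟨⟨c, hcy⟩, h.injective ?_⟩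
  change φ.toAlgHom (c • (t : evenSub A) • a) = φ.toAlgHom (c • (s : evenSub A) • b)
  rw [φ.map_even_smul, φ.map_even_smul, φ.map_even_smul, φ.map_even_smul, hc, mul_smul, hu,
    mul_smul]

theorem stalkMap_surjective (h : IsPrincipalLocalization φ f) (y : SpecTop B) :
    Function.Surjective (φ.stalkMap y) := by
  intro z
  obtain ⟨b, u, rfl⟩ := localization_mk_surjective z
  obtain ⟨n, a, ha⟩ := h.exists_map_eq_pow_smul b
  obtain ⟨k, c, hc⟩ := h.exists_even_map_eq_pow_mul u
  have hcy : φ.even (f ^ n * c) ∉ y.asIdeal := by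
    rw [map_mul, map_pow, hc]
    exact y.2.mul_notMem (h.map_pow_notMem y n) (y.2.mul_notMem (h.map_pow_notMem y k) u.2)
  refine ⟨LocalizedModule.mk (f ^ k • a) ⟨f ^ n * c, hcy⟩, LocalizedModule.mk_eq.2 ⟨1, ?_⟩⟩
  rw [one_smul, one_smul]
  change (u : evenSub B) • φ.toAlgHom (f ^ k • a) = φ.even (f ^ n * c) • b
  rw [φ.map_even_smul, ha, map_mul, map_pow, map_pow, hc, smul_smul, smul_smul]
  congr 1
  ring

theorem isOpenImmersion (h : IsPrincipalLocalization φ f) : φ.IsOpenImmersion :=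
  ⟨h.isOpenEmbedding, fun y => ⟨h.stalkMap_injective y, h.stalkMap_surjective y⟩⟩

end IsPrincipalLocalization

end PrincipalLocalization

section ExteriorLocalization

variable {A B : Type*} [Ring A] [Algebra ℂ A] [SuperCommAlgebra A]
  [Ring B] [Algebra ℂ B] [SuperCommAlgebra B]
  {R N : Type*} [CommRing R] [AddCommGroup N] [Module R N]

variable (R N) in
/-- The even and odd elements of the exterior algebra of a module. -/
abbrev exteriorPart (i : ZMod 2) : Submodule R (ExteriorAlgebra R N) :=
  CliffordAlgebra.evenOdd (0 : QuadraticForm R N) i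

theorem isCompl_exteriorPart (i : ZMod 2) :
    IsCompl (exteriorPart R N i) (exteriorPart R N (i + 1)) := by
  have hcompl : IsCompl (exteriorPart R N 0) (exteriorPart R N 1) :=
    CliffordAlgebra.evenOdd_isCompl 0
  fin_cases i
  exacts [hcompl, hcompl.symm]

theorem eq_zero_of_add_mem_exteriorPart {i : ZMod 2} {x y : ExteriorAlgebra R N}
    (hx : x ∈ exteriorPart R N i) (hy : y ∈ exteriorPart R N (i + 1))
    (hxy : x + y ∈ exteriorPart R N i) : y = 0 :=
  Submodule.disjoint_def.1 (isCompl_exteriorPart i).disjoint y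
    ((Submodule.add_mem_iff_right _ hx).1 hxy) hy

theorem mem_exteriorPart_of_isUnit_mul_mem {i : ZMod 2} {s x : ExteriorAlgebra R N}
    (hs : IsUnit s) (hs₀ : s ∈ exteriorPart R N 0) (hsx : s * x ∈ exteriorPart R N i) :
    x ∈ exteriorPart R N i := by
  obtain ⟨y, hy, z, hz, rfl⟩ := Submodule.mem_sup.1
    ((isCompl_exteriorPart (R := R) (N := N) i).sup_eq_top ▸ Submodule.mem_top (x := x))
  have hsy := SetLike.mul_mem_graded hs₀ hy
  have hsz := SetLike.mul_mem_graded hs₀ hz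
  rw [zero_add] at hsy hsz
  have hsz₀ : s * z = 0 := eq_zero_of_add_mem_exteriorPart hsy hsz (mul_add s y z ▸ hsx)
  rwa [hs.mul_right_eq_zero.1 hsz₀, add_zero]

theorem exists_eq_add_of_mem_part (i : ZMod 2) (a : A) :
    ∃ b ∈ part A i, ∃ c ∈ part A (i + 1), a = b + c := by
  obtain ⟨a₀, a₁, h₁, rfl⟩ := exists_eq_even_add_odd a
  fin_cases i
  exacts [⟨a₀, a₀.2, a₁, h₁, rfl⟩, ⟨a₁, h₁, a₀, a₀.2, add_comm _ _⟩]

/-- The injective even homomorphism `g : A → ⋀ N` identifies `⋀ N` with the localization of `A` at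
the even elements that are not nilpotent. -/
structure IsExteriorLocalization (g : A →+* ExteriorAlgebra R N) : Prop where
  injective : Function.Injective g
  isUnit : ∀ s ∉ nilradical (evenSub A), IsUnit (g s)
  exists_mul_eq : ∀ x, ∃ s ∉ nilradical (evenSub A), ∃ a, g s * x = g a
  map_part : ∀ i, ∀ a ∈ part A i, g a ∈ exteriorPart R N i

namespace IsExteriorLocalization

variable {g : A →+* ExteriorAlgebra R N}

theorem notMem_nilradical_iff [Nontrivial R] (hg : IsExteriorLocalization g) {s : evenSub A} :
    s ∉ nilradical (evenSub A) ↔ IsUnit (g s) := by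
  refine ⟨hg.isUnit s, fun hunit hs => ?_⟩
  exact hunit.not_isNilpotent ((isNilpotent_coe_iff.2 (mem_nilradical.1 hs)).map g)

theorem isPrime_nilradical [Nontrivial R] (hg : IsExteriorLocalization g) :
    (nilradical (evenSub A)).IsPrime := by
  refine ⟨(Ideal.ne_top_iff_one _).2 (hg.notMem_nilradical_iff.2 ?_), fun {s t} hst => ?_⟩
  · exact (map_one g).symm ▸ isUnit_one
  · contrapose! hst
    simp only [hg.notMem_nilradical_iff] at hst ⊢
    exact (map_mul g (s : A) t).symm ▸ hst.1.mul hst.2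

theorem mem_nonzdiv (hg : IsExteriorLocalization g) {s : evenSub A}
    (hs : s ∉ nilradical (evenSub A)) : s ∈ nonzdiv A := by
  intro a ha
  have hga : g s * g a = 0 := by rw [← map_mul, ha, map_zero]
  exact (map_eq_zero_iff g hg.injective).1 ((hg.isUnit s hs).mul_right_eq_zero.1 hga)

theorem exists_mul_ι_eq (hg : IsExteriorLocalization g) (n : N) :
    ∃ s ∉ nilradical (evenSub A), ∃ a ∈ part A 1, g s * ExteriorAlgebra.ι R n = g a := by
  obtain ⟨s, hs, a, ha⟩ := hg.exists_mul_eq (ExteriorAlgebra.ι R n)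
  obtain ⟨a₁, h₁, a₀, h₀, rfl⟩ := exists_eq_add_of_mem_part 1 a
  have hodd : g s * ExteriorAlgebra.ι R n ∈ exteriorPart R N 1 := by
    have h := SetLike.mul_mem_graded (hg.map_part 0 s s.2) (CliffordAlgebra.ι_mem_evenOdd_one 0 n)
    rwa [zero_add] at h
  rw [ha, map_add] at hodd
  have hga : g a₀ = 0 :=
    eq_zero_of_add_mem_exteriorPart (hg.map_part 1 a₁ h₁) (hg.map_part _ a₀ h₀) hodd
  exact ⟨s, hs, a₁, h₁, by rw [ha, map_add, hga, add_zero]⟩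

theorem exists_mul_sub_algebraMap_eq [Nontrivial R] (hg : IsExteriorLocalization g)
    (x : ExteriorAlgebra R N) : ∃ r : R, ∃ s ∉ nilradical (evenSub A), ∃ a ∈ oddIdeal A,
      g s * (x - algebraMap R _ r) = g a := by
  have hprime := hg.isPrime_nilradical
  induction x using CliffordAlgebra.right_induction with
  | algebraMap r =>
    exact ⟨r, 1, hprime.one_notMem, 0, zero_mem _, by simp [ExteriorAlgebra]⟩
  | add x y hx hy =>
    obtain ⟨r, s, hs, a, ha, hxa⟩ := hx
    obtain ⟨r', t, ht, b, hb, hyb⟩ := hy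
    refine ⟨r + r', s * t, hprime.mul_notMem hs ht, t • a + s • b,
      add_mem (Ideal.mul_mem_left _ _ ha) (Ideal.mul_mem_left _ _ hb), ?_⟩
    change g (s * t) * _ = g (t * a + s * b)
    rw [map_add (algebraMap R _), add_sub_add_comm, map_add, map_mul, map_mul, map_mul, ← hxa,
      ← hyb, ← mul_assoc, ← mul_assoc, map_even_comm g t s, mul_add]
  | mul_ι n x _ =>
    obtain ⟨s, hs, a, ha⟩ := hg.exists_mul_eq x
    obtain ⟨t, ht, b, hb, hnb⟩ := hg.exists_mul_ι_eq n
    refine ⟨0, t * s, hprime.mul_notMem ht hs, a * b,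
      Ideal.mul_mem_left _ a (odd_mem_oddIdeal hb), ?_⟩
    calc g (t * s) * (x * ExteriorAlgebra.ι R n - algebraMap R _ 0)
        = g t * (g s * x) * ExteriorAlgebra.ι R n := by
          rw [map_zero, sub_zero, map_mul, mul_assoc, mul_assoc, mul_assoc]
      _ = g (a * b) := by rw [ha, map_even_comm, mul_assoc, hnb, map_mul]

theorem isIntegralSuperring {K V : Type*} [Field K] [AddCommGroup V] [Module K V]
    {g : A →+* ExteriorAlgebra K V} (hg : IsExteriorLocalization g) : IsIntegralSuperring A := by
  refine ⟨hg.isPrime_nilradical, fun _ => hg.mem_nonzdiv, fun a ha => ?_⟩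
  obtain ⟨r, s, hs, b, hb, hab⟩ := hg.exists_mul_sub_algebraMap_eq (g a)
  have hnil : IsNilpotent (s • (a : A) - b) := by
    have ha' : s * a ∈ nilradical (evenSub A) := Ideal.mul_mem_left _ s ha
    have hb' := reduction_eq_zero_iff.2 (isNilpotent_of_mem_oddIdeal hb)
    have hsa := reduction_eq_zero_iff.2 (isNilpotent_coe_iff.2 (mem_nilradical.1 ha'))
    exact reduction_eq_zero_iff.1 (by rw [map_sub, hb', sub_zero]; exact hsa)
  have hr : r = 0 := by
    by_contra hr
    have hunit : IsUnit (g (s • (a : A) - b)) := by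
      have : g (s • (a : A) - b) = g s * algebraMap K _ r := by
        rw [map_sub, ← hab, mul_sub]
        exact (congrArg (· - _) (map_mul g (s : A) a)).trans (sub_sub_cancel _ _)
      exact this ▸ (hg.isUnit s hs).mul ((IsUnit.mk0 r hr).map _)
    exact hunit.not_isNilpotent (hnil.map g)
  refine ⟨s, hs, ?_⟩
  rw [hr, map_zero, sub_zero] at hab
  have hsab : s • (a : A) = b := hg.injective ((map_mul g (s : A) a).trans hab)
  exact hsab ▸ hb

theorem isFermionicallyRegular {A R N : Type u} [Ring A] [Algebra ℂ A] [SuperCommAlgebra A]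
    [CommRing R] [AddCommGroup N] [Module R N] {g : A →+* ExteriorAlgebra R N}
    (hg : IsExteriorLocalization g) {x : SpecTop A} (hx : x.asIdeal = nilradical (evenSub A)) :
    IsFermionicallyRegular (Stalk A x) (locPart x.asIdeal.primeCompl) := by
  have hunit : ∀ s ∈ x.asIdeal.primeCompl, IsUnit (g s) := fun s hs => hg.isUnit s (hx ▸ hs)
  let e : Stalk A x ≃+* ExteriorAlgebra R N := RingEquiv.ofBijective (localizationLift g hunit)
    ⟨localizationLift_injective hunit hg.injective,
      localizationLift_surjective hunit fun y => by simpa [hx] using! hg.exists_mul_eq y⟩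
  have he : ∀ i, ∀ a ∈ part A i, ∀ s, e (LocalizedModule.mk a s) ∈ exteriorPart R N i := by
    intro i a ha s
    refine mem_exteriorPart_of_isUnit_mul_mem (hunit s s.2) (hg.map_part 0 s s.1.2) ?_
    exact (mul_localizationLift_mk g hunit a s).symm ▸ hg.map_part i a ha
  refine ⟨R, N, inferInstance, inferInstance, inferInstance, e, fun i z => ⟨?_, fun hz => ?_⟩⟩
  · rintro ⟨a, ha, s, rfl⟩
    exact he i a ha s
  · obtain ⟨a, s, rfl⟩ := localization_mk_surjective z
    obtain ⟨b, hb, c, hc, rfl⟩ := exists_eq_add_of_mem_part i a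
    have hadd : (LocalizedModule.mk (b + c) s : Stalk A x) =
        LocalizedModule.mk b s + LocalizedModule.mk c s := by
      rw [LocalizedModule.mk_add_mk, ← smul_add, LocalizedModule.mk_cancel_common_left]
    rw [hadd, map_add] at hz
    have hc₀ := eq_zero_of_add_mem_exteriorPart (he i b hb s) (he _ c hc s) hz
    rw [map_eq_zero_iff e e.injective] at hc₀
    exact ⟨b, hb, s, by rw [hadd, hc₀, add_zero]⟩

theorem specIsGFR {A R N : Type u} [Ring A] [Algebra ℂ A] [SuperCommAlgebra A]
    [CommRing R] [Nontrivial R] [AddCommGroup N] [Module R N] {g : A →+* ExteriorAlgebra R N}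
    (hg : IsExteriorLocalization g) : SpecIsGFR A := by
  let η : SpecTop A := ⟨nilradical (evenSub A), hg.isPrime_nilradical⟩
  refine ⟨{η}, fun y => ?_, fun x hx => hg.isFermionicallyRegular (hx ▸ rfl)⟩
  exact specializes_iff_mem_closure.1
    ((PrimeSpectrum.le_iff_specializes η y).1 (nilradical_le_prime y.asIdeal))

theorem comp_of_isPrincipalLocalization {φ : SuperHom A B} {f : evenSub A}
    {g : B →+* ExteriorAlgebra R N} [Nontrivial R] (hg : IsExteriorLocalization g)
    (h : IsPrincipalLocalization φ f) :
    IsExteriorLocalization (g.comp (φ.toAlgHom : A →+* B)) where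
  injective := hg.injective.comp h.injective
  isUnit s hs := hg.isUnit (φ.even s)
    (mt (SuperHom.even_mem_nilradical_iff (SuperHom.even_injective h.injective)).1 hs)
  exists_mul_eq x := by
    obtain ⟨s, hs, b, hb⟩ := hg.exists_mul_eq x
    obtain ⟨n, c, hc⟩ := h.exists_even_map_eq_pow_mul s
    obtain ⟨k, a, ha⟩ := h.exists_map_eq_pow_smul b
    have hfc : φ.even (f ^ k * c) = φ.even f ^ k * (φ.even f ^ n * s) := by
      rw [map_mul, map_pow, hc]
    have hnil : φ.even (f ^ k * c) ∉ nilradical (evenSub B) := by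
      rwa [hfc, Ideal.unit_mul_mem_iff_mem _ (h.isUnit.pow k),
        Ideal.unit_mul_mem_iff_mem _ (h.isUnit.pow n)]
    refine ⟨f ^ k * c, mt (SuperHom.even_mem_nilradical_iff
      (SuperHom.even_injective h.injective)).2 hnil, f ^ n • a, ?_⟩
    calc g (φ.even (f ^ k * c) : B) * x
        = g (φ.even f ^ n * φ.even f ^ k : evenSub B) * (g s * x) := by
          rw [hfc, mul_left_comm, ← mul_assoc, ← mul_assoc, ← map_mul]; rfl
      _ = g (φ.toAlgHom (f ^ n • a)) := by
          rw [hb, ← map_mul, φ.map_even_smul, ha, map_pow, smul_smul]; rfl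
  map_part i a ha := hg.map_part i _ (φ.map_part i a ha)

end IsExteriorLocalization

end ExteriorLocalization

/-! ### Polynomials in even and odd variables -/

section ExteriorBaseChange

open TensorProduct

theorem map_mem_exteriorPart {k V R N : Type*} [CommRing k] [AddCommGroup V] [Module k V]
    [CommRing R] [AddCommGroup N] [Module R N] (f : ExteriorAlgebra k V →+* ExteriorAlgebra R N)
    (hf : ∀ r, f (algebraMap k _ r) ∈ exteriorPart R N 0)
    (hι : ∀ v, f (ExteriorAlgebra.ι k v) ∈ exteriorPart R N 1)
    {i : ZMod 2} {x : ExteriorAlgebra k V} (hx : x ∈ exteriorPart k V i) :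
    f x ∈ exteriorPart R N i := by
  have hpow : ∀ (n : ℕ), ∀ y ∈ LinearMap.range (ExteriorAlgebra.ι k (M := V)) ^ n,
      f y ∈ exteriorPart R N n := by
    intro n y hy
    induction hy using Submodule.pow_induction_on_left' with
    | algebraMap r => exact_mod_cast hf r
    | add y z n _ _ hy hz => exact (map_add f y z).symm ▸ add_mem hy hz
    | mem_mul v hv n y _ hy =>
      obtain ⟨v, rfl⟩ := hv
      rw [map_mul, Nat.cast_succ, add_comm]
      exact SetLike.mul_mem_graded (hι v) hy
  induction hx using Submodule.iSup_induction' with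
  | mem n y hy => exact n.2 ▸ hpow n y hy
  | zero => exact (map_zero f).symm ▸ zero_mem _
  | add y z _ _ hy hz => exact (map_add f y z).symm ▸ add_mem hy hz

variable (R V : Type*) [CommRing R] [Algebra ℂ R] [AddCommGroup V] [Module ℂ V]

/-- Base change of exterior algebras. -/
def exteriorBaseChange : R ⊗[ℂ] ExteriorAlgebra ℂ V ≃ₐ[R] ExteriorAlgebra R (R ⊗[ℂ] V) :=
  (CliffordAlgebra.equivBaseChange R 0).symm.trans <| CliffordAlgebra.equivOfIsometry
    { LinearEquiv.refl R (R ⊗[ℂ] V) with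
      map_app' := fun v => by simp [QuadraticForm.baseChange, QuadraticForm.tmul] }

variable {R V}

theorem exteriorBaseChange_tmul_algebraMap (r : R) (z : ℂ) :
    exteriorBaseChange R V (r ⊗ₜ algebraMap ℂ _ z) = algebraMap R _ (z • r) := by
  rw [Algebra.algebraMap_eq_smul_one, ← TensorProduct.smul_tmul]
  exact (exteriorBaseChange R V).commutes (z • r)

theorem exteriorBaseChange_tmul_ι (r : R) (v : V) :
    exteriorBaseChange R V (r ⊗ₜ ExteriorAlgebra.ι ℂ v) = ExteriorAlgebra.ι R (r ⊗ₜ v) :=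
  (congrArg _ (CliffordAlgebra.ofBaseChange_tmul_ι R 0 r v)).trans
    (CliffordAlgebra.map_apply_ι _ _)

theorem exteriorBaseChange_tmul_mem (r : R) {i : ZMod 2} {c : ExteriorAlgebra ℂ V}
    (hc : c ∈ exteriorPart ℂ V i) :
    exteriorBaseChange R V (r ⊗ₜ c) ∈ exteriorPart R (R ⊗[ℂ] V) i := by
  have hr : r ⊗ₜ[ℂ] c = r • (1 ⊗ₜ[ℂ] c) := by rw [TensorProduct.smul_tmul', smul_eq_mul, mul_one]
  rw [hr, map_smul]
  let f : ExteriorAlgebra ℂ V →+* ExteriorAlgebra R (R ⊗[ℂ] V) :=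
    (exteriorBaseChange R V).toRingEquiv.toRingHom.comp
      (Algebra.TensorProduct.includeRight : _ →ₐ[ℂ] R ⊗[ℂ] ExteriorAlgebra ℂ V).toRingHom
  refine Submodule.smul_mem _ _ (map_mem_exteriorPart f (fun z => ?_) (fun v => ?_) hc)
  · exact (exteriorBaseChange_tmul_algebraMap (V := V) (1 : R) z).symm ▸
      SetLike.algebraMap_mem_graded _ _
  · exact (exteriorBaseChange_tmul_ι (1 : R) v).symm ▸ CliffordAlgebra.ι_mem_evenOdd_one 0 _

end ExteriorBaseChange

section Body

open AddMonoidAlgebra TensorProduct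

variable {M ι : Type*} [AddCommMonoid M]

variable (M ι) in
/-- The homomorphism setting the odd variables to zero. -/
def body : SuperPoly M ι →ₐ[ℂ] AddMonoidAlgebra ℂ M :=
  mapAlgHom M ExteriorAlgebra.algebraMapInv

variable (M ι) in
/-- The inclusion of the polynomials in the even variables. -/
def ofBody : AddMonoidAlgebra ℂ M →ₐ[ℂ] SuperPoly M ι :=
  mapAlgHom M (Algebra.ofId ℂ _)

theorem ofBody_single (m : M) (c : ℂ) :
    ofBody M ι (single m c) = single m (algebraMap ℂ _ c) := by
  simp [ofBody, Algebra.ofId_apply]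

theorem ofBody_mem (p : AddMonoidAlgebra ℂ M) : ofBody M ι p ∈ part (SuperPoly M ι) 0 := by
  induction p using AddMonoidAlgebra.induction_linear with
  | zero => exact (map_zero (ofBody M ι)).symm ▸ zero_mem _
  | add f g hf hg => exact (map_add (ofBody M ι) f g).symm ▸ add_mem hf hg
  | single m c =>
    rw [ofBody_single]
    exact single_mem_polyPart (SetLike.algebraMap_mem_graded _ c) m

theorem body_ofBody (p : AddMonoidAlgebra ℂ M) : body M ι (ofBody M ι p) = p := by
  induction p using AddMonoidAlgebra.induction_linear with
  | zero => rw [map_zero, map_zero]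
  | add f g hf hg => rw [map_add, map_add, hf, hg]
  | single m c =>
    rw [ofBody_single, body, mapAlgHom_single, ExteriorAlgebra.algebraMap_leftInverse]

theorem sub_ofBody_body_mem (f : SuperPoly M ι) :
    f - ofBody M ι (body M ι f) ∈ oddIdeal (SuperPoly M ι) := by
  induction f using AddMonoidAlgebra.induction_linear with
  | zero => simp only [map_zero, sub_zero, zero_mem]
  | add f g hf hg =>
    rw [map_add, map_add, add_sub_add_comm]
    exact add_mem hf hg
  | single m c =>
    rw [body, mapAlgHom_single, ofBody_single, ← single_sub]
    induction c using CliffordAlgebra.right_induction with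
    | algebraMap r =>
      have hr : ExteriorAlgebra.algebraMapInv (algebraMap ℂ (ExteriorAlgebra ℂ (ι → ℂ)) r) = r :=
        ExteriorAlgebra.algebraMap_leftInverse _ r
      have hzero : single m ((algebraMap ℂ (ExteriorAlgebra ℂ (ι → ℂ)) r) - algebraMap ℂ _
          (ExteriorAlgebra.algebraMapInv (algebraMap ℂ (ExteriorAlgebra ℂ (ι → ℂ)) r))) = 0 := by
        rw [hr, sub_self, single_zero]
      exact hzero ▸ zero_mem _
    | add a b ha hb =>
      rw [map_add, map_add, add_sub_add_comm, single_add]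
      exact add_mem ha hb
    | mul_ι v a _ =>
      have hv : ExteriorAlgebra.algebraMapInv (ExteriorAlgebra.ι ℂ v) = 0 := by
        simp only [ExteriorAlgebra.algebraMapInv, ExteriorAlgebra.lift_ι_apply,
          LinearMap.zero_apply]
      have hsplit : single m (a * ExteriorAlgebra.ι ℂ v -
          algebraMap ℂ _ (ExteriorAlgebra.algebraMapInv (a * ExteriorAlgebra.ι ℂ v))) =
          single m a * single 0 (ExteriorAlgebra.ι ℂ v) := by
        rw [map_mul, hv, mul_zero, map_zero, sub_zero, single_mul_single, add_zero]
      exact hsplit ▸ Ideal.mul_mem_left _ _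
        (odd_mem_oddIdeal (single_mem_polyPart (CliffordAlgebra.ι_mem_evenOdd_one 0 v) 0))

theorem isNilpotent_sub_ofBody_body (f : SuperPoly M ι) :
    IsNilpotent (f - ofBody M ι (body M ι f)) :=
  isNilpotent_of_mem_oddIdeal (sub_ofBody_body_mem f)

end Body

section ToExterior

open AddMonoidAlgebra TensorProduct

variable {M ι : Type*} [AddCommMonoid M] (R : Type*) [CommRing R] [Algebra ℂ R]
  [Algebra (AddMonoidAlgebra ℂ M) R]

variable (M ι) in
/-- The extension of scalars `ℂ[M] ⊗ ⋀ → R ⊗ ⋀` along `ℂ[M] → R`. -/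
def toTensor : SuperPoly M ι →+* R ⊗[ℂ] ExteriorAlgebra ℂ (ι → ℂ) :=
  liftNCRingHom
    (Algebra.TensorProduct.includeRight : ExteriorAlgebra ℂ (ι → ℂ) →ₐ[ℂ] _).toRingHom
    ((Algebra.TensorProduct.includeLeft (R := ℂ) (S := R) (A := R)
        (B := ExteriorAlgebra ℂ (ι → ℂ))).toMonoidHom.comp
      ((algebraMap (AddMonoidAlgebra ℂ M) R : AddMonoidAlgebra ℂ M →* R).comp (of ℂ M)))
    fun c m => by
      change (1 ⊗ₜ c) * (_ ⊗ₜ 1) = (_ ⊗ₜ 1) * (1 ⊗ₜ c)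
      rw [Algebra.TensorProduct.tmul_mul_tmul, Algebra.TensorProduct.tmul_mul_tmul, one_mul,
        one_mul, mul_one, mul_one]

theorem toTensor_single (m : M) (c : ExteriorAlgebra ℂ (ι → ℂ)) :
    toTensor M ι R (single m c) = algebraMap (AddMonoidAlgebra ℂ M) R (single m 1) ⊗ₜ c := by
  refine (liftNC_single _ _ m c).trans ?_
  change (1 ⊗ₜ c) * (algebraMap (AddMonoidAlgebra ℂ M) R (single m 1) ⊗ₜ 1) = _
  rw [Algebra.TensorProduct.tmul_mul_tmul, one_mul, mul_one]

variable (M ι) in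
/-- The extension of scalars `⋀_ℂ[M] → ⋀_R` along `ℂ[M] → R`. -/
def toExterior : SuperPoly M ι →+* ExteriorAlgebra R (R ⊗[ℂ] (ι → ℂ)) :=
  (exteriorBaseChange R (ι → ℂ)).toRingEquiv.toRingHom.comp (toTensor M ι R)

theorem toExterior_mem {i : ZMod 2} {f : SuperPoly M ι} (hf : f ∈ part (SuperPoly M ι) i) :
    toExterior M ι R f ∈ exteriorPart R (R ⊗[ℂ] (ι → ℂ)) i := by
  refine polyPart_induction (p := fun f => toExterior M ι R f ∈ exteriorPart R _ i) hf ?_ ?_ ?_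
  · exact (map_zero (toExterior M ι R)).symm ▸ zero_mem _
  · exact fun f g hf hg => (map_add (toExterior M ι R) f g).symm ▸ add_mem hf hg
  · intro m c hc
    change exteriorBaseChange R _ (toTensor M ι R (single m c)) ∈ _
    exact (toTensor_single R m c).symm ▸ exteriorBaseChange_tmul_mem _ hc

variable [IsScalarTower ℂ (AddMonoidAlgebra ℂ M) R]

theorem toTensor_injective (hR : Function.Injective (algebraMap (AddMonoidAlgebra ℂ M) R)) :
    Function.Injective (toTensor M ι R) := by
  classical
  let incl : (M →₀ ℂ) →ₗ[ℂ] R := (IsScalarTower.toAlgHom ℂ (AddMonoidAlgebra ℂ M) R).toLinearMap ∘ₗ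
    (coeffLinearEquiv ℂ).symm.toLinearMap
  let e := (TensorProduct.finsuppScalarLeft ℂ (ExteriorAlgebra ℂ (ι → ℂ)) M).symm
  have hincl : Function.Injective (incl.rTensor (ExteriorAlgebra ℂ (ι → ℂ))) :=
    Module.Flat.rTensor_preserves_injective_linearMap _
      (hR.comp (coeffLinearEquiv ℂ).symm.injective)
  have hfactor : ∀ f : SuperPoly M ι, toTensor M ι R f = incl.rTensor _ (e f.coeff) := by
    intro f
    induction f using AddMonoidAlgebra.induction_linear with
    | zero => simp only [map_zero, coeff_zero]
    | add f g hf hg => simp only [map_add, coeff_add, hf, hg]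
    | single m c =>
      rw [toTensor_single, coeff_single, TensorProduct.finsuppScalarLeft_symm_apply_single,
        LinearMap.rTensor_tmul]
      rfl
  rw [funext hfactor]
  exact (hincl.comp e.injective).comp coeff_injective

theorem toTensor_ofBody (p : AddMonoidAlgebra ℂ M) :
    toTensor M ι R (ofBody M ι p) = algebraMap (AddMonoidAlgebra ℂ M) R p ⊗ₜ 1 := by
  induction p using AddMonoidAlgebra.induction_linear with
  | zero => simp only [map_zero, TensorProduct.zero_tmul]
  | add p q hp hq => rw [map_add, map_add, hp, hq, map_add, TensorProduct.add_tmul]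
  | single m z =>
    rw [ofBody_single, toTensor_single, Algebra.algebraMap_eq_smul_one (R := ℂ),
      ← TensorProduct.smul_tmul, ← IsScalarTower.coe_toAlgHom' ℂ (AddMonoidAlgebra ℂ M) R,
      ← map_smul, smul_single, smul_eq_mul, mul_one]

end ToExterior

section FractionField

open AddMonoidAlgebra TensorProduct

variable {M ι : Type*} [AddCommMonoid M] (K : Type*) [CommRing K] [Algebra ℂ K]
  [Algebra (AddMonoidAlgebra ℂ M) K] [IsScalarTower ℂ (AddMonoidAlgebra ℂ M) K]
  [IsFractionRing (AddMonoidAlgebra ℂ M) K]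

theorem isUnit_toTensor_ofBody {p : AddMonoidAlgebra ℂ M}
    (hp : p ∈ nonZeroDivisors (AddMonoidAlgebra ℂ M)) : IsUnit (toTensor M ι K (ofBody M ι p)) := by
  rw [toTensor_ofBody]
  exact (IsLocalization.map_units K (⟨p, hp⟩ : nonZeroDivisors _)).map
    (Algebra.TensorProduct.includeLeft (R := ℂ) (S := K) (A := K)
    (B := ExteriorAlgebra ℂ (ι → ℂ)))

theorem exists_toTensor_ofBody_mul_eq (z : K ⊗[ℂ] ExteriorAlgebra ℂ (ι → ℂ)) :
    ∃ p ∈ nonZeroDivisors (AddMonoidAlgebra ℂ M),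
      ∃ f, toTensor M ι K (ofBody M ι p) * z = toTensor M ι K f := by
  induction z using TensorProduct.induction_on with
  | zero => exact ⟨1, one_mem _, 0, by rw [mul_zero, map_zero]⟩
  | tmul r c =>
    obtain ⟨⟨a, p⟩, hap⟩ := IsLocalization.surj (nonZeroDivisors (AddMonoidAlgebra ℂ M)) r
    refine ⟨p.1, p.2, ofBody M ι a * single 0 c, ?_⟩
    rw [map_mul, toTensor_ofBody, toTensor_ofBody, toTensor_single,
      Algebra.TensorProduct.tmul_mul_tmul, Algebra.TensorProduct.tmul_mul_tmul, ← one_def,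
      map_one, mul_one, mul_comm, hap]
  | add z w hz hw =>
    obtain ⟨p, hp, f, hf⟩ := hz
    obtain ⟨q, hq, g, hg⟩ := hw
    refine ⟨p * q, mul_mem hp hq, ofBody M ι q * f + ofBody M ι p * g, ?_⟩
    rw [map_add, map_mul _ _ f, map_mul _ _ g, ← hf, ← hg, mul_add]
    simp only [← mul_assoc, ← map_mul, mul_comm q p]

variable [IsDomain (AddMonoidAlgebra ℂ M)]

theorem isUnit_toTensor {s : evenSub (SuperPoly M ι)} (hs : s ∉ nilradical (evenSub _)) :
    IsUnit (toTensor M ι K s) := by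
  have hnil := isNilpotent_sub_ofBody_body (s : SuperPoly M ι)
  have hbody : body M ι s ≠ 0 := by
    refine fun h => hs (isNilpotent_coe_iff.1 ?_)
    rwa [h, map_zero, sub_zero] at hnil
  have hcomm : toTensor M ι K _ * toTensor M ι K _ = _ :=
    map_even_comm (toTensor M ι K) ⟨_, ofBody_mem (body M ι s)⟩ (s - ofBody M ι (body M ι s.1))
  have hunit := (hnil.map (toTensor M ι K)).isUnit_add_left_of_commute
    (isUnit_toTensor_ofBody K (mem_nonZeroDivisors_of_ne_zero hbody)) hcomm.symm
  rwa [← map_add, add_sub_cancel] at hunit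

theorem isExteriorLocalization_toExterior :
    IsExteriorLocalization (toExterior M ι K) where
  injective := (exteriorBaseChange K (ι → ℂ)).injective.comp
    (toTensor_injective K (IsFractionRing.injective (AddMonoidAlgebra ℂ M) K))
  isUnit _ hs := (isUnit_toTensor K hs).map (exteriorBaseChange K (ι → ℂ))
  exists_mul_eq x := by
    obtain ⟨z, rfl⟩ := (exteriorBaseChange K (ι → ℂ)).surjective x
    obtain ⟨p, hp, f, hf⟩ := exists_toTensor_ofBody_mul_eq (M := M) K z
    refine ⟨⟨ofBody M ι p, ofBody_mem p⟩, fun hnil => nonZeroDivisors.ne_zero hp ?_, f, ?_⟩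
    · have h := (isNilpotent_coe_iff.2 (mem_nilradical.1 hnil)).map (body M ι)
      rw [body_ofBody] at h
      exact h.eq_zero
    · exact (map_mul (exteriorBaseChange K (ι → ℂ)) _ z).symm.trans (congrArg _ hf)
  map_part _ _ := toExterior_mem K

end FractionField

/-! ### The action of a supertorus -/

section Contraction

variable {k V : Type*} [CommRing k] [AddCommGroup V] [Module k V] {Q : QuadraticForm k V}

open CliffordAlgebra

theorem contractLeft_mul (d : Module.Dual k V) (a b : CliffordAlgebra Q) :
    contractLeft d (a * b) = contractLeft d a * b + involute a * contractLeft d b := by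
  induction a using left_induction with
  | algebraMap r =>
    rw [contractLeft_algebraMap_mul, contractLeft_algebraMap, AlgHom.commutes, zero_mul, zero_add]
  | add x y hx hy => simp only [add_mul, map_add, hx, hy]; abel
  | ι_mul x v hx =>
    rw [mul_assoc, contractLeft_ι_mul, hx, contractLeft_ι_mul, map_mul, involute_ι]
    simp only [sub_mul, mul_add, smul_mul_assoc, neg_mul, mul_assoc]
    abel

theorem contractLeft_mem_evenOdd (d : Module.Dual k V) {i : ZMod 2} {a : CliffordAlgebra Q}
    (ha : a ∈ evenOdd Q i) : contractLeft d a ∈ evenOdd Q (i + 1) := by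
  have hpow : ∀ (n : ℕ), ∀ x ∈ LinearMap.range (ι Q) ^ n,
      contractLeft d x ∈ evenOdd Q (n + 1) := by
    intro n x hx
    induction hx using Submodule.pow_induction_on_left' with
    | algebraMap r => rw [contractLeft_algebraMap]; exact zero_mem _
    | add x y n _ _ hx hy => rw [map_add]; exact add_mem hx hy
    | mem_mul v hv n x hx ih =>
      obtain ⟨v, rfl⟩ := hv
      have hn : ((n + 1 : ℕ) + 1 : ZMod 2) = n := by
        rw [Nat.cast_succ, add_assoc, CharTwo.add_self_eq_zero, add_zero]
      have hn' : ((n + 1 : ℕ) + 1 : ZMod 2) = 1 + (n + 1) := by rw [Nat.cast_succ, add_comm]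
      rw [contractLeft_ι_mul]
      refine sub_mem (Submodule.smul_mem _ _ ?_) ?_
      · exact hn.symm ▸ Submodule.mem_iSup_of_mem ⟨n, rfl⟩ hx
      · exact hn'.symm ▸ SetLike.mul_mem_graded (ι_mem_evenOdd_one Q v) ih
  induction ha using Submodule.iSup_induction' with
  | mem n x hx => exact n.2 ▸ hpow n x hx
  | zero => rw [map_zero]; exact zero_mem _
  | add x y _ _ hx hy => rw [map_add]; exact add_mem hx hy

theorem involute_eq_neg_one_pow_smul {i : ZMod 2} {a : CliffordAlgebra Q}
    (ha : a ∈ evenOdd Q i) : involute a = (-1 : k) ^ i.val • a := by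
  have zero_or_one : ∀ i : ZMod 2, i = 0 ∨ i = 1 := by decide
  obtain rfl | rfl := zero_or_one i
  · rw [involute_eq_of_mem_even ha, ZMod.val_zero, pow_zero, one_smul]
  · rw [involute_eq_of_mem_odd ha, ZMod.val_one, pow_one, neg_one_smul]

end Contraction

section OddDeriv

open AddMonoidAlgebra

variable {M ι : Type*}

variable (M) in
/-- The odd derivation `-∂/∂ξ_i`, by which the odd generators of a supertorus with zero bracket
act on functions. -/
def oddDeriv (i : ι) : SuperPoly M ι →ₗ[ℂ] SuperPoly M ι :=
  (coeffLinearEquiv ℂ).symm.toLinearMap ∘ₗ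
    Finsupp.mapRange.linearMap (-CliffordAlgebra.contractLeft
      (Q := (0 : QuadraticForm ℂ (ι → ℂ))) (LinearMap.proj i)) ∘ₗ
    (coeffLinearEquiv ℂ).toLinearMap

theorem oddDeriv_single (i : ι) (m : M) (c : ExteriorAlgebra ℂ (ι → ℂ)) :
    oddDeriv M i (single m c) = single m (-CliffordAlgebra.contractLeft
      (Q := (0 : QuadraticForm ℂ (ι → ℂ))) (LinearMap.proj i) c) := by
  ext n
  simp [oddDeriv]

theorem oddDeriv_add_swap (i j : ι) (f : SuperPoly M ι) :
    oddDeriv M i (oddDeriv M j f) + oddDeriv M j (oddDeriv M i f) = 0 := by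
  induction f using AddMonoidAlgebra.induction_linear with
  | zero => simp only [map_zero, add_zero]
  | add f g hf hg => rw [map_add, map_add, map_add, map_add, add_add_add_comm, hf, hg, add_zero]
  | single m c =>
    simp only [oddDeriv_single, map_neg, neg_neg]
    rw [← single_add, CliffordAlgebra.contractLeft_comm, neg_add_cancel, single_zero]

variable [AddCommMonoid M]

theorem map_mem_of_forall_single_mem {E : Type*} [AddCommGroup E] [Module ℂ E]
    (D : SuperPoly M ι →ₗ[ℂ] E) (p : Submodule ℂ E) {i : ZMod 2}
    (h : ∀ m, ∀ c ∈ extPart ι i, D (single m c) ∈ p) {f : SuperPoly M ι}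
    (hf : f ∈ part (SuperPoly M ι) i) : D f ∈ p :=
  polyPart_induction (p := fun f => D f ∈ p) hf (by rw [map_zero]; exact zero_mem _)
    (fun _ _ hf hg => by rw [map_add]; exact add_mem hf hg) h

theorem oddDeriv_mem (i : ι) {k : ZMod 2} {f : SuperPoly M ι} (hf : f ∈ part (SuperPoly M ι) k) :
    oddDeriv M i f ∈ part (SuperPoly M ι) (k + 1) :=
  map_mem_of_forall_single_mem (oddDeriv M i) _
    (fun m c hc => (oddDeriv_single i m c).symm ▸
      single_mem_polyPart (neg_mem (contractLeft_mem_evenOdd _ hc)) m) hf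

theorem oddDeriv_mul (i : ι) {k : ZMod 2} {f : SuperPoly M ι} (hf : f ∈ part (SuperPoly M ι) k)
    (g : SuperPoly M ι) :
    oddDeriv M i (f * g) = oddDeriv M i f * g + (-1 : ℂ) ^ k.val • (f * oddDeriv M i g) := by
  refine polyPart_induction (p := fun f => oddDeriv M i (f * g) =
    oddDeriv M i f * g + (-1 : ℂ) ^ k.val • (f * oddDeriv M i g)) hf ?_ ?_ fun m c hc => ?_
  · simp only [zero_mul, map_zero, smul_zero, add_zero]
  · intro f f' hf hf'
    simp only [add_mul, map_add, hf, hf', smul_add]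
    abel
  · induction g using AddMonoidAlgebra.induction_linear with
    | zero => simp only [mul_zero, map_zero, smul_zero, add_zero]
    | add g g' hg hg' => simp only [mul_add, map_add, hg, hg', smul_add]; abel
    | single n c' =>
      simp only [oddDeriv_single, single_mul_single, smul_single, ← single_add]
      rw [contractLeft_mul, involute_eq_neg_one_pow_smul hc]
      simp only [neg_add, neg_mul, mul_neg, smul_neg, smul_mul_assoc]

theorem oddDeriv_algebraMap (i : ι) (z : ℂ) :
    oddDeriv M i (algebraMap ℂ (SuperPoly M ι) z) = 0 := by
  rw [show algebraMap ℂ (SuperPoly M ι) z = single 0 (algebraMap ℂ _ z) from rfl, oddDeriv_single,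
    CliffordAlgebra.contractLeft_algebraMap, neg_zero, single_zero]

end OddDeriv

section TorusAction

open AddMonoidAlgebra

theorem torusChar_zero {p : ℕ} (t : Fin p → ℂˣ) : torusChar 0 t = 1 := by
  simp [torusChar]

theorem torusChar_add {p : ℕ} (m n : Fin p → ℤ) (t : Fin p → ℂˣ) :
    torusChar (m + n) t = torusChar m t * torusChar n t := by
  simp [torusChar, zpow_add, Finset.prod_mul_distrib]

theorem torusChar_mul {p : ℕ} (m : Fin p → ℤ) (t t' : Fin p → ℂˣ) :
    torusChar m (t * t') = torusChar m t * torusChar m t' := by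
  simp [torusChar, mul_zpow, Finset.prod_mul_distrib]

theorem torusChar_one {p : ℕ} (m : Fin p → ℤ) : torusChar m (1 : Fin p → ℂˣ) = 1 := by
  simp [torusChar]

namespace Supertorus

variable (T : Supertorus)

theorem translate_single (t : Fin T.p → ℂˣ) (m : Fin T.p → ℤ)
    (c : ExteriorAlgebra ℂ (Fin T.q → ℂ)) :
    T.translate t (single m c) = torusChar (-m) t • (single m c : T.Coord) := by
  rw [translate, coeff_single, Finsupp.sum_single_index, smul_single]
  rw [smul_zero, single_zero]

/-- Left translation by `t ∈ T₀` as a linear map. -/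
def translateLinearMap (t : Fin T.p → ℂˣ) : T.Coord →ₗ[ℂ] T.Coord :=
  Finsupp.lsum ℂ (fun m => torusChar (-m) t • lsingle m) ∘ₗ (coeffLinearEquiv ℂ).toLinearMap

theorem translateLinearMap_apply (t : Fin T.p → ℂˣ) (f : T.Coord) :
    T.translateLinearMap t f = T.translate t f :=
  Finsupp.sum_congr fun m _ => smul_single (torusChar (-m) t) m _

theorem translateLinearMap_single (t : Fin T.p → ℂˣ) (m : Fin T.p → ℤ)
    (c : ExteriorAlgebra ℂ (Fin T.q → ℂ)) :
    T.translateLinearMap t (single m c) = torusChar (-m) t • (single m c : T.Coord) := by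
  rw [translateLinearMap_apply, translate_single]

theorem translateLinearMap_mul (t : Fin T.p → ℂˣ) (f g : T.Coord) :
    T.translateLinearMap t (f * g) = T.translateLinearMap t f * T.translateLinearMap t g := by
  induction f using AddMonoidAlgebra.induction_linear with
  | zero => rw [zero_mul, map_zero, zero_mul]
  | add f f' hf hf' => rw [add_mul, map_add, hf, hf', map_add, add_mul]
  | single m a =>
    induction g using AddMonoidAlgebra.induction_linear with
    | zero => rw [mul_zero, map_zero, mul_zero]
    | add g g' hg hg' => rw [mul_add, map_add, hg, hg', map_add, mul_add]
    | single n b =>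
      rw [single_mul_single, translateLinearMap_single, translateLinearMap_single,
        translateLinearMap_single, neg_add, torusChar_add, smul_mul_smul_comm, single_mul_single]

/-- The action of `T₀` on functions on `T` by left translation. -/
def translateHom : (Fin T.p → ℂˣ) →* (T.Coord →ₐ[ℂ] T.Coord) where
  toFun t := AlgHom.ofLinearMap (T.translateLinearMap t)
    (by rw [one_def, translateLinearMap_single, neg_zero, torusChar_zero, one_smul])
    (T.translateLinearMap_mul t)
  map_one' := AlgHom.ext fun f => by
    change T.translateLinearMap 1 f = f
    induction f using AddMonoidAlgebra.induction_linear with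
    | zero => rw [map_zero]
    | add f g hf hg => rw [map_add, hf, hg]
    | single m c => rw [translateLinearMap_single, torusChar_one, one_smul]
  map_mul' t t' := AlgHom.ext fun f => by
    change T.translateLinearMap (t * t') f = T.translateLinearMap t (T.translateLinearMap t' f)
    induction f using AddMonoidAlgebra.induction_linear with
    | zero => simp only [map_zero]
    | add f g hf hg => simp only [map_add, hf, hg]
    | single m c =>
      rw [translateLinearMap_single, translateLinearMap_single, map_smul,
        translateLinearMap_single, smul_smul, torusChar_mul, mul_comm]

theorem translateHom_apply (t : Fin T.p → ℂˣ) (f : T.Coord) :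
    T.translateHom t f = T.translate t f :=
  T.translateLinearMap_apply t f

theorem translateHom_single (t : Fin T.p → ℂˣ) (m : Fin T.p → ℤ)
    (c : ExteriorAlgebra ℂ (Fin T.q → ℂ)) :
    T.translateHom t (single m c) = torusChar (-m) t • (single m c : T.Coord) :=
  T.translateLinearMap_single t m c

theorem translateHom_mem (t : Fin T.p → ℂˣ) {k : ZMod 2} {f : T.Coord}
    (hf : f ∈ part T.Coord k) : T.translateHom t f ∈ part T.Coord k :=
  map_mem_of_forall_single_mem (T.translateHom t).toLinearMap _ (fun m c hc =>
    (T.translateHom_single t m c).symm ▸ Submodule.smul_mem _ _ (single_mem_polyPart hc m)) hf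

theorem oddDeriv_translateHom (i : Fin T.q) (t : Fin T.p → ℂˣ) (f : T.Coord) :
    oddDeriv _ i (T.translateHom t f) = T.translateHom t (oddDeriv _ i f) := by
  induction f using AddMonoidAlgebra.induction_linear with
  | zero => simp only [map_zero]
  | add f g hf hg => simp only [map_add, hf, hg]
  | single m a => rw [translateHom_single, map_smul, oddDeriv_single, translateHom_single]

theorem oddField_eq_oddDeriv (hT : T.bracket = 0) (i : Fin T.q) (f : T.Coord) :
    T.oddField i f = oddDeriv _ i f := by
  have hsum : T.oddField i f = f.coeff.sum fun m c => oddDeriv _ i (single m c) := by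
    refine Finsupp.sum_congr fun m _ => ?_
    rw [oddDeriv_single, hT]
    simp [weightPairing]
  rw [hsum, ← map_finsuppSum]
  exact congrArg _ (AddMonoidAlgebra.sum_coeff_single f)

/-- The action of a supertorus with zero bracket on itself by left translation. -/
def regularAction (hT : T.bracket = 0) : T.Action T.Coord where
  grp := T.translateHom
  grp_part t _ _ := T.translateHom_mem t
  rational f := by
    induction f using AddMonoidAlgebra.induction_linear with
    | zero => exact zero_mem _
    | add f g hf hg => exact add_mem hf hg
    | single m c => exact Submodule.subset_span ⟨-m, fun t => T.translateHom_single t m c⟩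
  odd := oddDeriv _
  odd_part i _ _ := oddDeriv_mem i
  leibniz i _ _ b ha := oddDeriv_mul i ha b
  odd_grp := T.oddDeriv_translateHom
  odd_odd i j m w _ := by
    rw [oddDeriv_add_swap, hT]
    simp [weightPairing]

end Supertorus

end TorusAction

section Restriction

variable {A B : Type*} [Ring A] [Algebra ℂ A] [SuperCommAlgebra A]
  [Ring B] [Algebra ℂ B] [SuperCommAlgebra B]

theorem SuperHom.mem_part_of_map_mem {φ : SuperHom A B} (hφ : Function.Injective φ.toAlgHom)
    {i : ZMod 2} {a : A} (ha : φ.toAlgHom a ∈ part B i) : a ∈ part A i := by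
  obtain ⟨a₀, a₁, h₁, rfl⟩ := exists_eq_even_add_odd a
  have hB := SuperCommAlgebra.isCompl (A := B)
  have k₀ : φ.toAlgHom a₀ ∈ part B 0 := φ.map_part 0 _ a₀.2
  have k₁ : φ.toAlgHom a₁ ∈ part B 1 := φ.map_part 1 _ h₁
  rw [map_add] at ha
  have zero_or_one : ∀ i : ZMod 2, i = 0 ∨ i = 1 := by decide
  obtain rfl | rfl := zero_or_one i
  · have h : φ.toAlgHom a₁ = 0 := Submodule.disjoint_def.1 hB.disjoint _
      (by simpa only [add_sub_cancel_left] using sub_mem ha k₀) k₁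
    rw [(map_eq_zero_iff _ hφ).1 h, add_zero]
    exact a₀.2
  · have h : φ.toAlgHom a₀ = 0 := Submodule.disjoint_def.1 hB.disjoint _ k₀
      (by simpa only [add_sub_cancel_right] using sub_mem ha k₁)
    rw [(map_eq_zero_iff _ hφ).1 h, zero_add]
    exact h₁

/-- The restriction of a linear map along an injective linear map whose range it preserves. -/
def restrictAlong {V W : Type*} [AddCommGroup V] [Module ℂ V] [AddCommGroup W] [Module ℂ W]
    (φ : V →ₗ[ℂ] W) (hφ : Function.Injective φ) (D : W →ₗ[ℂ] W)
    (h : ∀ v, D (φ v) ∈ LinearMap.range φ) : V →ₗ[ℂ] V :=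
  (LinearEquiv.ofInjective φ hφ).symm.toLinearMap ∘ₗ (D ∘ₗ φ).codRestrict _ h

theorem map_restrictAlong {V W : Type*} [AddCommGroup V] [Module ℂ V] [AddCommGroup W]
    [Module ℂ W] (φ : V →ₗ[ℂ] W) (hφ : Function.Injective φ) (D : W →ₗ[ℂ] W)
    (h : ∀ v, D (φ v) ∈ LinearMap.range φ) (v : V) :
    φ (restrictAlong φ hφ D h v) = D (φ v) :=
  LinearEquiv.ofInjective_symm_apply φ (h := hφ) ((D ∘ₗ φ).codRestrict _ h v)

namespace Supertorus

variable {T : Supertorus}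

theorem Action.grp_mem_range (ρ : T.Action B) (φ : SuperHom A B)
    (hspan : ∀ a : A, a ∈ Submodule.span ℂ
      {a | ∃ m, ∀ t, ρ.grp t (φ.toAlgHom a) = torusChar m t • φ.toAlgHom a})
    (t : Fin T.p → ℂˣ) (a : A) :
    ρ.grp t (φ.toAlgHom a) ∈ LinearMap.range φ.toAlgHom.toLinearMap := by
  induction hspan a using Submodule.span_induction with
  | mem a ha =>
    obtain ⟨m, hm⟩ := ha
    exact ⟨torusChar m t • a, by rw [hm]; exact map_smul φ.toAlgHom _ a⟩
  | zero => simp only [map_zero, zero_mem]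
  | add a b _ _ ha hb => rw [map_add, map_add]; exact add_mem ha hb
  | smul c a _ ha => rw [map_smul, map_smul]; exact Submodule.smul_mem _ _ ha

/-- The restriction of an action on `Spec B` to the image of `Spec B → Spec A`, for a subalgebra
`φ : A → B` that is spanned by weight vectors and stable under the odd derivations. -/
def Action.restrict (ρ : T.Action B) (φ : SuperHom A B) (hφ : Function.Injective φ.toAlgHom)
    (hspan : ∀ a : A, a ∈ Submodule.span ℂ
      {a | ∃ m, ∀ t, ρ.grp t (φ.toAlgHom a) = torusChar m t • φ.toAlgHom a})
    (hodd : ∀ i a, ρ.odd i (φ.toAlgHom a) ∈ LinearMap.range φ.toAlgHom.toLinearMap) :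
    T.Action A :=
  let G t := restrictAlong φ.toAlgHom.toLinearMap hφ (ρ.grp t).toLinearMap
    (ρ.grp_mem_range φ hspan t)
  have hG t a : φ.toAlgHom (G t a) = ρ.grp t (φ.toAlgHom a) :=
    map_restrictAlong φ.toAlgHom.toLinearMap hφ (ρ.grp t).toLinearMap (ρ.grp_mem_range φ hspan t) a
  let D i := restrictAlong φ.toAlgHom.toLinearMap hφ (ρ.odd i) (hodd i)
  have hD i a : φ.toAlgHom (D i a) = ρ.odd i (φ.toAlgHom a) :=
    map_restrictAlong φ.toAlgHom.toLinearMap hφ (ρ.odd i) (hodd i) a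
  { grp :=
      { toFun t := AlgHom.ofLinearMap (G t) (hφ (by rw [hG, map_one, map_one]))
          fun a b => hφ (by simp only [hG, map_mul])
        map_one' := AlgHom.ext fun a => hφ ((hG 1 a).trans (by rw [map_one]; rfl))
        map_mul' t t' := AlgHom.ext fun a => hφ (by
          change φ.toAlgHom (G (t * t') a) = φ.toAlgHom (G t (G t' a))
          rw [hG, hG, hG, map_mul]; rfl) }
    grp_part t i a ha := SuperHom.mem_part_of_map_mem hφ
      ((hG t a).symm ▸ ρ.grp_part t i _ (φ.map_part i a ha))
    rational a := by
      refine Submodule.span_mono ?_ (hspan a)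
      rintro b ⟨m, hm⟩
      exact ⟨m, fun t => hφ (((hG t b).trans (hm t)).trans (map_smul φ.toAlgHom _ b).symm)⟩
    odd := D
    odd_part i k a ha := SuperHom.mem_part_of_map_mem hφ
      ((hD i a).symm ▸ ρ.odd_part i k _ (φ.map_part k a ha))
    leibniz i k a b ha := hφ (by
      rw [hD, map_mul, ρ.leibniz i k (φ.toAlgHom a) _ (φ.map_part k a ha), map_add, map_mul,
        map_smul, map_mul, hD, hD])
    odd_grp i t a := hφ (by
      change φ.toAlgHom (D i (G t a)) = φ.toAlgHom (G t (D i a))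
      rw [hD, hG, hG, hD, ρ.odd_grp])
    odd_odd i j m w hw := hφ (by
      have hw' t : ρ.grp t (φ.toAlgHom w) = torusChar m t • φ.toAlgHom w := by
        rw [← hG, ← map_smul]; exact congrArg _ (hw t)
      simp only [map_add, map_smul, hD, ρ.odd_odd i j m _ hw']) }

theorem Action.map_restrict_grp (ρ : T.Action B) (φ : SuperHom A B)
    (hφ : Function.Injective φ.toAlgHom)
    (hspan : ∀ a : A, a ∈ Submodule.span ℂ
      {a | ∃ m, ∀ t, ρ.grp t (φ.toAlgHom a) = torusChar m t • φ.toAlgHom a})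
    (hodd : ∀ i a, ρ.odd i (φ.toAlgHom a) ∈ LinearMap.range φ.toAlgHom.toLinearMap)
    (t : Fin T.p → ℂˣ) (a : A) :
    φ.toAlgHom ((ρ.restrict φ hφ hspan hodd).grp t a) = ρ.grp t (φ.toAlgHom a) :=
  map_restrictAlong φ.toAlgHom.toLinearMap hφ (ρ.grp t).toLinearMap (ρ.grp_mem_range φ hspan t) a

theorem Action.map_restrict_odd (ρ : T.Action B) (φ : SuperHom A B)
    (hφ : Function.Injective φ.toAlgHom)
    (hspan : ∀ a : A, a ∈ Submodule.span ℂ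
      {a | ∃ m, ∀ t, ρ.grp t (φ.toAlgHom a) = torusChar m t • φ.toAlgHom a})
    (hodd : ∀ i a, ρ.odd i (φ.toAlgHom a) ∈ LinearMap.range φ.toAlgHom.toLinearMap)
    (i : Fin T.q) (a : A) :
    φ.toAlgHom ((ρ.restrict φ hφ hspan hodd).odd i a) = ρ.odd i (φ.toAlgHom a) :=
  map_restrictAlong φ.toAlgHom.toLinearMap hφ (ρ.odd i) (hodd i) a

end Supertorus

end Restriction

section Criterion

open TensorProduct

theorem IsPrincipalLocalization.isIrreducibleSupervariety {A : Type u} [Ring A] [Algebra ℂ A]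
    [SuperCommAlgebra A] {M ι : Type u} [AddCommMonoid M] [IsDomain (AddMonoidAlgebra ℂ M)]
    {φ : SuperHom A (SuperPoly M ι)} {f : evenSub A} (h : IsPrincipalLocalization φ f)
    (hft : Algebra.FiniteType ℂ A) : IsIrreducibleSupervariety A :=
  have hA := (isExteriorLocalization_toExterior
    (FractionRing (AddMonoidAlgebra ℂ M))).comp_of_isPrincipalLocalization h
  { irreducible := hA.isIntegralSuperring.irreducibleSpace
    reduced := hA.isIntegralSuperring.specIsReduced
    gfr := hA.specIsGFR
    finiteType := hft
    separated a := ⟨a ⊗ₜ 1, by rw [LinearMap.mul'_apply, mul_one]⟩ }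

theorem isFaithfulToricSupervariety_of_isPrincipalLocalization {A : Type} [Ring A] [Algebra ℂ A]
    [SuperCommAlgebra A] {T : Supertorus} (hT : T.bracket = 0) {φ : SuperHom A T.Coord}
    {f : evenSub A} (h : IsPrincipalLocalization φ f)
    (hspan : ∀ a : A, a ∈ Submodule.span ℂ
      {a | ∃ m c, φ.toAlgHom a = AddMonoidAlgebra.single m c})
    (hodd : ∀ i a, oddDeriv _ i (φ.toAlgHom a) ∈ LinearMap.range φ.toAlgHom.toLinearMap)
    (hft : Algebra.FiniteType ℂ A) : IsFaithfulToricSupervariety A := by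
  have hweight : ∀ a : A, a ∈ Submodule.span ℂ {a | ∃ m, ∀ t,
      (T.regularAction hT).grp t (φ.toAlgHom a) = torusChar m t • φ.toAlgHom a} := by
    refine fun a => Submodule.span_mono ?_ (hspan a)
    rintro b ⟨m, c, hb⟩
    exact ⟨-m, fun t => by rw [hb]; exact T.translateHom_single t m c⟩
  refine ⟨h.isIrreducibleSupervariety hft, T,
    (T.regularAction hT).restrict φ h.injective hweight hodd, φ, fun t a => ?_, fun i a => ?_,
    h.isOpenImmersion⟩
  · exact ((T.regularAction hT).map_restrict_grp φ h.injective hweight hodd t a).trans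
      (T.translateHom_apply t _)
  · exact ((T.regularAction hT).map_restrict_odd φ h.injective hweight hodd i a).trans
      (T.oddField_eq_oddDeriv hT i _).symm

end Criterion

/-! ### Monomial superalgebras -/

section MapVars

open AddMonoidAlgebra

variable {M N ι κ : Type*} [AddCommMonoid M] [AddCommMonoid N]

/-- The monomial change of variables given by an additive map `w` on exponents and a linear map `r`
on the span of the odd variables. -/
def mapVars (w : M →+ N) (r : (ι → ℂ) →ₗ[ℂ] (κ → ℂ)) : SuperPoly M ι →ₐ[ℂ] SuperPoly N κ :=
  (mapDomainAlgHom ℂ _ w).comp (mapAlgHom M (ExteriorAlgebra.map r))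

theorem mapVars_single (w : M →+ N) (r : (ι → ℂ) →ₗ[ℂ] (κ → ℂ)) (m : M)
    (c : ExteriorAlgebra ℂ (ι → ℂ)) :
    mapVars w r (single m c) = single (w m) (ExteriorAlgebra.map r c) := by
  simp [mapVars]

theorem exteriorAlgebra_map_mem_extPart (r : (ι → ℂ) →ₗ[ℂ] (κ → ℂ)) {i : ZMod 2}
    {c : ExteriorAlgebra ℂ (ι → ℂ)} (hc : c ∈ extPart ι i) :
    ExteriorAlgebra.map r c ∈ extPart κ i := by
  refine map_mem_exteriorPart (ExteriorAlgebra.map r).toRingHom (fun z => ?_) (fun v => ?_) hc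
  · exact ((ExteriorAlgebra.map r).commutes z).symm ▸ SetLike.algebraMap_mem_graded _ z
  · exact (ExteriorAlgebra.map_apply_ι r v).symm ▸ CliffordAlgebra.ι_mem_evenOdd_one 0 _

theorem mapVars_mem (w : M →+ N) (r : (ι → ℂ) →ₗ[ℂ] (κ → ℂ)) {i : ZMod 2} {f : SuperPoly M ι}
    (hf : f ∈ part (SuperPoly M ι) i) : mapVars w r f ∈ part (SuperPoly N κ) i :=
  map_mem_of_forall_single_mem (mapVars w r).toLinearMap _ (fun m c hc =>
    (mapVars_single w r m c).symm ▸ single_mem_polyPart (exteriorAlgebra_map_mem_extPart r hc) _) hf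

end MapVars

section OddVariables

variable {O : Type}

theorem xi_eq [DecidableEq O] (o : O) : xi o = ExteriorAlgebra.ι ℂ (Pi.single o 1 : O → ℂ) := by
  unfold xi
  congr!

theorem ι_eq_sum_smul_xi [Fintype O] (v : O → ℂ) : ExteriorAlgebra.ι ℂ v = ∑ o, v o • xi o := by
  classical
  conv_lhs => rw [pi_eq_sum_univ' v, map_sum]
  refine Finset.sum_congr rfl fun o _ => ?_
  rw [map_smul, xi_eq]

theorem exists_prod_xi_eq_smul_of_perm {l l' : List O} (h : l.Perm l') :
    ∃ ε : ℂ, (l.map xi).prod = ε • (l'.map xi).prod := by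
  classical
  induction h with
  | nil => exact ⟨1, (one_smul ℂ _).symm⟩
  | cons o _ ih =>
    obtain ⟨ε, hε⟩ := ih
    exact ⟨ε, by rw [List.map_cons, List.map_cons, List.prod_cons, List.prod_cons, hε,
      mul_smul_comm]⟩
  | swap o o' l =>
    refine ⟨-1, ?_⟩
    simp only [List.map_cons, List.prod_cons, ← mul_assoc, neg_smul, one_smul]
    rw [← neg_mul, xi_eq o, xi_eq o',
      eq_neg_of_add_eq_zero_left (ExteriorAlgebra.ι_add_mul_swap _ _)]
  | trans _ _ ih ih' =>
    obtain ⟨ε, hε⟩ := ih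
    obtain ⟨ε', hε'⟩ := ih'
    exact ⟨ε * ε', by rw [hε, hε', smul_smul]⟩

theorem map_prod_xi_cons [DecidableEq O] {J : Type*} (r : (O → ℂ) →ₗ[ℂ] (J → ℂ)) (o : O)
    (l : List O) :
    ExteriorAlgebra.map r ((o :: l).map xi).prod =
      ExteriorAlgebra.ι ℂ (r (Pi.single o 1)) * ExteriorAlgebra.map r (l.map xi).prod := by
  rw [List.map_cons, List.prod_cons, map_mul, xi_eq, ExteriorAlgebra.map_apply_ι]

theorem contractLeft_map_prod_xi_mem_span {J : Type*} (r : (O → ℂ) →ₗ[ℂ] (J → ℂ))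
    (d : Module.Dual ℂ (J → ℂ)) (l : List O) :
    CliffordAlgebra.contractLeft (Q := (0 : QuadraticForm ℂ (J → ℂ))) d
      (ExteriorAlgebra.map r (l.map xi).prod) ∈ Submodule.span ℂ
        {c | ∃ l' : List O, l'.Sublist l ∧ c = ExteriorAlgebra.map r (l'.map xi).prod} := by
  classical
  induction l with
  | nil =>
    rw [List.map_nil, List.prod_nil, map_one]
    exact (CliffordAlgebra.contractLeft_one (Q := (0 : QuadraticForm ℂ (J → ℂ))) d).symm ▸
      zero_mem _
  | cons o l ih =>
    rw [map_prod_xi_cons]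
    refine (CliffordAlgebra.contractLeft_ι_mul d _ _).symm ▸ sub_mem (Submodule.smul_mem _ _
      (Submodule.subset_span ⟨l, List.sublist_cons_self o l, rfl⟩)) ?_
    generalize CliffordAlgebra.contractLeft (Q := (0 : QuadraticForm ℂ (J → ℂ))) d
      (ExteriorAlgebra.map r (l.map xi).prod) = c at ih ⊢
    induction ih using Submodule.span_induction with
    | mem c hc =>
      obtain ⟨l', hl, rfl⟩ := hc
      exact Submodule.subset_span ⟨o :: l', hl.cons_cons o, (map_prod_xi_cons r o l').symm⟩
    | zero => rw [mul_zero]; exact zero_mem _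
    | add x y _ _ hx hy => rw [mul_add]; exact add_mem hx hy
    | smul z x _ hx => rw [mul_smul_comm]; exact Submodule.smul_mem _ _ hx

end OddVariables

section Extend

theorem extend_comp_of_support_subset {α β R : Type*} [Zero R] {k : α → β}
    (hk : Function.Injective k) {x : β → R} (hx : Function.support x ⊆ Set.range k) :
    Function.extend k (x ∘ k) 0 = x := by
  funext b
  by_cases hb : b ∈ Set.range k
  · obtain ⟨a, rfl⟩ := hb
    rw [hk.extend_apply, Function.comp_apply]
  · rw [Function.extend_apply' _ _ _ hb]
    exact (Function.notMem_support.1 fun h => hb (hx h)).symm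

theorem map_extend_map_funLeft_prod_xi {O : Type} {J : Type*} {j : J → O}
    (hj : Function.Injective j) {l : List O} (hl : ∀ o ∈ l, o ∈ Set.range j) :
    ExteriorAlgebra.map (Function.ExtendByZero.linearMap ℂ j)
      (ExteriorAlgebra.map (LinearMap.funLeft ℂ ℂ j) (l.map xi).prod) = (l.map xi).prod := by
  classical
  rw [← AlgHom.comp_apply, ExteriorAlgebra.map_comp_map, map_list_prod, List.map_map]
  congr 1
  refine List.map_congr_left fun o ho => ?_
  rw [Function.comp_apply, xi_eq, ExteriorAlgebra.map_apply_ι]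
  refine congrArg _ (extend_comp_of_support_subset hj (x := (Pi.single o 1 : O → ℂ))
    fun o' ho' => ?_)
  rw [Function.mem_support, Pi.single_apply, ite_ne_right_iff] at ho'
  exact ho'.1 ▸ hl o ho

end Extend

section MonomialHom

open AddMonoidAlgebra

variable {E O : Type}

/-- The exponents of the monomial `x^m v^n`, as a function on the set of even variables, where
`none` stands for `v`. -/
def exponents : (E → ℕ) × ℕ →+ (Option E → ℤ) where
  toFun m x := x.elim (m.2 : ℤ) fun e => m.1 e
  map_zero' := by funext x; cases x <;> rfl
  map_add' m n := by funext x; cases x <;> simp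

theorem exponents_injective : Function.Injective (exponents (E := E)) := by
  intro m n h
  have h₁ e : (m.1 e : ℤ) = n.1 e := congrFun h (some e)
  have h₂ : (m.2 : ℤ) = n.2 := congrFun h none
  exact Prod.ext (funext fun e => Int.ofNat_inj.1 (h₁ e)) (Int.ofNat_inj.1 h₂)

/-- The exponent `m` of the generator `x^m v` that introduces the given even variable: `0` for `v`
itself, and a unit vector for `x_e`. -/
def baseExponent (x : Option E) : E → ℕ := by
  classical exact x.elim 0 fun e => Pi.single e 1

theorem baseExponent_le {m : E → ℕ} {n : ℕ} {x : Option E} (hx : exponents (m, n) x ≠ 0) :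
    baseExponent x ≤ m := by
  classical
  cases x with
  | none => exact fun e => Nat.zero_le _
  | some e =>
    have he : m e ≠ 0 := fun h => hx (by simp [exponents, h])
    intro e'
    simp only [baseExponent, Option.elim_some, Pi.single_apply]
    split_ifs with h
    · exact h ▸ Nat.one_le_iff_ne_zero.2 he
    · exact Nat.zero_le _

variable (S : Set (Finset O × (E → ℕ))) {K J : Type*} (k : K → Option E) (j : J → O)

/-- Restriction of exponents to the even variables selected by `k`. -/
def restrictExponents : (E → ℕ) × ℕ →+ (K → ℤ) :=
  (LinearMap.funLeft ℤ ℤ k).toAddMonoidHom.comp exponents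

/-- The homomorphism from a monomial superalgebra to the Laurent polynomials in the selected even
and odd variables: the other odd variables are mapped to `0`, the other even ones to `1`. -/
def monomialHom : SuperHom (MonomialSuperalgebra S) (SuperPoly (K → ℤ) J) where
  toAlgHom := (mapVars (restrictExponents k) (LinearMap.funLeft ℂ ℂ j)).comp
    (Algebra.adjoin ℂ (generators S)).val
  map_part _ _ ha := mapVars_mem (restrictExponents k) (LinearMap.funLeft ℂ ℂ j) ha

variable {S}

/-- The generator `ξ^I x^m v` of a monomial superalgebra, for `s = (I, m)`. -/
def gen {s : Finset O × (E → ℕ)} (hs : s ∈ S) : MonomialSuperalgebra S :=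
  ⟨monomial s.1 s.2, Algebra.subset_adjoin ⟨s, hs, rfl⟩⟩

@[elab_as_elim]
theorem MonomialSuperalgebra.induction {P : MonomialSuperalgebra S → Prop}
    (gen : ∀ (s : Finset O × (E → ℕ)) (hs : s ∈ S), P (gen hs))
    (algebraMap : ∀ r : ℂ, P (algebraMap ℂ _ r)) (add : ∀ a b, P a → P b → P (a + b))
    (mul : ∀ a b, P a → P b → P (a * b)) (a : MonomialSuperalgebra S) : P a := by
  obtain ⟨x, hx⟩ := a
  induction hx using Algebra.adjoin_induction with
  | mem x hx =>
    obtain ⟨s, hs, rfl⟩ := hx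
    exact gen s hs
  | algebraMap r => exact algebraMap r
  | add x y hx' hy' hx hy => exact add ⟨x, hx'⟩ ⟨y, hy'⟩ hx hy
  | mul x y hx' hy' hx hy => exact mul ⟨x, hx'⟩ ⟨y, hy'⟩ hx hy

theorem monomialHom_gen {s : Finset O × (E → ℕ)} (hs : s ∈ S) :
    (monomialHom S k j).toAlgHom (gen hs) = single (exponents (s.2, 1) ∘ k)
      (ExteriorAlgebra.map (LinearMap.funLeft ℂ ℂ j) (s.1.toList.map xi).prod) :=
  mapVars_single _ _ _ _

variable {k j}

theorem baseExponent_mem_of_isLowerSet (hS : IsLowerSet S) {s : Finset O × (E → ℕ)} (hs : s ∈ S)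
    {x : Option E} (hx : exponents (s.2, 1) x ≠ 0) : (∅, baseExponent x) ∈ S :=
  hS (show (∅, baseExponent x) ≤ s from ⟨Finset.empty_subset _, baseExponent_le hx⟩) hs

theorem singleton_mem_of_isLowerSet (hS : IsLowerSet S) {s : Finset O × (E → ℕ)} (hs : s ∈ S)
    {o : O} (ho : o ∈ s.1) : ({o}, 0) ∈ S :=
  hS (show ({o}, 0) ≤ s from ⟨Finset.singleton_subset_iff.2 ho, fun _ => Nat.zero_le _⟩) hs

/-- `monomialHom` loses nothing, since only the selected variables occur in the generators. -/
theorem mapVars_extend_monomialHom (hS : IsLowerSet S) (hk : Function.Injective k)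
    (hj : Function.Injective j) (hkS : ∀ x, (∅, baseExponent x) ∈ S → x ∈ Set.range k)
    (hjS : ∀ o, ({o}, 0) ∈ S → o ∈ Set.range j) (a : MonomialSuperalgebra S) :
    mapVars (Function.ExtendByZero.linearMap ℤ k).toAddMonoidHom
      (Function.ExtendByZero.linearMap ℂ j) ((monomialHom S k j).toAlgHom a) =
        mapDomainAlgHom ℂ _ exponents a.1 := by
  suffices h : ((mapVars (Function.ExtendByZero.linearMap ℤ k).toAddMonoidHom
      (Function.ExtendByZero.linearMap ℂ j)).comp (monomialHom S k j).toAlgHom) =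
        (mapDomainAlgHom ℂ _ exponents).comp (Algebra.adjoin ℂ (generators S)).val from
    DFunLike.congr_fun h a
  refine AlgHom.adjoin_ext ?_
  rintro _ ⟨s, hs, rfl⟩
  change mapVars _ _ ((monomialHom S k j).toAlgHom (gen hs)) =
    mapDomainAlgHom ℂ _ exponents (monomial s.1 s.2)
  rw [monomialHom_gen, mapVars_single, monomial, mapDomainAlgHom_apply, mapDomain_single,
    map_extend_map_funLeft_prod_xi hj fun o ho =>
      hjS o (singleton_mem_of_isLowerSet hS hs (Finset.mem_toList.1 ho))]
  exact congrArg (single · _) (extend_comp_of_support_subset hk fun x hx =>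
    hkS x (baseExponent_mem_of_isLowerSet hS hs hx))

theorem monomialHom_injective (hS : IsLowerSet S) (hk : Function.Injective k)
    (hj : Function.Injective j) (hkS : ∀ x, (∅, baseExponent x) ∈ S → x ∈ Set.range k)
    (hjS : ∀ o, ({o}, 0) ∈ S → o ∈ Set.range j) :
    Function.Injective (monomialHom S k j).toAlgHom := by
  intro a b hab
  refine Subtype.ext (mapDomain_injective exponents_injective ?_)
  have h := mapVars_extend_monomialHom hS hk hj hkS hjS
  exact (h a).symm.trans ((congrArg _ hab).trans (h b))

theorem mem_span_monomialHom_eq_single (a : MonomialSuperalgebra S) : a ∈ Submodule.span ℂ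
    {a : MonomialSuperalgebra S | ∃ m c, (monomialHom S k j).toAlgHom a = single m c} := by
  induction a using MonomialSuperalgebra.induction with
  | gen s hs => exact Submodule.subset_span ⟨_, _, monomialHom_gen k j hs⟩
  | algebraMap r => exact Submodule.subset_span ⟨0, algebraMap ℂ _ r, AlgHom.commutes _ r⟩
  | add a b ha hb => exact add_mem ha hb
  | mul a b ha hb =>
    have h := Submodule.mul_mem_mul ha hb
    rw [Submodule.span_mul_span] at h
    refine Submodule.span_mono ?_ h
    rintro _ ⟨x, ⟨m, c, hx⟩, y, ⟨n, d, hy⟩, rfl⟩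
    exact ⟨m + n, c * d, by simp only [map_mul, hx, hy, single_mul_single]⟩

theorem oddDeriv_mul_mem_range {A M ι : Type*} [Ring A] [Algebra ℂ A] [SuperCommAlgebra A]
    [AddCommMonoid M] (φ : SuperHom A (SuperPoly M ι)) (i : ι) {a b : A}
    (ha : oddDeriv M i (φ.toAlgHom a) ∈ LinearMap.range φ.toAlgHom.toLinearMap)
    (hb : oddDeriv M i (φ.toAlgHom b) ∈ LinearMap.range φ.toAlgHom.toLinearMap) :
    oddDeriv M i (φ.toAlgHom (a * b)) ∈ LinearMap.range φ.toAlgHom.toLinearMap := by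
  obtain ⟨a₀, a₁, h₁, rfl⟩ := exists_eq_even_add_odd a
  obtain ⟨a', ha⟩ := ha
  obtain ⟨b', hb⟩ := hb
  rw [AlgHom.toLinearMap_apply] at ha hb
  have h_even := oddDeriv_mul i (f := φ.toAlgHom a₀) (φ.map_part 0 _ a₀.2) (φ.toAlgHom b)
  have h_odd := oddDeriv_mul i (f := φ.toAlgHom a₁) (φ.map_part 1 _ h₁) (φ.toAlgHom b)
  rw [ZMod.val_zero, pow_zero, one_smul] at h_even
  rw [ZMod.val_one, pow_one, neg_one_smul] at h_odd
  refine ⟨a' * b + (a₀ - a₁) * b', ?_⟩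
  calc
    φ.toAlgHom (a' * b + (a₀ - a₁) * b') = oddDeriv M i (φ.toAlgHom (a₀ + a₁)) * φ.toAlgHom b +
        (φ.toAlgHom a₀ - φ.toAlgHom a₁) * oddDeriv M i (φ.toAlgHom b) := by
      rw [map_add, map_mul, map_mul, map_sub, ha, hb]
    _ = oddDeriv M i (φ.toAlgHom a₀ * φ.toAlgHom b + φ.toAlgHom a₁ * φ.toAlgHom b) := by
      rw [map_add φ.toAlgHom, map_add (oddDeriv M i), map_add (oddDeriv M i), h_even, h_odd,
        add_mul, sub_mul]
      abel
    _ = oddDeriv M i (φ.toAlgHom ((a₀ + a₁) * b)) := by rw [map_mul, map_add φ.toAlgHom, add_mul]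

theorem oddDeriv_monomialHom_gen_mem_range (hS : IsLowerSet S) (i : J)
    {s : Finset O × (E → ℕ)} (hs : s ∈ S) :
    oddDeriv _ i ((monomialHom S k j).toAlgHom (gen hs)) ∈
      LinearMap.range (monomialHom S k j).toAlgHom.toLinearMap := by
  classical
  rw [monomialHom_gen, oddDeriv_single]
  suffices h : Submodule.span ℂ {c | ∃ l : List O, l.Sublist s.1.toList ∧
      c = ExteriorAlgebra.map (LinearMap.funLeft ℂ ℂ j) (l.map xi).prod} ≤
        (LinearMap.range (monomialHom S k j).toAlgHom.toLinearMap).comap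
          (lsingle (exponents (s.2, 1) ∘ k)) from
    h (neg_mem (contractLeft_map_prod_xi_mem_span _ _ _))
  refine Submodule.span_le.2 ?_
  rintro _ ⟨l, hl, rfl⟩
  have hsub : l.toFinset ⊆ s.1 := fun o ho =>
    Finset.mem_toList.1 (hl.subset (List.mem_toFinset.1 ho))
  have hls : (l.toFinset, s.2) ∈ S := hS (show (l.toFinset, s.2) ≤ s from ⟨hsub, le_rfl⟩) hs
  obtain ⟨ε, hε⟩ := exists_prod_xi_eq_smul_of_perm
    (List.toFinset_toList (hl.nodup s.1.nodup_toList)).symm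
  refine ⟨ε • gen hls, ?_⟩
  rw [map_smul, AlgHom.toLinearMap_apply, monomialHom_gen, hε, map_smul, lsingle_apply, smul_single]

theorem oddDeriv_monomialHom_mem_range (hS : IsLowerSet S) (i : J) (a : MonomialSuperalgebra S) :
    oddDeriv _ i ((monomialHom S k j).toAlgHom a) ∈
      LinearMap.range (monomialHom S k j).toAlgHom.toLinearMap := by
  induction a using MonomialSuperalgebra.induction with
  | gen s hs => exact oddDeriv_monomialHom_gen_mem_range hS i hs
  | algebraMap r => rw [AlgHom.commutes, oddDeriv_algebraMap]; exact zero_mem _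
  | add a b ha hb => rw [map_add, map_add]; exact add_mem ha hb
  | mul a b ha hb => exact oddDeriv_mul_mem_range _ i ha hb

end MonomialHom

section Fractions

variable {A B : Type*} [Ring A] [Algebra ℂ A] [SuperCommAlgebra A]
  [Ring B] [Algebra ℂ B] [SuperCommAlgebra B]

/-- The subalgebra of `B` of all elements of the form `a / f ^ n` with `a` in `A`. -/
def fractionSubalgebra (φ : SuperHom A B) (f : evenSub A) : Subalgebra ℂ B where
  carrier := {b | ∃ (n : ℕ) (a : A), φ.toAlgHom a = φ.even f ^ n • b}
  mul_mem' := by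
    rintro b b' ⟨n, a, h⟩ ⟨n', a', h'⟩
    exact ⟨n + n', a * a', by rw [map_mul, h, h', pow_add, smul_mul_smul_comm]⟩
  add_mem' := by
    rintro b b' ⟨n, a, h⟩ ⟨n', a', h'⟩
    refine ⟨n + n', f ^ n' • a + f ^ n • a', ?_⟩
    rw [map_add, φ.map_even_smul, φ.map_even_smul, h, h', smul_smul, smul_smul, map_pow, map_pow,
      ← pow_add, ← pow_add, add_comm n', smul_add]
  algebraMap_mem' r := ⟨0, algebraMap ℂ A r, by rw [AlgHom.commutes, pow_zero, one_smul]⟩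

theorem map_mem_fractionSubalgebra (φ : SuperHom A B) (f : evenSub A) (a : A) :
    φ.toAlgHom a ∈ fractionSubalgebra φ f :=
  ⟨0, a, by rw [pow_zero, one_smul]⟩

theorem mem_fractionSubalgebra_of_smul {φ : SuperHom A B} {f : evenSub A} {a : A} {b : B}
    (h : φ.toAlgHom a = φ.even f • b) : b ∈ fractionSubalgebra φ f :=
  ⟨1, a, by rw [pow_one, h]⟩

end Fractions

section LaurentSubalgebra

open AddMonoidAlgebra

theorem single_one_mul_single_neg {M ι : Type*} [AddCommGroup M] (m : M) :
    (single m 1 : SuperPoly M ι) * single (-m) 1 = 1 := by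
  rw [single_mul_single, add_neg_cancel, one_mul, one_def]

/-- The exponents `m` for which both monomials `t^m` and `t^(-m)` belong to `D`. -/
def unitExponents {M ι : Type*} [AddCommGroup M] (D : Subalgebra ℂ (SuperPoly M ι)) :
    AddSubgroup M where
  carrier := {m | single m 1 ∈ D ∧ single (-m) 1 ∈ D}
  zero_mem' := ⟨D.one_mem, by rw [neg_zero]; exact D.one_mem⟩
  add_mem' := by
    rintro m n ⟨hm, hm'⟩ ⟨hn, hn'⟩
    constructor
    · have h := D.mul_mem hm hn
      rwa [single_mul_single, one_mul] at h
    · have h := D.mul_mem hm' hn'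
      rwa [single_mul_single, one_mul, ← neg_add] at h
  neg_mem' := fun ⟨h, h'⟩ => ⟨h', by rwa [neg_neg]⟩

theorem addSubgroup_eq_top_of_single_mem {K : Type*} [Finite K] [DecidableEq K]
    {H : AddSubgroup (K → ℤ)} (hH : ∀ i, Pi.single i 1 ∈ H) : H = ⊤ := by
  have := Fintype.ofFinite K
  refine H.eq_top_iff'.2 fun v => ?_
  rw [pi_eq_sum_univ' v]
  exact H.sum_mem fun i _ => H.zsmul_mem (hH i) _

theorem single_zero_mem_of_xi_mem {M ι : Type} [Finite ι] [AddCommMonoid M]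
    {D : Subalgebra ℂ (SuperPoly M ι)} (hι : ∀ i, single 0 (xi i) ∈ D)
    (x : ExteriorAlgebra ℂ (ι → ℂ)) : single 0 x ∈ D := by
  have := Fintype.ofFinite ι
  induction x using ExteriorAlgebra.induction with
  | algebraMap r => exact D.algebraMap_mem r
  | ι v =>
    rw [ι_eq_sum_smul_xi, ← lsingle_apply (R := ℂ), map_sum]
    refine D.sum_mem fun i _ => ?_
    rw [map_smul]
    exact D.smul_mem (hι i) _
  | mul x y hx hy =>
    have h := D.mul_mem hx hy
    rwa [single_mul_single, add_zero] at h
  | add x y hx hy => rw [single_add]; exact D.add_mem hx hy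

theorem laurent_subalgebra_eq_top {K ι : Type} [Finite K] [DecidableEq K] [Finite ι]
    {D : Subalgebra ℂ (SuperPoly (K → ℤ) ι)} (hK : ∀ i, Pi.single i 1 ∈ unitExponents D)
    (hι : ∀ i, single 0 (xi i) ∈ D) : D = ⊤ := by
  refine eq_top_iff.2 fun b _ => ?_
  induction b using AddMonoidAlgebra.induction_linear with
  | zero => exact D.zero_mem
  | add f g hf hg => exact D.add_mem (hf trivial) (hg trivial)
  | single v x =>
    have hv : v ∈ unitExponents D := addSubgroup_eq_top_of_single_mem hK ▸ AddSubgroup.mem_top v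
    have h := D.mul_mem hv.1 (single_zero_mem_of_xi_mem hι x)
    rwa [single_mul_single, one_mul, add_zero] at h

end LaurentSubalgebra

section Denominator

open AddMonoidAlgebra

variable {E O : Type} {S : Set (Finset O × (E → ℕ))} {K J : Type} {k : K → Option E} {j : J → O}

theorem single_one_mem_even {M ι : Type*} [AddCommMonoid M] (m : M) :
    single m 1 ∈ part (SuperPoly M ι) 0 :=
  single_mem_polyPart (Submodule.one_le.1 (CliffordAlgebra.one_le_evenOdd_zero _)) m

theorem gen_empty_mem {m : E → ℕ} (hm : (∅, m) ∈ S) :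
    gen hm ∈ part (MonomialSuperalgebra S) 0 := by
  change monomial ∅ m ∈ part (SuperPoly _ _) 0
  rw [monomial, Finset.toList_empty, List.map_nil, List.prod_nil]
  exact single_one_mem_even _

theorem monomialHom_gen_empty {m : E → ℕ} (hm : (∅, m) ∈ S) :
    (monomialHom S k j).toAlgHom (gen hm) = single (exponents (m, 1) ∘ k) 1 := by
  rw [monomialHom_gen, Finset.toList_empty, List.map_nil, List.prod_nil, map_one]

theorem monomialHom_gen_singleton (hj : Function.Injective j) {i : J} (hi : ({j i}, 0) ∈ S) :
    (monomialHom S k j).toAlgHom (gen hi) = single (exponents (0, 1) ∘ k) (xi i) := by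
  classical
  rw [monomialHom_gen, Finset.toList_singleton, List.map_singleton, List.prod_singleton, xi_eq,
    xi_eq, ExteriorAlgebra.map_apply_ι]
  congr 2
  funext i'
  simp only [LinearMap.funLeft_apply, Pi.single_apply, hj.eq_iff]

theorem exponents_zero_comp [DecidableEq K] (hk : Function.Injective k) {i : K}
    (hi : k i = none) : exponents (0, 1) ∘ k = Pi.single i 1 := by
  funext i'
  obtain rfl | h := eq_or_ne i' i
  · simp [exponents, hi]
  · obtain ⟨e, he⟩ := Option.ne_none_iff_exists'.1 fun h' => h (hk (h'.trans hi.symm))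
    simp [exponents, he, h]

theorem exponents_baseExponent_comp [DecidableEq K] (hk : Function.Injective k) {i : K} {e : E}
    (hi : k i = some e) :
    exponents (baseExponent (k i), 1) ∘ k = Pi.single i 1 + exponents (0, 1) ∘ k := by
  classical
  funext i'
  obtain rfl | h := eq_or_ne i' i
  · simp [exponents, hi, baseExponent]
  · cases hi' : k i' with
    | none => simp [exponents, hi', h]
    | some e' =>
      have hne : e' ≠ e := fun he => h (hk (by rw [hi', hi, he]))
      simp [exponents, hi, hi', baseExponent, h, hne]

/-- The element that is inverted to get to the torus: the product of the generators `x^m v` that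
introduce the even variables selected by `k`. -/
def denominator [Fintype K] (hk : ∀ i, (∅, baseExponent (k i)) ∈ S) :
    evenSub (MonomialSuperalgebra S) :=
  ∏ i, ⟨gen (hk i), gen_empty_mem (hk i)⟩

variable [Fintype K]

theorem isUnit_even_denominator (hk : ∀ i, (∅, baseExponent (k i)) ∈ S) :
    IsUnit ((monomialHom S k j).even (denominator hk)) := by
  rw [denominator, map_prod]
  refine IsUnit.prod_iff.2 fun i _ => IsUnit.of_mul_eq_one ⟨_, single_one_mem_even
    (-(exponents (baseExponent (k i), 1) ∘ k))⟩ (Subtype.ext ?_)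
  change (monomialHom S k j).toAlgHom (gen (hk i)) * single _ 1 = 1
  rw [monomialHom_gen_empty, single_one_mul_single_neg]

theorem exponents_baseExponent_mem_unitExponents (hk : ∀ i, (∅, baseExponent (k i)) ∈ S) (i : K) :
    exponents (baseExponent (k i), 1) ∘ k ∈
      unitExponents (fractionSubalgebra (monomialHom S k j) (denominator hk)) := by
  classical
  have hgen := monomialHom_gen_empty (k := k) (j := j) (hk i)
  refine ⟨hgen ▸ map_mem_fractionSubalgebra _ _ _, ?_⟩
  let others : evenSub (MonomialSuperalgebra S) :=
    ∏ i' ∈ Finset.univ.erase i, ⟨gen (hk i'), gen_empty_mem (hk i')⟩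
  have hprod : denominator hk = others * ⟨gen (hk i), gen_empty_mem (hk i)⟩ :=
    (Finset.prod_erase_mul _ _ (Finset.mem_univ i)).symm
  refine mem_fractionSubalgebra_of_smul (a := (others : MonomialSuperalgebra S)) ?_
  rw [hprod]
  change _ = (monomialHom S k j).toAlgHom (_ * gen (hk i)) * _
  rw [map_mul, hgen, mul_assoc, single_one_mul_single_neg, mul_one]

theorem fractionSubalgebra_denominator_eq_top [Finite J] (hS : IsLowerSet S)
    (hk : Function.Injective k) (hj : Function.Injective j)
    (hkS : ∀ x, x ∈ Set.range k ↔ (∅, baseExponent x) ∈ S)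
    (hjS : ∀ i, ({j i}, 0) ∈ S) :
    fractionSubalgebra (monomialHom S k j) (denominator fun i => (hkS _).1 ⟨i, rfl⟩) = ⊤ := by
  classical
  set D := fractionSubalgebra (monomialHom S k j) (denominator fun i => (hkS _).1 ⟨i, rfl⟩)
  have hv {s} (hs : s ∈ S) : exponents (0, 1) ∘ k ∈ unitExponents D := by
    have h₀ : (∅, baseExponent none) ∈ S :=
      hS (show (∅, baseExponent none) ≤ s from ⟨Finset.empty_subset _, fun _ => Nat.zero_le _⟩) hs
    obtain ⟨i, hi⟩ := (hkS none).2 h₀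
    have h := exponents_baseExponent_mem_unitExponents (j := j) (fun i => (hkS (k i)).1 ⟨i, rfl⟩) i
    rwa [hi] at h
  refine laurent_subalgebra_eq_top (fun i => ?_) fun i => ?_
  · have hi := (hkS (k i)).1 ⟨i, rfl⟩
    cases h : k i with
    | none => exact exponents_zero_comp hk h ▸ hv hi
    | some e =>
      have hmem := (unitExponents D).sub_mem
        (exponents_baseExponent_mem_unitExponents (j := j) _ i) (hv hi)
      rwa [exponents_baseExponent_comp hk h, add_sub_cancel_right] at hmem
  · have h := D.mul_mem (map_mem_fractionSubalgebra _ _ (gen (hjS i))) (hv (hjS i)).2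
    rwa [monomialHom_gen_singleton hj, single_mul_single, add_neg_cancel, mul_one] at h

theorem isPrincipalLocalization_monomialHom [Finite J] (hS : IsLowerSet S)
    (hk : Function.Injective k) (hj : Function.Injective j)
    (hkS : ∀ x, x ∈ Set.range k ↔ (∅, baseExponent x) ∈ S)
    (hjS : ∀ o, o ∈ Set.range j ↔ ({o}, 0) ∈ S) :
    IsPrincipalLocalization (monomialHom S k j) (denominator fun i => (hkS _).1 ⟨i, rfl⟩) where
  injective := monomialHom_injective hS hk hj (fun x => (hkS x).2) fun o => (hjS o).2
  isUnit := isUnit_even_denominator _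
  exists_map_eq_pow_smul b := by
    have hb : b ∈ (⊤ : Subalgebra ℂ _) := trivial
    rwa [← fractionSubalgebra_denominator_eq_top hS hk hj hkS fun i => (hjS _).1 ⟨i, rfl⟩] at hb

theorem finiteType_monomialSuperalgebra (hfin : S.Finite) :
    Algebra.FiniteType ℂ (MonomialSuperalgebra S) := by
  rw [← Subalgebra.fg_iff_finiteType, Subalgebra.fg_def]
  have hgen : generators S = (fun s => monomial s.1 s.2) '' S :=
    Set.ext fun f => exists_congr fun s => and_congr_right fun _ => eq_comm
  exact ⟨_, hgen ▸ hfin.image _, rfl⟩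

end Denominator

theorem baseExponent_injective {E : Type} : Function.Injective (baseExponent (E := E)) := by
  classical
  rintro (_ | e) (_ | e') h
  · rfl
  · simpa [baseExponent] using congrFun h e'
  · simpa [baseExponent] using congrFun h e
  · have he : e = e' := by simpa [baseExponent, Pi.single_apply] using congrFun h e
    rw [he]

/-! ### Lattice points of the polytope -/

section DyckPaths

theorem exists_isChain_of_reflTransGen {α : Type*} {r : α → α → Prop} {a x b : α}
    (hax : Relation.ReflTransGen r a x) (hxb : Relation.ReflTransGen r x b) :
    ∃ l : List α, l.IsChain r ∧ l.head? = some a ∧ l.getLast? = some b ∧ x ∈ l := by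
  obtain ⟨l, hne, hl, rfl, hx⟩ := List.exists_isChain_ne_nil_of_relationReflTransGen hax
  obtain ⟨l', hl', rfl⟩ := List.exists_isChain_cons_of_relationReflTransGen hxb
  have hlx : l.dropLast ++ [x] = l := hx ▸ List.dropLast_append_getLast hne
  refine ⟨l ++ l', ?_, ?_, ?_, List.mem_append_left _ (hx ▸ List.getLast_mem hne)⟩
  · rw [← hlx] at hl ⊢
    exact hl.append_overlap hl' (List.cons_ne_nil x [])
  · rw [List.head?_append_of_ne_nil _ hne, List.head?_eq_some_head hne]
  · rw [← hlx, List.append_assoc, List.singleton_append, List.getLast?_append_of_ne_nil _ (by simp),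
      List.getLast?_eq_some_getLast (List.cons_ne_nil x l')]

variable {P : ℕ × ℕ → Prop}

theorem reflTransGen_dyckStep_of_fst_eq {i a b : ℕ} (hab : a ≤ b)
    (hP : ∀ k, a ≤ k → k ≤ b → P (i, k)) :
    Relation.ReflTransGen (fun x y : Subtype P => DyckStep x.1 y.1)
      ⟨(i, a), hP a le_rfl hab⟩ ⟨(i, b), hP b hab le_rfl⟩ := by
  induction b, hab using Nat.le_induction with
  | base => exact .refl
  | succ b hab ih => exact (ih fun k hak hkb => hP k hak (hkb.trans b.le_succ)).tail (Or.inl rfl)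

theorem reflTransGen_dyckStep_of_snd_eq {j a b : ℕ} (hab : a ≤ b)
    (hP : ∀ k, a ≤ k → k ≤ b → P (k, j)) :
    Relation.ReflTransGen (fun x y : Subtype P => DyckStep x.1 y.1)
      ⟨(a, j), hP a le_rfl hab⟩ ⟨(b, j), hP b hab le_rfl⟩ := by
  induction b, hab using Nat.le_induction with
  | base => exact .refl
  | succ b hab ih => exact (ih fun k hak hkb => hP k hak (hkb.trans b.le_succ)).tail (Or.inr rfl)

theorem le_sum_map_of_mem {α : Type*} {s : α → ℝ} (hs : ∀ x, 0 ≤ s x) {l : List α} {x : α}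
    (hx : x ∈ l) : s x ≤ (l.map s).sum :=
  List.single_le_sum (List.forall_mem_map.2 fun y _ => hs y) _ (List.mem_map_of_mem hx)

theorem DyckA.le {r : ℕ} {m : ℕ → ℝ} {s : ARoot r → ℝ} (h : DyckA m s) (hs : ∀ x, 0 ≤ s x)
    (x : ARoot r) : s x ≤ ∑ k ∈ Finset.Icc x.1.1 x.1.2, m k := by
  obtain ⟨⟨i, j⟩, hij, hj⟩ := x
  obtain ⟨l, hl, ha, hb, hxl⟩ := exists_isChain_of_reflTransGen
    (reflTransGen_dyckStep_of_fst_eq (P := fun x => x.1 ≤ x.2 ∧ x.2 < r) hij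
      fun k hik hkj => ⟨hik, hkj.trans_lt hj⟩)
    (reflTransGen_dyckStep_of_snd_eq (P := fun x => x.1 ≤ x.2 ∧ x.2 < r) hij
      fun k _ hkj => ⟨hkj, hj⟩)
  exact (le_sum_map_of_mem hs hxl).trans (h l _ _ hl ha hb rfl rfl)

theorem DyckC.le {n : ℕ} {m : ℕ → ℝ} {s : CRoot n → ℝ} {t : ℕ → ℝ} (h : DyckC m s t)
    (hs : ∀ x, 0 ≤ s x) (ht : ∀ j, 0 ≤ t j) (x : CRoot n) :
    s x ≤ ∑ k ∈ Finset.Icc x.1.1 (n - 1), m k := by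
  obtain ⟨⟨i, j⟩, hij, hj⟩ := x
  dsimp only at hij hj
  obtain ⟨l, hl, ha, hb, hxl⟩ := exists_isChain_of_reflTransGen
    (reflTransGen_dyckStep_of_fst_eq (P := fun x => x.1 ≤ x.2 ∧ x.1 + x.2 + 2 ≤ 2 * n) hij
      fun k hik hkj => ⟨hik, by dsimp only; omega⟩)
    (reflTransGen_dyckStep_of_fst_eq (P := fun x => x.1 ≤ x.2 ∧ x.1 + x.2 + 2 ≤ 2 * n)
      (b := 2 * n - 2 - i) (by omega) fun k hjk hkb => ⟨hij.trans hjk, by dsimp only; omega⟩)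
  calc
    s _ ≤ (l.map s).sum := le_sum_map_of_mem hs hxl
    _ ≤ (l.map s).sum + t i := le_add_of_nonneg_right (ht i)
    _ ≤ ∑ k ∈ Finset.Icc i (n - 1), m k := (h l _ _ hl ha hb rfl).2 (by dsimp only; omega)

theorem DyckA.anti {r : ℕ} {m : ℕ → ℝ} {s s' : ARoot r → ℝ} (h : DyckA m s) (hs : s' ≤ s) :
    DyckA m s' := fun l a b hl ha hb h₁ h₂ =>
  (List.sum_le_sum fun x _ => hs x).trans (h l a b hl ha hb h₁ h₂)

theorem DyckC.anti {n : ℕ} {m : ℕ → ℝ} {s s' : CRoot n → ℝ} {t t' : ℕ → ℝ} (h : DyckC m s t)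
    (hs : s' ≤ s) (ht : t' ≤ t) : DyckC m s' t' := fun l a b hl ha hb h₁ =>
  ⟨fun h₂ => (List.sum_le_sum fun x _ => hs x).trans ((h l a b hl ha hb h₁).1 h₂),
    fun h₂ => (add_le_add (List.sum_le_sum fun x _ => hs x) (ht _)).trans
      ((h l a b hl ha hb h₁).2 h₂)⟩

end DyckPaths

section ExceptionalPolytopes

theorem IneqB3.anti {m₁ m₂ m₃ : ℝ} {s s' : B3Root → ℝ} (h : IneqB3 m₁ m₂ m₃ s) (hs : s' ≤ s) :
    IneqB3 m₁ m₂ m₃ s' := by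
  simp only [IneqB3] at h ⊢
  casesm* _ ∧ _
  refine ⟨?_, ?_, ?_, ?_, ?_, ?_, ?_, ?_, ?_, ?_, ?_, ?_, ?_, ?_, ?_, ?_, ?_, ?_, ?_, ?_⟩ <;>
    linarith [hs .r11, hs .r12, hs .r13, hs .r22, hs .r23, hs .r33, hs .u23, hs .u13, hs .u12]

theorem IneqB3.le {m₁ m₂ m₃ : ℝ} {s : B3Root → ℝ} (h : IneqB3 m₁ m₂ m₃ s) (hs : ∀ r, 0 ≤ s r)
    (r : B3Root) : s r ≤ m₁ + 3 * m₂ + 2 * m₃ := by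
  obtain ⟨-, -, -, -, -, -, -, -, -, -, -, -, -, -, -, -, -, -, hle, hle'⟩ := h
  cases r <;>
    linarith [hs .r11, hs .r12, hs .r13, hs .r22, hs .r23, hs .r33, hs .u23, hs .u13, hs .u12]

theorem IneqG2.anti {m₁ m₂ : ℝ} {s s' : G2Root → ℝ} (h : IneqG2 m₁ m₂ s) (hs : s' ≤ s) :
    IneqG2 m₁ m₂ s' := by
  simp only [IneqG2] at h ⊢
  casesm* _ ∧ _
  refine ⟨?_, ?_, ?_, ?_, ?_, ?_, ?_⟩ <;>
    linarith [hs .r10, hs .r01, hs .r11, hs .r21, hs .r31, hs .r32]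

theorem IneqG2.le {m₁ m₂ : ℝ} {s : G2Root → ℝ} (h : IneqG2 m₁ m₂ s) (hs : ∀ r, 0 ≤ s r)
    (r : G2Root) : s r ≤ m₁ + 2 * m₂ := by
  obtain ⟨-, -, -, -, -, hle, hle'⟩ := h
  cases r <;> linarith [hs .r10, hs .r01, hs .r11, hs .r21, hs .r31, hs .r32]

end ExceptionalPolytopes

section LatticePoints

instance ARoot.finite (r : ℕ) : Finite (ARoot r) :=
  ((Set.finite_Iic (r, r)).subset fun _ hx => ⟨hx.1.trans hx.2.le, hx.2.le⟩ :
    {x : ℕ × ℕ | x.1 ≤ x.2 ∧ x.2 < r}.Finite)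

instance CRoot.finite (n : ℕ) : Finite (CRoot n) :=
  ((Set.finite_Iic (2 * n, 2 * n)).subset fun x hx => by
      obtain ⟨-, hx⟩ := hx
      exact ⟨by omega, by omega⟩ : {x : ℕ × ℕ | x.1 ≤ x.2 ∧ x.1 + x.2 + 2 ≤ 2 * n}.Finite)

instance B3Root.finite : Finite B3Root :=
  Finite.of_surjective (fun i : Fin 9 =>
    ![B3Root.r11, .r12, .r13, .r22, .r23, .r33, .u23, .u13, .u12] i) fun r => by
      cases r
      exacts [⟨0, rfl⟩, ⟨1, rfl⟩, ⟨2, rfl⟩, ⟨3, rfl⟩, ⟨4, rfl⟩, ⟨5, rfl⟩, ⟨6, rfl⟩, ⟨7, rfl⟩,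
        ⟨8, rfl⟩]

instance G2Root.finite : Finite G2Root :=
  Finite.of_surjective (fun i : Fin 6 => ![G2Root.r10, .r01, .r11, .r21, .r31, .r32] i) fun r => by
    cases r
    exacts [⟨0, rfl⟩, ⟨1, rfl⟩, ⟨2, rfl⟩, ⟨3, rfl⟩, ⟨4, rfl⟩, ⟨5, rfl⟩]

theorem dite_fin_le_dite_fin {n : ℕ} {y y' : Fin n → ℝ} (h : y' ≤ y) (j : ℕ) :
    (if hj : j < n then y' ⟨j, hj⟩ else 0) ≤ if hj : j < n then y ⟨j, hj⟩ else 0 := by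
  split_ifs with hj
  exacts [h _, le_rfl]

theorem dite_fin_nonneg {n : ℕ} {y : Fin n → ℝ} (h : 0 ≤ y) (j : ℕ) :
    0 ≤ if hj : j < n then y ⟨j, hj⟩ else 0 := by
  split_ifs with hj
  exacts [h _, le_rfl]

namespace KFType

instance finite_evenRoot : (τ : KFType) → Finite τ.EvenRoot
  | A m n => inferInstanceAs (Finite (ARoot (m - 1) ⊕ ARoot (n - 1)))
  | C n => inferInstanceAs (Finite (CRoot n))
  | B n => inferInstanceAs (Finite (CRoot n))
  | D21 _ => inferInstanceAs (Finite (Fin 3))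
  | F4 => inferInstanceAs (Finite (Option B3Root))
  | G3 => inferInstanceAs (Finite (Option G2Root))

instance finite_oddRoot : (τ : KFType) → Finite τ.OddRoot
  | A m n => inferInstanceAs (Finite (Fin m × Fin n))
  | C n => inferInstanceAs (Finite (Fin n × Bool))
  | B n => inferInstanceAs (Finite (Fin n))
  | D21 _ => inferInstanceAs (Finite (Bool × Bool))
  | F4 => inferInstanceAs (Finite (Bool × Bool × Bool))
  | G3 => inferInstanceAs (Finite (Option (Fin 3 × Bool)))

theorem WeightIneq.anti : {τ : KFType} → {a : Fin τ.rank → ℂ} → {x x' : τ.EvenRoot → ℝ} →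
    {y y' : τ.OddRoot → ℝ} → τ.WeightIneq a x y → x' ≤ x → y' ≤ y → τ.WeightIneq a x' y'
  | A _ _, _, _, _, _, _, h, hx, _ =>
    ⟨h.1.anti fun r => hx (Sum.inl r), h.2.anti fun r => hx (Sum.inr r)⟩
  | C _, _, _, _, _, _, h, hx, _ => DyckC.anti h hx le_rfl
  | B n, a, x, _, y, _, h, hx, hy =>
    DyckC.anti (n := n) (m := fun k => if k + 1 = n then lab a k / 2 else lab a k) (s := x)
      (t := fun j => if hj : j < n then y (⟨j, hj⟩ : Fin n) else 0) h hx (dite_fin_le_dite_fin hy)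
  | D21 _, _, _, _, _, _, h, hx, hy =>
    ⟨(hx (1 : Fin 3)).trans h.1, (hx (2 : Fin 3)).trans h.2.1,
      (add_le_add (hx (0 : Fin 3)) (Finset.sum_le_sum fun o _ => hy o)).trans h.2.2⟩
  | F4, _, _, _, _, _, h, hx, hy =>
    ⟨h.1.anti fun r => hx (some r),
      (add_le_add (hx (none : Option B3Root)) (Finset.sum_le_sum fun o _ => hy o)).trans h.2⟩
  | G3, _, _, _, _, _, h, hx, hy =>
    ⟨h.1.anti fun r => hx (some r),
      (add_le_add (hx (none : Option G2Root)) (Finset.sum_le_sum fun o _ => hy o)).trans h.2⟩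

/-- An upper bound for the coordinates at the even roots of the points of the polytope. -/
def evenBound : (τ : KFType) → (Fin τ.rank → ℂ) → τ.EvenRoot → ℝ
  | A m n, a => Sum.elim
      (fun r : ARoot (m - 1) => ∑ k ∈ Finset.Icc r.1.1 r.1.2, lab a k)
      (fun r : ARoot (n - 1) => ∑ k ∈ Finset.Icc r.1.1 r.1.2, lab a (m + k))
  | C n, a => fun r : CRoot n => ∑ k ∈ Finset.Icc r.1.1 (n - 1), lab a (k + 1)
  | B n, a => fun r : CRoot n =>
      ∑ k ∈ Finset.Icc r.1.1 (n - 1), if k + 1 = n then lab a k / 2 else lab a k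
  | D21 α, a => ![corootValue (D21 α) a ![2, 1, 1], lab a 1, lab a 2]
  | F4, a => fun r : Option B3Root =>
      r.elim (corootValue F4 a ![2, 3, 2, 1]) fun _ => lab a 3 + 3 * lab a 2 + 2 * lab a 1
  | G3, a => fun r : Option G2Root =>
      r.elim (corootValue G3 a ![2, 4, 2]) fun _ => lab a 1 + 2 * lab a 2

theorem WeightIneq.le_evenBound : {τ : KFType} → {a : Fin τ.rank → ℂ} → {x : τ.EvenRoot → ℝ} →
    {y : τ.OddRoot → ℝ} → τ.WeightIneq a x y → 0 ≤ x → 0 ≤ y → x ≤ τ.evenBound a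
  | A _ _, _, _, _, h, hx, _ => fun
    | Sum.inl r => h.1.le (fun r => hx (Sum.inl r)) r
    | Sum.inr r => h.2.le (fun r => hx (Sum.inr r)) r
  | C _, _, _, _, h, hx, _ => fun r => DyckC.le h hx (fun _ => le_rfl) r
  | B n, a, x, y, h, hx, hy =>
    DyckC.le (n := n) (m := fun k => if k + 1 = n then lab a k / 2 else lab a k) (s := x)
      (t := fun j => if hj : j < n then y (⟨j, hj⟩ : Fin n) else 0) h hx (dite_fin_nonneg hy)
  | D21 _, _, _, _, h, _, hy => fun
    | (0 : Fin 3) =>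
      (le_add_of_nonneg_right (Finset.sum_nonneg fun o _ => hy o)).trans h.2.2
    | (1 : Fin 3) => h.1
    | (2 : Fin 3) => h.2.1
  | F4, _, _, _, h, hx, hy => fun
    | none => (le_add_of_nonneg_right (Finset.sum_nonneg fun o _ => hy o)).trans h.2
    | some r => h.1.le (fun r => hx (some r)) r
  | G3, _, _, _, h, hx, hy => fun
    | none => (le_add_of_nonneg_right (Finset.sum_nonneg fun o _ => hy o)).trans h.2
    | some r => h.1.le (fun r => hx (some r)) r

theorem isLowerSet_latticePoints (τ : KFType) (a : Fin τ.rank → ℂ) :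
    IsLowerSet (τ.latticePoints a) := by
  classical
  rintro ⟨I, m⟩ ⟨I', m'⟩ ⟨hI, hm⟩ ⟨-, -, h⟩
  refine ⟨?_, ?_, h.anti ?_ ?_⟩
  · rintro (r | o)
    · exact Nat.cast_nonneg _
    · exact Set.indicator_nonneg (fun _ _ => zero_le_one) o
  · exact Set.indicator_le_self' fun _ _ => zero_le_one
  · exact fun r => Nat.cast_le.2 (hm r)
  · exact Set.indicator_le_indicator_of_subset (Finset.coe_subset.2 hI) fun _ => zero_le_one

theorem finite_latticePoints (τ : KFType) (a : Fin τ.rank → ℂ) : (τ.latticePoints a).Finite := by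
  refine (Set.finite_univ.prod (Set.Finite.pi' fun r => Set.finite_Iic ⌊τ.evenBound a r⌋₊)).subset
    ?_
  rintro ⟨I, m⟩ ⟨h₀, -, h⟩
  exact ⟨trivial, fun r => Nat.le_floor
    (h.le_evenBound (fun r => h₀ (Sum.inl r)) (fun o => h₀ (Sum.inr o)) r)⟩

end KFType

end LatticePoints

end SuperToric

end

open SuperToric in
theorem mainTheorem2_general {E O : Type} {S : Set (Finset O × (E → ℕ))} (hS : IsLowerSet S)
    (hfin : S.Finite) : IsFaithfulToricSupervariety (MonomialSuperalgebra S) := by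
  have hV : {x : Option E | (∅, baseExponent x) ∈ S}.Finite :=
    hfin.preimage fun x _ y _ h => baseExponent_injective (Prod.ext_iff.1 h).2
  have hW : {o : O | ({o}, 0) ∈ S}.Finite :=
    hfin.preimage fun x _ y _ h => Finset.singleton_injective (Prod.ext_iff.1 h).1
  obtain ⟨p, k, hk, hkV⟩ := hV.fin_param
  obtain ⟨q, j, hj, hjW⟩ := hW.fin_param
  have hkS x : x ∈ Set.range k ↔ (∅, baseExponent x) ∈ S := hkV ▸ Iff.rfl
  have hjS o : o ∈ Set.range j ↔ ({o}, 0) ∈ S := hjW ▸ Iff.rfl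
  let T : Supertorus := ⟨p, q, 0, fun _ _ => rfl⟩
  exact isFaithfulToricSupervariety_of_isPrincipalLocalization (T := T) rfl
    (isPrincipalLocalization_monomialHom hS hk hj hkS hjS) mem_span_monomialHom_eq_single
    (oddDeriv_monomialHom_mem_range hS) (finiteType_monomialSuperalgebra hfin)

theorem mainTheorem2 (τ : SuperToric.KFType) (hτ : τ.Valid)
    {g : Type*} [AddCommGroup g] [Module ℂ g] [FiniteDimensional ℂ g]
    (L : SuperToric.LieSuperalgebra g) (hL : L.IsSimple)
    (R : SuperToric.ChevalleyGenerators τ L)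
    (lam : Module.Dual ℂ R.cartan) (hdom : R.IsDominantIntegral lam)
    (htyp : ∀ k : ℕ, 1 ≤ k → R.IsTypical ((k : ℂ) • lam)) :
    SuperToric.IsFaithfulToricSupervariety
      (SuperToric.MonomialSuperalgebra (τ.latticePoints (R.labels lam))) :=
  mainTheorem2_general (τ.isLowerSet_latticePoints (R.labels lam))
    (τ.finite_latticePoints (R.labels lam))
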